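/- Let $X_1,X_2,\ldots$ be i.i.d. with the symmetric Laplace density $\frac12 e^{-|x|}$, let $S_0=0$, $S_n=X_1+\cdots+X_n$, let $\tau^-=\inf\{n: S_n<0\}$ (almost surely finite), and let $\nu=\tau^- -1$; then $\mathbb P(\nu\ge m)>0$ for every $m$. Let $0=M_0\le M_1\le\cdots\le M_\nu$ be the order statistics of $S_0,\ldots,S_\nu$ and $\Delta_k=M_k-M_{k-1}$ for $1\le k\le\nu$. For $k\ge1$ let $Y_k$ be the number of excursions of $(S_i,\,0\le i\le\nu)$ above the level $M_{k-1}$, i.e. the number of $1\le i\le \nu$ with $S_{i-1}\le M_{k-1}<S_i$, if $k-1\le\nu$, and $Y_k=0$ if $k-1>\nu$. Let $P_0$ be the transition matrix of the simple symmetric random walk on $\{0,1,2,\ldots\}$ absorbed at $0$: $P_0(i,i\pm1)=\frac12$ for $i\ge1$, $P_0(0,0)=1$, and all other entries are $0$. 1. Conditionally on $\{\nu\ge1\}$, $(Y_k)_{k\ge1}$ is a homogeneous Markov chain with $Y_1=1$ and transition matrix $\frac12(I+P_0)$. 2. Let $k\ge1$. Conditionally on $\{\nu\ge1\}$ and on $(Y_1,\ldots,Y_k)=(y_1,\ldots,y_k)$,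 for any values with $y_k>0$ of positive probability, $\Delta_1,\ldots,\Delta_k$ are independent and $\Delta_j$ is exponential with rate $2y_j$. Consequently $$(\Delta_j,\,1\le j\le k\mid \nu\ge k)\stackrel{d}{=}\Big(\frac{\varepsilon_j}{2Y_j},\,1\le j\le k\,\Big|\,Y_k>0\Big),$$ where on the right $(Y_j)$ is a Markov chain as in 1 and $(\varepsilon_j)$ are i.i.d. standard exponential variables independent of $(Y_j)$. 3. The function $h(j)=j$ is harmonic for $\frac12(I+P_0)$. Let $Y^\uparrow$ be the Doob $h$-transform of $Y$, i.e. the homogeneous Markov chain with $Y^\uparrow_1=1$ and one-step transition probabilities $\frac12(I+P_0)(i,j)\,\frac ji$ for $i,j\ge1$. It stays in $\{1,2,\ldots\}$ almost surely, its $m$-step transition probabilities are $2^{-m}(I+P_0)^m(i,j)\,\frac ji$ for $i,j\ge1$, and for each fixed $k$, if $(\varepsilon_j)$ are i.i.d. standard exponential variables independent of $Y^\uparrow$, then $$(\Delta_j,\,1\le j\le k\mid\nu\ge m)\stackrel{d}{\longrightarrow}\Big(\frac{\varepsilon_j}{2Y^\uparrow_j},\,1\le j\le k\Big)\qquad\text{as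 } m\to\infty .$$ -/

import Mathlib

open MeasureTheory ProbabilityTheory Filter Topology Finset

noncomputable section

namespace LaplaceWalk

/-! ### The walk stopped before its first descending ladder time -/

/-- The symmetric Laplace distribution, with density `exp (-|x|) / 2`. -/
def laplaceMeasure : Measure ℝ :=
  volume.withDensity fun x => ENNReal.ofReal (1 / 2 * Real.exp (-|x|))

/-- The random walk `S_n = X_1 + ⋯ + X_n`, `S_0 = 0`; the increment `X_{i+1}` is `X i`. -/
def walk {Ω : Type*} (X : ℕ → Ω → ℝ) (n : ℕ) (ω : Ω) : ℝ :=
  ∑ i ∈ range n, X i ω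

/-- The first descending ladder time `τ⁻ = inf {n : S_n < 0}` (its value is `0` on the null event
that the walk never becomes negative). -/
def ladderTime {Ω : Type*} (X : ℕ → Ω → ℝ) (ω : Ω) : ℕ :=
  sInf {n : ℕ | walk X n ω < 0}

/-- `ν = τ⁻ - 1`, the last time before the first descending ladder time. -/
def lastTime {Ω : Type*} (X : ℕ → Ω → ℝ) (ω : Ω) : ℕ :=
  ladderTime X ω - 1

/-- The order statistic `M_k` of `S_0, …, S_ν`, for `0 ≤ k ≤ ν` (with `M_0` the smallest):
the least real `x` such that at least `k + 1` of the values `S_0, …, S_ν` are at most `x`. -/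
def orderStat {Ω : Type*} (X : ℕ → Ω → ℝ) (k : ℕ) (ω : Ω) : ℝ :=
  sInf {x : ℝ | k + 1 ≤ #{i ∈ range (lastTime X ω + 1) | walk X i ω ≤ x}}

/-- The spacing `Δ_{k+1} = M_{k+1} - M_k`, meaningful for `k + 1 ≤ ν`. -/
def spacing {Ω : Type*} (X : ℕ → Ω → ℝ) (k : ℕ) (ω : Ω) : ℝ :=
  orderStat X (k + 1) ω - orderStat X k ω

/-- The number of excursions of `S_0, …, S_ν` above the level `v`, that is, the number of
`1 ≤ i ≤ ν` with `S_{i-1} ≤ v < S_i`. -/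
def excursionsAbove {Ω : Type*} (X : ℕ → Ω → ℝ) (v : ℝ) (ω : Ω) : ℕ :=
  #{i ∈ range (lastTime X ω) | walk X i ω ≤ v ∧ v < walk X (i + 1) ω}

/-- `Y_{k+1}`, the number of excursions of `S_0, …, S_ν` above the level `M_k`; it is `0` when
`k > ν`, where there is no level `M_k` any more. -/
def excursionChain {Ω : Type*} (X : ℕ → Ω → ℝ) (k : ℕ) (ω : Ω) : ℕ :=
  if k ≤ lastTime X ω then excursionsAbove X (orderStat X k ω) ω else 0

/-! ### Markov chains on the nonnegative integers -/

/-- `(Y n)` is, under `μ`, a homogeneous Markov chain started at `y₀` with transition matrix `p`. -/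
structure IsMarkovChain {Ω : Type*} [MeasurableSpace Ω] (μ : Measure Ω) (Y : ℕ → Ω → ℕ)
    (y₀ : ℕ) (p : Matrix ℕ ℕ ℝ) : Prop where
  measurable : ∀ n, Measurable (Y n)
  initial : ∀ᵐ ω ∂μ, Y 0 ω = y₀
  transition : ∀ (n : ℕ) (y : ℕ → ℕ), μ {ω | ∀ i ≤ n, Y i ω = y i} ≠ 0 →
    ∀ b : ℕ, μ[|{ω | ∀ i ≤ n, Y i ω = y i}] {ω | Y (n + 1) ω = b} = ENNReal.ofReal (p (y n) b)

/-- Powers of an infinite matrix (all matrices used here have finitely supported rows). -/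
def matPow (p : Matrix ℕ ℕ ℝ) : ℕ → Matrix ℕ ℕ ℝ
  | 0 => 1
  | m + 1 => fun i j => ∑' l, p i l * matPow p m l j

/-- The transition matrix `P₀` of simple symmetric random walk on the nonnegative integers with
absorption at `0`. -/
def P₀ : Matrix ℕ ℕ ℝ := fun i j =>
  if i = 0 then (if j = 0 then 1 else 0)
  else if j = i + 1 ∨ j + 1 = i then 1 / 2 else 0

/-- The matrix `½ (I + P₀)`. -/
def lazyMatrix : Matrix ℕ ℕ ℝ := (1 / 2 : ℝ) • (1 + P₀)

/-- The one-step matrix `p(i,j) h(j) / h(i)` of the Doob `h`-transform of `p`. It is meaningful for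
states with `h i > 0`; a chain started at such a state almost surely visits only such states. -/
def doobTransform (p : Matrix ℕ ℕ ℝ) (h : ℕ → ℝ) : Matrix ℕ ℕ ℝ := fun i j =>
  p i j * h j / h i

end LaplaceWalk

end

namespace LaplaceWalk

open scoped ENNReal

/-! ### Splitting run lengths -/

/-! On the event that the walk first becomes negative at time `n + 1`, the last jump contributes the
tail `e^{-S_n} / 2`. Hence `(S_1, …, S_n)` has density `2^{-(n+1)} e^{-V}` on nonnegative paths,
where `V` is the total variation of the closed path `0, S_1, …, S_n, 0` (`measure_stoppedPath`).
Take a path that is positive exactly on `A ⊆ {1, …, n}`, with minimum `m` on `A` attained at `a`.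
Subtracting `m` on `A` leaves a path that is positive exactly on `A \ {a}`, up to ties, and lowers
`V` by `2 r m`, where `r` is the number of runs of `A`: each run has one edge going up from zero and
one going back down. Here `r` is the number of excursions above the current level and `m` is the
current spacing. Integrating over `m` therefore yields a factor `1 / (2 r)` and an exponential law
of rate `2 r`, decoupled from the rest of the path (`lmarginal_eq_sum_erase`, `profileMass_succ`).

What remains is the combinatorics of deleting the sites of `{1, …, n}` one by one, and only the run
lengths matter. Summation over `n` turns this into sums over all lists of positive run lengths.
Deleting an element of a run leaves two possibly empty pieces, so among all lists the number of runs
drops by one in one way, stays in two ways and grows by one in one way, for each of the `r` runs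
(`runSum_splitSum`). Divided by `4 r` this gives the entries `1/4, 1/2, 1/4` of `lazyMatrix`.

The total weight `q r` of all continuations from `r` runs is consequently discrete harmonic with `q
0 = 1`, hence affine in `r`. It is nonnegative, and `q 1 ≤ 1` because `(1 + q 1) / 2` is the
probability of a finite ladder time; so `q` is identically `1` (`eq_one_of_discrete_harmonic`). This
proves that the ladder time is almost surely finite and gives the joint law of counts and spacings
(`measure_excursionChain_spacing`): `1/2`, times the probability that the lazy chain follows the
path, times a product of exponential laws. The Markov property and the conditional independence can
be read off.

Almost surely `ν ≥ k` exactly when the `k`-th count is positive, so conditioning on a large `ν`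
reweights each path of counts by the survival probability of the lazy chain from its last state.
These probabilities are explicit binomial sums, and their ratios converge to the last state
(`tendsto_survival_ratio`), which is the Doob transform by `h(j) = j`. Only finitely many paths of
given length have positive weight, so the limit holds for every measurable set
(`tendsto_cond_spacing_mem`). -/

/-- The sum of `F` over all lists obtained from `L` by deleting one element of one of the runs
whose lengths are listed in `L`; the run splits into two (possibly empty) runs. -/
noncomputable def splitSum : (List ℕ → ℝ≥0∞) → List ℕ → ℝ≥0∞
  | _, [] => 0
  | F, l :: L => ∑ p ∈ range l, F (p :: (l - 1 - p) :: L) + splitSum (fun L' => F (l :: L')) L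

/-- The sum of `F` over all lists of `r` positive run lengths. -/
noncomputable def runSum : ℕ → (List ℕ → ℝ≥0∞) → ℝ≥0∞
  | 0, F => F []
  | r + 1, F => ∑' l : ℕ, runSum r (fun L => F ((l + 1) :: L))

/-- `F` does not see empty runs. -/
def IgnoresZeros (F : List ℕ → ℝ≥0∞) : Prop :=
  ∀ L, F (L.filter (· ≠ 0)) = F L

/-- The number of nonempty runs. -/
def runCount (L : List ℕ) : ℕ := (L.filter (· ≠ 0)).length

lemma IgnoresZeros.zero_cons {F : List ℕ → ℝ≥0∞} (hF : IgnoresZeros F) (L : List ℕ) :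
    F (0 :: L) = F L := by
  rw [← hF (0 :: L), ← hF L]; simp

lemma IgnoresZeros.cons {F : List ℕ → ℝ≥0∞} (hF : IgnoresZeros F) (l : ℕ) :
    IgnoresZeros fun L => F (l :: L) := by
  intro L
  change F (l :: L.filter (· ≠ 0)) = F (l :: L)
  rw [← hF, ← hF (l :: L)]
  by_cases h : l = 0 <;> simp [h]

/-- An empty run has no element to delete, so it contributes no summand of its own. -/
lemma IgnoresZeros.splitSum {F : List ℕ → ℝ≥0∞} (hF : IgnoresZeros F) :
    IgnoresZeros (splitSum F) := by
  intro L
  induction L generalizing F with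
  | nil => simp
  | cons l L ih =>
    by_cases h : l = 0
    · subst h
      have : (fun L' => F (0 :: L')) = F := funext hF.zero_cons
      have h1 := ih hF
      simp only [ne_eq, decide_not] at h1
      simp [LaplaceWalk.splitSum, this, h1]
    · have h1 := ih (hF.cons l)
      have h2 : ∀ p, F (p :: (l - 1 - p) :: L.filter (· ≠ 0)) = F (p :: (l - 1 - p) :: L) :=
        fun p => ((hF.cons p).cons (l - 1 - p)) L
      simp only [ne_eq, decide_not] at h1 h2
      simp [LaplaceWalk.splitSum, h, h1, h2]

lemma splitSum_congr {F G : List ℕ → ℝ≥0∞} (L : List ℕ)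
    (h : ∀ L' : List ℕ, L'.sum + 1 = L.sum → F L' = G L') : splitSum F L = splitSum G L := by
  induction L generalizing F G with
  | nil => simp [splitSum]
  | cons l L ih =>
    simp only [splitSum]
    congr 1
    · refine sum_congr rfl fun p hp => h _ ?_
      have := mem_range.1 hp
      simp; omega
    · exact ih fun L' hL' => h _ (by simp; omega)

lemma runSum_congr {r : ℕ} {F G : List ℕ → ℝ≥0∞}
    (h : ∀ L : List ℕ, L.length = r → (∀ l ∈ L, l ≠ 0) → F L = G L) : runSum r F = runSum r G := by
  induction r generalizing F G with
  | zero => exact h [] rfl (by simp)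
  | succ r ih =>
    simp only [runSum]
    refine tsum_congr fun l => ih fun L hL h0 => h _ (by simp [hL]) ?_
    simpa using h0

lemma runSum_add (r : ℕ) (F G : List ℕ → ℝ≥0∞) :
    runSum r (fun L => F L + G L) = runSum r F + runSum r G := by
  induction r generalizing F G with
  | zero => rfl
  | succ r ih => simp only [runSum, ih, ENNReal.tsum_add]

lemma runSum_zero (r : ℕ) : runSum r (fun _ => 0) = 0 := by
  induction r with
  | zero => rfl
  | succ r ih => simp [runSum, ih]

lemma runSum_sum {ι : Type*} (s : Finset ι) (r : ℕ) (F : ι → List ℕ → ℝ≥0∞) :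
    runSum r (fun L => ∑ i ∈ s, F i L) = ∑ i ∈ s, runSum r (F i) := by
  classical
  induction s using Finset.induction_on with
  | empty => simp [runSum_zero]
  | insert a s ha ih => simp [sum_insert ha, runSum_add, ih]

lemma runSum_const_mul (r : ℕ) (c : ℝ≥0∞) (F : List ℕ → ℝ≥0∞) :
    runSum r (fun L => c * F L) = c * runSum r F := by
  induction r generalizing F with
  | zero => rfl
  | succ r ih => simp only [runSum, ih, ENNReal.tsum_mul_left]

lemma tsum_sum_range_succ_eq (a : ℕ → ℕ → ℝ≥0∞) :
    ∑' l, ∑ p ∈ range (l + 1), a p (l - p) = ∑' p, ∑' q, a p q := by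
  rw [← ENNReal.tsum_prod,
    ← Equiv.tsum_eq (HasAntidiagonal.sigmaAntidiagonalEquivProd (A := ℕ)) (fun x : ℕ × ℕ => a x.1 x.2),
    ENNReal.tsum_sigma']
  refine tsum_congr fun l => ?_
  rw [tsum_fintype, ← Nat.sum_antidiagonal_eq_sum_range_succ a,
    ← Finset.sum_coe_sort (antidiagonal l)]
  rfl

/-- A first run of length `l + 1` loses one element and leaves lengths `p + q = l`, so every pair
`(p, q)` of naturals occurs once. The cases of two, one or no empty piece give `r`, `r + 1` (twice)
and `r + 2` nonempty runs. -/
lemma runSum_split_head {F : List ℕ → ℝ≥0∞} (hF : IgnoresZeros F) (r : ℕ) :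
    ∑' l : ℕ, runSum r (fun L => ∑ p ∈ range (l + 1), F (p :: (l - p) :: L)) =
      runSum r F + 2 * runSum (r + 1) F + runSum (r + 2) F := by
  have h0 : (fun L => F (0 :: L)) = F := funext hF.zero_cons
  have h1 : ∀ p, (fun L => F (p :: 0 :: L)) = fun L => F (p :: L) :=
    fun p => funext (hF.cons p).zero_cons
  have h2 : ∀ q, (fun L => F (0 :: q :: L)) = fun L => F (q :: L) :=
    fun q => funext fun L => hF.zero_cons _
  simp only [runSum_sum]
  rw [tsum_sum_range_succ_eq fun p q => runSum r fun L => F (p :: q :: L),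
    tsum_eq_zero_add' ENNReal.summable, tsum_eq_zero_add' ENNReal.summable]
  have h3 : ∀ p, ∑' q, runSum r (fun L => F ((p + 1) :: q :: L)) =
      runSum r (fun L => F ((p + 1) :: L)) +
        ∑' q, runSum r (fun L => F ((p + 1) :: (q + 1) :: L)) := by
    intro p
    rw [tsum_eq_zero_add' ENNReal.summable, h1]
  simp only [h3, ENNReal.tsum_add, h2, h0, runSum, two_mul]
  ring

/-- All `r + 1` runs contribute equally: the head by `runSum_split_head`, the others by induction
with the head frozen. The coefficients `1, 2, 1` are the origin of the lazy walk. -/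
theorem runSum_splitSum {F : List ℕ → ℝ≥0∞} (hF : IgnoresZeros F) (r : ℕ) :
    runSum (r + 1) (splitSum F) =
      (r + 1) * (runSum r F + 2 * runSum (r + 1) F + runSum (r + 2) F) := by
  induction r generalizing F with
  | zero =>
    rw [← runSum_split_head hF 0]
    simp [runSum, splitSum]
  | succ r ih =>
    have : ∀ l, runSum (r + 1) (fun L => splitSum F ((l + 1) :: L)) =
        runSum (r + 1) (fun L => ∑ p ∈ range (l + 1), F (p :: (l - p) :: L)) +
        (r + 1) * (runSum r (fun L => F ((l + 1) :: L)) +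
          2 * runSum (r + 1) (fun L => F ((l + 1) :: L)) +
          runSum (r + 2) (fun L => F ((l + 1) :: L))) := by
      intro l
      rw [← ih (hF.cons (l + 1)), ← runSum_add]
      simp [splitSum]
    rw [runSum]
    simp only [this, ENNReal.tsum_add, ENNReal.tsum_mul_left, runSum_split_head hF (r + 1)]
    rw [← runSum, ← runSum, ← runSum]
    push_cast
    ring

/-! ### The run lengths of a finite set -/

/-- The lengths of the runs of `A` in the window of `len` integers starting at `i`, the first run
being prolonged by `k` elements to the left of the window. -/
def runLengths (A : Finset ℕ) : ℕ → ℕ → ℕ → List ℕ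
  | k, _, 0 => [k]
  | k, i, len + 1 =>
    if i ∈ A then runLengths A (k + 1) (i + 1) len else k :: runLengths A 0 (i + 1) len

lemma runLengths_congr {A B : Finset ℕ} (k i len : ℕ) (h : ∀ j, i ≤ j → (j ∈ A ↔ j ∈ B)) :
    runLengths A k i len = runLengths B k i len := by
  induction len generalizing k i with
  | zero => rfl
  | succ len ih =>
    simp only [runLengths, h i le_rfl, ih _ (i + 1) fun j hj => h j (by omega)]

lemma filter_window_zero (A : Finset ℕ) (i : ℕ) :
    A.filter (fun a => i ≤ a ∧ a < i + 0) = ∅ := by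
  simp only [filter_eq_empty_iff]
  omega

lemma filter_window_of_mem {A : Finset ℕ} {i : ℕ} (hi : i ∈ A) (len : ℕ) :
    A.filter (fun a => i ≤ a ∧ a < i + (len + 1)) =
      insert i (A.filter (fun a => i + 1 ≤ a ∧ a < i + 1 + len)) := by
  ext a
  simp only [mem_filter, mem_insert]
  constructor
  · rintro ⟨h1, h2, h3⟩
    by_cases h : a = i
    · exact Or.inl h
    · exact Or.inr ⟨h1, by omega, by omega⟩
  · rintro (rfl | ⟨h1, h2, h3⟩)
    · exact ⟨hi, by omega, by omega⟩
    · exact ⟨h1, by omega, by omega⟩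

lemma filter_window_of_notMem {A : Finset ℕ} {i : ℕ} (hi : i ∉ A) (len : ℕ) :
    A.filter (fun a => i ≤ a ∧ a < i + (len + 1)) =
      A.filter (fun a => i + 1 ≤ a ∧ a < i + 1 + len) := by
  ext a
  simp only [mem_filter]
  constructor
  · rintro ⟨h1, h2, h3⟩
    have : a ≠ i := fun h => hi (h ▸ h1)
    exact ⟨h1, by omega, by omega⟩
  · rintro ⟨h1, h2, h3⟩
    exact ⟨h1, by omega, by omega⟩

/-- The second sum accounts for deletions among the `k` elements already absorbed to the left of the
window. With it the statement is stable when the window shrinks from the left. -/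
lemma sum_runLengths_erase (A : Finset ℕ) (k i len : ℕ) (F : List ℕ → ℝ≥0∞) :
    ∑ a ∈ A.filter (fun a => i ≤ a ∧ a < i + len), F (runLengths (A.erase a) k i len) +
      ∑ p ∈ range k, F (p :: runLengths A (k - 1 - p) i len) =
    splitSum F (runLengths A k i len) := by
  induction len generalizing k i F with
  | zero =>
    rw [filter_window_zero]
    simp [runLengths, splitSum]
  | succ len ih =>
    by_cases hi : i ∈ A
    · rw [filter_window_of_mem hi, sum_insert (by simp)]
      have h1 : runLengths (A.erase i) k i (len + 1) = k :: runLengths A 0 (i + 1) len := by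
        simp only [runLengths, mem_erase, ne_eq, not_true_eq_false, false_and, if_false]
        rw [runLengths_congr]
        intro j hj
        simp; omega
      have h2 : ∀ a ∈ A.filter (fun a => i + 1 ≤ a ∧ a < i + 1 + len),
          F (runLengths (A.erase a) k i (len + 1)) =
            F (runLengths (A.erase a) (k + 1) (i + 1) len) := by
        intro a ha
        have := (mem_filter.1 ha).2.1
        have hia : i ∈ A.erase a := mem_erase.2 ⟨by omega, hi⟩
        simp [runLengths, hia]
      have h3 : ∀ p ∈ range k, F (p :: runLengths A (k - 1 - p) i (len + 1)) =
          F (p :: runLengths A (k + 1 - 1 - p) (i + 1) len) := by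
        intro p hp
        have := mem_range.1 hp
        have e : k - 1 - p + 1 = k + 1 - 1 - p := by omega
        simp only [runLengths, hi, if_true, e]
      rw [h1, sum_congr rfl h2, sum_congr rfl h3]
      simp only [runLengths, hi, if_true]
      -- The last summand `p = k` is the deletion of `i` itself, now the newest absorbed element.
      rw [← ih, sum_range_succ]
      simp only [Nat.add_sub_cancel, Nat.sub_self]
      ring
    · rw [filter_window_of_notMem hi]
      simp only [runLengths, hi, if_false, splitSum, mem_erase, and_false]
      rw [← ih]
      simp
      ring

lemma sum_runLengths (A : Finset ℕ) (k i len : ℕ) :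
    (runLengths A k i len).sum = k + #(A.filter (fun a => i ≤ a ∧ a < i + len)) := by
  induction len generalizing k i with
  | zero =>
    rw [filter_window_zero]
    simp [runLengths]
  | succ len ih =>
    by_cases hi : i ∈ A
    · rw [filter_window_of_mem hi, card_insert_of_notMem (by simp)]
      simp only [runLengths, hi, if_true, ih]
      omega
    · rw [filter_window_of_notMem hi]
      simp [runLengths, hi, ih]

/-- Runs are counted by their left ends. The run containing `i` started outside the window, hence
the separate term; `hk` says that the accumulator is nonempty exactly when there is such a run. -/
lemma runCount_runLengths (A : Finset ℕ) (k i len : ℕ) (hk : 0 < k ↔ i ∈ A) :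
    runCount (runLengths A k (i + 1) len) =
      (if i ∈ A then 1 else 0) +
        ∑ x ∈ range len, if i + x ∉ A ∧ i + x + 1 ∈ A then 1 else 0 := by
  induction len generalizing k i with
  | zero =>
    by_cases h : i ∈ A
    · simp [runLengths, runCount, h, (hk.2 h).ne']
    · have : k = 0 := by by_contra h0; exact h (hk.1 (Nat.pos_of_ne_zero h0))
      simp [runLengths, runCount, h, this]
  | succ len ih =>
    rw [sum_range_succ']
    have e : ∀ x, i + (x + 1) = i + 1 + x := fun x => by ring
    have hs : (∑ x ∈ range len, if i + (x + 1) ∉ A ∧ i + (x + 1) + 1 ∈ A then 1 else 0) =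
        ∑ x ∈ range len, if i + 1 + x ∉ A ∧ i + 1 + x + 1 ∈ A then 1 else 0 :=
      sum_congr rfl fun x _ => by rw [e]
    rw [hs]
    simp only [runLengths, Nat.add_zero]
    by_cases h1 : i + 1 ∈ A
    · rw [if_pos h1, ih (k + 1) (i + 1) (by simp [h1])]
      by_cases h : i ∈ A <;> simp [h, h1, add_comm]
    · have h2 := ih 0 (i + 1) (by simp [h1])
      simp only [h1, if_false, and_false, add_zero, zero_add] at h2 ⊢
      rw [← h2]
      by_cases h : i ∈ A
      · simp [runCount, h, (hk.2 h).ne', add_comm]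
      · have : k = 0 := by by_contra h0; exact h (hk.1 (Nat.pos_of_ne_zero h0))
        simp [runCount, h, this]

/-! ### Integration over positive paths -/

/-- Lebesgue measure on the positive half-line, in each coordinate. -/
noncomputable abbrev halfLine (_ : ℕ) : Measure ℝ := volume.restrict (Set.Ioi 0)

/-- Adding `m` to the coordinates in `B`. -/
noncomputable def raise (B : Finset ℕ) (m : ℝ) (s : ℕ → ℝ) (i : ℕ) : ℝ :=
  if i ∈ B then m + s i else s i

lemma measurable_raise (B : Finset ℕ) : Measurable fun p : ℝ × (ℕ → ℝ) => raise B p.1 p.2 := by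
  refine measurable_pi_lambda _ fun i => ?_
  by_cases h : i ∈ B
  · simp only [raise, h, if_true]; fun_prop
  · simp only [raise, h, if_false]; fun_prop

lemma setLIntegral_Ioi_indicator_eq_shift {m : ℝ} (hm : 0 < m) {I : Set ℝ}
    (hI : I = Set.Ioi m ∨ I = Set.Ici m) (f : ℝ → ℝ≥0∞) :
    ∫⁻ t in Set.Ioi 0, f t * I.indicator 1 t = ∫⁻ t in Set.Ioi 0, f (m + t) := by
  have hIm : MeasurableSet I := by rcases hI with rfl | rfl <;> measurability
  have h1 : ∀ t, f t * I.indicator 1 t = I.indicator f t := by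
    intro t; by_cases h : t ∈ I <;> simp [h]
  simp only [h1]
  rw [lintegral_indicator hIm, Measure.restrict_restrict hIm]
  have h2 : I ∩ Set.Ioi 0 = I := by
    rw [Set.inter_eq_left]
    rcases hI with rfl | rfl
    · exact Set.Ioi_subset_Ioi hm.le
    · exact Set.Ici_subset_Ioi.2 hm
  have h3 : volume.restrict I = volume.restrict (Set.Ioi m) := by
    rcases hI with rfl | rfl
    · rfl
    · exact Measure.restrict_congr_set Ioi_ae_eq_Ici.symm
  rw [h2, h3, ← lintegral_indicator measurableSet_Ioi, ← lintegral_indicator measurableSet_Ioi,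
    ← lintegral_add_left_eq_self _ m]
  refine lintegral_congr fun t => ?_
  by_cases h : 0 < t <;> simp [Set.indicator, h]

/-- Coordinate by coordinate, the part of the half-line above `m` is a translate of the half-line.
Open and closed rays are both admitted because ties for the minimum are broken by index; they differ
by a null set. -/
lemma lmarginal_mul_indicator_eq_raise (B : Finset ℕ) {m : ℝ} (hm : 0 < m) (I : ℕ → Set ℝ)
    (hI : ∀ b, I b = Set.Ioi m ∨ I b = Set.Ici m) {F : (ℕ → ℝ) → ℝ≥0∞} (hF : Measurable F)
    (x : ℕ → ℝ) :
    (∫⋯∫⁻_B, (fun s => F s * ∏ b ∈ B, (I b).indicator 1 (s b)) ∂halfLine) x =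
      (∫⋯∫⁻_B, (fun s => F (raise B m s)) ∂halfLine) x := by
  have hIm : ∀ b, MeasurableSet (I b) := fun b => by
    rcases hI b with h | h <;> rw [h] <;> measurability
  have hr : ∀ B, Measurable (raise B m) := fun B =>
    (measurable_raise B).comp (measurable_const.prodMk measurable_id)
  induction B using Finset.induction_on generalizing F with
  | empty => simp; rfl
  | insert b B hb ih =>
    have hprod : Measurable fun s : ℕ → ℝ => ∏ b ∈ insert b B, (I b).indicator (1 : ℝ → ℝ≥0∞) (s b) :=
      Finset.measurable_prod _ fun i _ =>
        (measurable_one.indicator (hIm i)).comp (measurable_pi_apply i)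
    have hm1 : Measurable fun s : ℕ → ℝ =>
        F s * ∏ b ∈ insert b B, (I b).indicator (1 : ℝ → ℝ≥0∞) (s b) := hF.mul hprod
    have hm2 : Measurable fun s : ℕ → ℝ => F (raise (insert b B) m s) := hF.comp (hr _)
    rw [lmarginal_insert' _ hm1 hb, lmarginal_insert' _ hm2 hb]
    have h1 : ∀ s : ℕ → ℝ, ∫⁻ t, F (Function.update s b t) *
        ∏ c ∈ insert b B, (I c).indicator 1 (Function.update s b t c) ∂halfLine b =
        (∫⁻ t in Set.Ioi 0, F (Function.update s b (m + t))) *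
          ∏ c ∈ B, (I c).indicator (1 : ℝ → ℝ≥0∞) (s c) := by
      intro s
      have h2 : ∀ t, ∏ c ∈ insert b B, (I c).indicator (1 : ℝ → ℝ≥0∞) (Function.update s b t c) =
          (I b).indicator 1 t * ∏ c ∈ B, (I c).indicator 1 (s c) := by
        intro t
        rw [prod_insert hb, Function.update_self]
        congr 1
        refine prod_congr rfl fun c hc => ?_
        rw [Function.update_of_ne (ne_of_mem_of_not_mem hc hb)]
      simp only [h2, ← mul_assoc]
      rw [lintegral_mul_const, setLIntegral_Ioi_indicator_eq_shift hm (hI b) fun t =>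
        F (Function.update s b t)]
      exact (hF.comp (measurable_update s)).mul (measurable_one.indicator (hIm b))
    simp only [h1]
    have hG : Measurable fun s : ℕ → ℝ => ∫⁻ t in Set.Ioi 0, F (Function.update s b (m + t)) := by
      refine Measurable.lintegral_prod_right (f := fun s t => F (Function.update s b (m + t)))
        (hF.comp ?_)
      exact measurable_update'.comp (measurable_fst.prodMk (measurable_const.add measurable_snd))
    rw [ih hG]
    congr 1
    ext s
    refine lintegral_congr fun t => ?_
    congr 1
    ext i
    by_cases hib : i = b
    · subst hib; simp [raise]
    · by_cases hi : i ∈ B <;> simp [raise, hib, hi]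

/-- `a` is the place of the minimum of `s` on `A`, the first one in case of ties. -/
def IsFirstMin (A : Finset ℕ) (s : ℕ → ℝ) (a : ℕ) : Prop :=
  ∀ b ∈ A.erase a, if b < a then s a < s b else s a ≤ s b

lemma existsUnique_isFirstMin {A : Finset ℕ} (hA : A.Nonempty) (s : ℕ → ℝ) :
    ∃! a, a ∈ A ∧ IsFirstMin A s a := by
  -- Minimising the pair (value, index) lexicographically selects the first minimum.
  obtain ⟨a, ha, hmin⟩ := A.exists_min_image (fun b => toLex (s b, b)) hA
  refine ⟨a, ⟨ha, fun b hb => ?_⟩, fun c ⟨hc, hcm⟩ => ?_⟩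
  · have hb' := mem_erase.1 hb
    have h := Prod.Lex.toLex_le_toLex.1 (hmin b hb'.2)
    split_ifs with hlt
    · rcases h with h | ⟨_, h⟩
      · exact h
      · simp only at h; omega
    · rcases h with h | ⟨h, _⟩
      · exact h.le
      · exact h.le
  · by_contra hne
    have h1 := hcm a (mem_erase.2 ⟨fun h => hne h.symm, ha⟩)
    have h := Prod.Lex.toLex_le_toLex.1 (hmin c hc)
    simp only at h
    split_ifs at h1 with hlt
    · rcases h with h | ⟨h, h'⟩
      · exact absurd h1 (not_lt.2 h.le)
      · exact absurd h1 (not_lt.2 h.le)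
    · rcases h with h | ⟨h, h'⟩
      · exact absurd h1 (not_le.2 h)
      · omega

/-- Exactly one site is the first minimum. The tie-breaking makes the identity hold at every `s`, so
no null set of ties has to be discarded. -/
lemma sum_prod_indicator_min {A : Finset ℕ} (hA : A.Nonempty) (s : ℕ → ℝ) :
    ∑ a ∈ A, ∏ b ∈ A.erase a,
      (if b < a then Set.Ioi (s a) else Set.Ici (s a)).indicator (1 : ℝ → ℝ≥0∞) (s b) = 1 := by
  obtain ⟨a, ⟨ha, hmin⟩, huniq⟩ := existsUnique_isFirstMin hA s
  rw [sum_eq_single_of_mem a ha]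
  · refine prod_eq_one fun b hb => ?_
    have := hmin b hb
    split_ifs at this ⊢ <;> simp [this]
  · intro c hc hca
    by_contra hne
    refine hca (huniq c ⟨hc, fun b hb => ?_⟩)
    have := Finset.prod_ne_zero_iff.1 hne b hb
    split_ifs at this ⊢ <;> simpa [Set.indicator] using this

/-- Decomposition of an integral over positive paths according to the minimum of the path. -/
theorem lmarginal_eq_sum_erase {A : Finset ℕ} (hA : A.Nonempty) {F : (ℕ → ℝ) → ℝ≥0∞}
    (hF : Measurable F) :
    (∫⋯∫⁻_A, F ∂halfLine) 0 = ∑ a ∈ A, ∫⁻ m in Set.Ioi 0,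
      (∫⋯∫⁻_(A.erase a), (fun s => F (raise A m s)) ∂halfLine) 0 := by
  set I : ℕ → ℝ → ℕ → Set ℝ := fun a m b => if b < a then Set.Ioi m else Set.Ici m with hIdef
  have hmeas : ∀ a, Measurable fun s : ℕ → ℝ =>
      F s * ∏ b ∈ A.erase a, (I a (s a) b).indicator (1 : ℝ → ℝ≥0∞) (s b) := by
    intro a
    refine hF.mul (Finset.measurable_prod _ fun b _ => ?_)
    have hset : MeasurableSet {s : ℕ → ℝ | s b ∈ I a (s a) b} := by
      simp only [hIdef]
      split_ifs
      · exact measurableSet_lt (measurable_pi_apply a) (measurable_pi_apply b)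
      · exact measurableSet_le (measurable_pi_apply a) (measurable_pi_apply b)
    exact measurable_one.indicator hset
  have hsplit : F = fun s => ∑ a ∈ A,
      F s * ∏ b ∈ A.erase a, (I a (s a) b).indicator (1 : ℝ → ℝ≥0∞) (s b) := by
    ext s
    rw [← mul_sum, sum_prod_indicator_min hA, mul_one]
  have hsum : (∫⋯∫⁻_A, F ∂halfLine) 0 = ∑ a ∈ A, (∫⋯∫⁻_A, (fun s : ℕ → ℝ =>
      F s * ∏ b ∈ A.erase a, (I a (s a) b).indicator (1 : ℝ → ℝ≥0∞) (s b)) ∂halfLine) 0 := by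
    conv_lhs => rw [hsplit]
    exact lintegral_finsetSum A fun a _ => (hmeas a).comp measurable_updateFinset
  rw [hsum]
  refine sum_congr rfl fun a ha => ?_
  have hins : insert a (A.erase a) = A := insert_erase ha
  have hna : a ∉ A.erase a := by simp
  have h1 := lmarginal_insert (μ := halfLine) _ (hmeas a) hna (0 : ℕ → ℝ)
  rw [hins] at h1
  rw [h1]
  refine setLIntegral_congr_fun measurableSet_Ioi fun m hm => ?_
  rw [lmarginal_update_of_notMem (hmeas a) hna 0 m]
  have h3 : ((fun s : ℕ → ℝ => F s * ∏ b ∈ A.erase a,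
      (I a (s a) b).indicator (1 : ℝ → ℝ≥0∞) (s b)) ∘ fun s => Function.update s a m) =
      fun s => F (Function.update s a m) *
        ∏ b ∈ A.erase a, (I a m b).indicator (1 : ℝ → ℝ≥0∞) (s b) := by
    ext s
    simp only [Function.comp_apply]
    congr 1
    refine prod_congr rfl fun b hb => ?_
    rw [Function.update_self, Function.update_of_ne (mem_erase.1 hb).1]
  have hFu : Measurable fun s : ℕ → ℝ => F (Function.update s a m) :=
    hF.comp (measurable_update'.comp (measurable_id.prodMk measurable_const))
  rw [h3, lmarginal_mul_indicator_eq_raise (A.erase a) hm (I a m)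
    (fun b => by simp only [hIdef]; split_ifs <;> simp) hFu]
  -- Coordinate `a` is no longer integrated and keeps the value `0` of the base point, so fixing it
  -- at `m` agrees with raising it by `m`.
  have h4 : ∀ s : ℕ → ℝ, s a = 0 →
      F (Function.update (raise (A.erase a) m s) a m) = F (raise A m s) := by
    intro s hs
    congr 1
    ext i
    by_cases hi : i = a
    · subst hi; simp [raise, ha, hs]
    · by_cases hiA : i ∈ A <;> simp [raise, hi, hiA]
  simp only [lmarginal]
  refine lintegral_congr fun y => h4 _ ?_
  simp [Function.updateFinset_def]

/-- Integrals over positive paths only see paths that are positive on `B` and zero off `B`. -/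
lemma lmarginal_halfLine_congr {B : Finset ℕ} {F G : (ℕ → ℝ) → ℝ≥0∞}
    (h : ∀ s : ℕ → ℝ, (∀ i ∈ B, 0 < s i) → (∀ i ∉ B, s i = 0) → F s = G s) :
    (∫⋯∫⁻_B, F ∂halfLine) 0 = (∫⋯∫⁻_B, G ∂halfLine) 0 := by
  simp only [lmarginal]
  refine lintegral_congr_ae ?_
  have hpos : ∀ᵐ y ∂(Measure.pi fun i : B => halfLine i), ∀ i, 0 < y i := by
    rw [ae_all_iff]
    intro i
    have h0 : ∀ᵐ t ∂(halfLine i), (0 : ℝ) < t := ae_restrict_mem measurableSet_Ioi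
    exact (Measure.quasiMeasurePreserving_eval (fun i : B => halfLine i) i).ae h0
  filter_upwards [hpos] with y hy
  refine h _ (fun i hi => ?_) fun i hi => ?_
  · simpa [Function.updateFinset_def, hi] using hy ⟨i, hi⟩
  · simp [Function.updateFinset_def, hi]

lemma lmarginal_const_mul {B : Finset ℕ} (c : ℝ≥0∞) {F : (ℕ → ℝ) → ℝ≥0∞} (hF : Measurable F)
    (x : ℕ → ℝ) :
    (∫⋯∫⁻_B, (fun s => c * F s) ∂halfLine) x = c * (∫⋯∫⁻_B, F ∂halfLine) x := by
  simp only [lmarginal]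
  exact lintegral_const_mul _ (hF.comp measurable_updateFinset)

/-! ### Order statistics -/

/-- The levels below or at which `s` has at least `k + 1` of its values on `B`. -/
def levelSet (B : Finset ℕ) (k : ℕ) (s : ℕ → ℝ) : Set ℝ :=
  {x | k + 1 ≤ #{i ∈ B | s i ≤ x}}

/-- At least `k + 1` values are at most `x` iff this holds for all sites of some subset of size `k +
1`, which gives a finite union of closed sets. Closedness makes the infimum defining the order
statistic attained. -/
lemma isClosed_levelSet (B : Finset ℕ) (k : ℕ) (s : ℕ → ℝ) : IsClosed (levelSet B k s) := by
  have : levelSet B k s = ⋃ T ∈ (powersetCard (k + 1) B : Finset (Finset ℕ)),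
      ⋂ i ∈ T, Set.Ici (s i) := by
    ext x
    simp only [levelSet, Set.mem_ofPred_eq, Set.mem_iUnion, Set.mem_iInter, Set.mem_Ici,
      mem_powersetCard, exists_prop]
    constructor
    · intro h
      obtain ⟨T, hT, hcard⟩ := exists_subset_card_eq h
      exact ⟨T, ⟨hT.trans (filter_subset _ _), hcard⟩, fun i hi => (mem_filter.1 (hT hi)).2⟩
    · rintro ⟨T, ⟨hT, hcard⟩, h⟩
      rw [← hcard]
      exact card_le_card fun i hi => mem_filter.2 ⟨hT hi, h i hi⟩
  rw [this]
  exact Set.Finite.isClosed_biUnion (Finset.finite_toSet _) fun T _ =>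
    isClosed_biInter fun i _ => isClosed_Ici

lemma levelSet_nonempty {B : Finset ℕ} {k : ℕ} (hk : k < #B) (s : ℕ → ℝ) :
    (levelSet B k s).Nonempty := by
  have hB : B.Nonempty := card_pos.1 (by omega)
  refine ⟨B.sup' hB s, ?_⟩
  have : {i ∈ B | s i ≤ B.sup' hB s} = B := filter_true_of_mem fun i hi => le_sup' s hi
  simp only [levelSet, Set.mem_ofPred_eq, this]
  exact hk

lemma bddBelow_levelSet (B : Finset ℕ) (k : ℕ) (s : ℕ → ℝ) : BddBelow (levelSet B k s) := by
  obtain ⟨c, hc⟩ := (B.finite_toSet.image s).bddBelow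
  refine ⟨c, fun x hx => ?_⟩
  have : 0 < #{i ∈ B | s i ≤ x} := lt_of_lt_of_le (Nat.succ_pos k) hx
  obtain ⟨i, hi⟩ := card_pos.1 this
  have hi' := mem_filter.1 hi
  exact (hc ⟨i, hi'.1, rfl⟩).trans hi'.2

lemma sInf_levelSet_le_iff {B : Finset ℕ} {k : ℕ} (hk : k < #B) (s : ℕ → ℝ) (x : ℝ) :
    sInf (levelSet B k s) ≤ x ↔ k + 1 ≤ #{i ∈ B | s i ≤ x} := by
  constructor
  · intro h
    have hm := (isClosed_levelSet B k s).csInf_mem (levelSet_nonempty hk s)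
      (bddBelow_levelSet B k s)
    refine le_trans hm (card_le_card fun i hi => ?_)
    have hi' := mem_filter.1 hi
    exact mem_filter.2 ⟨hi'.1, hi'.2.trans h⟩
  · exact fun h => csInf_le (bddBelow_levelSet B k s) h

lemma measurableSet_le_card_filter {α : Type*} [MeasurableSpace α] (B : Finset ℕ) (k : ℕ)
    {s : α → ℕ → ℝ} (hs : Measurable s) (x : ℝ) :
    MeasurableSet {a | k ≤ #{i ∈ B | s a i ≤ x}} := by
  simp only [card_filter]
  refine measurableSet_le measurable_const (Finset.measurable_sum _ fun i _ => ?_)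
  exact Measurable.ite (measurableSet_le ((measurable_pi_apply i).comp hs) measurable_const)
    measurable_const measurable_const

lemma measurable_sInf_levelSet (B : Finset ℕ) (k : ℕ) :
    Measurable fun s : ℕ → ℝ => sInf (levelSet B k s) := by
  by_cases hk : k < #B
  · refine measurable_of_Iic fun x => ?_
    have : (fun s : ℕ → ℝ => sInf (levelSet B k s)) ⁻¹' Set.Iic x =
        {s | k + 1 ≤ #{i ∈ B | s i ≤ x}} := by
      ext s; exact sInf_levelSet_le_iff hk s x
    rw [this]
    exact measurableSet_le_card_filter B (k + 1) measurable_id x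
  · have : ∀ s : ℕ → ℝ, levelSet B k s = ∅ := fun s => by
      ext x
      have := card_filter_le B fun i => s i ≤ x
      simp only [levelSet, Set.mem_ofPred_eq, Set.mem_empty_iff_false, iff_false]
      omega
    simp only [this]
    exact measurable_const

/-! ### Functionals of positive paths -/

/-- The `k`-th order statistic of the values of the path `s` at `0` and on `A`. -/
noncomputable def pathOrder (A : Finset ℕ) (k : ℕ) (s : ℕ → ℝ) : ℝ :=
  sInf (levelSet (insert 0 A) k s)

/-- The number of upcrossings of the level `v` by `s` before time `n`. -/
noncomputable def crossings (n : ℕ) (v : ℝ) (s : ℕ → ℝ) : ℕ :=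
  #{i ∈ range n | s i ≤ v ∧ v < s (i + 1)}

/-- The total variation of `s` up to time `n + 1`. -/
noncomputable def totalVar (n : ℕ) (s : ℕ → ℝ) : ℝ :=
  ∑ i ∈ range (n + 1), |s (i + 1) - s i|

/-- The number of runs of `A` that start in `{1, …, n}`. -/
def runs (n : ℕ) (A : Finset ℕ) : ℕ := #{i ∈ range n | i ∉ A ∧ i + 1 ∈ A}

/-- The path `s` is positive on `A` and zero off `A`. -/
def IsPositiveOn (A : Finset ℕ) (s : ℕ → ℝ) : Prop :=
  (∀ i ∈ A, 0 < s i) ∧ ∀ i ∉ A, s i = 0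

lemma IsPositiveOn.nonneg {A : Finset ℕ} {s : ℕ → ℝ} (hs : IsPositiveOn A s) (i : ℕ) :
    0 ≤ s i := by
  by_cases h : i ∈ A
  · exact (hs.1 i h).le
  · exact (hs.2 i h).ge

lemma IsPositiveOn.raise {A : Finset ℕ} {a : ℕ} {s : ℕ → ℝ}
    (hs : IsPositiveOn (A.erase a) s) {m : ℝ} (hm : 0 < m) : IsPositiveOn A (raise A m s) := by
  refine ⟨fun i hi => ?_, fun i hi => ?_⟩
  · have := hs.nonneg i
    simp only [LaplaceWalk.raise, hi, if_true]
    linarith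
  · simp only [LaplaceWalk.raise, hi, if_false]
    exact hs.2 i fun h => hi (mem_of_mem_erase h)

lemma measurable_pathOrder (A : Finset ℕ) (k : ℕ) : Measurable (pathOrder A k) :=
  measurable_sInf_levelSet _ _

lemma measurable_crossings (n : ℕ) {α : Type*} [MeasurableSpace α] {v : α → ℝ} {s : α → ℕ → ℝ}
    (hv : Measurable v) (hs : Measurable s) : Measurable fun a => crossings n (v a) (s a) := by
  simp only [crossings, card_filter]
  refine Finset.measurable_sum _ fun i _ => ?_
  exact Measurable.ite ((measurableSet_le ((measurable_pi_apply i).comp hs) hv).inter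
    (measurableSet_lt hv ((measurable_pi_apply (i + 1)).comp hs))) measurable_const measurable_const

lemma measurable_totalVar (n : ℕ) : Measurable (totalVar n) := by
  refine Finset.measurable_sum _ fun i _ => ?_
  have h1 : Measurable fun s : ℕ → ℝ => s (i + 1) - s i := by fun_prop
  exact h1.abs

lemma pathOrder_zero {A : Finset ℕ} {s : ℕ → ℝ} (hs : IsPositiveOn A s) (h0 : 0 ∉ A) :
    pathOrder A 0 s = 0 := by
  have : levelSet (insert 0 A) 0 s = Set.Ici 0 := by
    ext x
    simp only [levelSet, Set.mem_ofPred_eq, zero_add, Set.mem_Ici, Nat.succ_le_iff, card_pos]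
    constructor
    · rintro ⟨i, hi⟩
      exact (hs.nonneg i).trans (mem_filter.1 hi).2
    · intro hx
      exact ⟨0, mem_filter.2 ⟨mem_insert_self _ _, by rwa [hs.2 0 h0]⟩⟩
  rw [pathOrder, this, csInf_Ici]

lemma pathOrder_nonneg {A : Finset ℕ} {s : ℕ → ℝ} (hs : IsPositiveOn A s) (k : ℕ) :
    0 ≤ pathOrder A k s := by
  refine Real.sInf_nonneg fun x hx => ?_
  have : 0 < #{i ∈ insert 0 A | s i ≤ x} := lt_of_lt_of_le (Nat.succ_pos k) hx
  obtain ⟨i, hi⟩ := card_pos.1 this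
  exact (hs.nonneg i).trans (mem_filter.1 hi).2

/-- Site `0` stays at height `0`, whereas `a` moves from `0` to `m` together with the rest of `A`.
So for `x ≥ m` the raised path has exactly one more value up to `x` than `s` has up to `x - m`, and
ranks shift by one. -/
lemma pathOrder_raise {A : Finset ℕ} {a : ℕ} (ha : a ∈ A) (h0 : 0 ∉ A) {s : ℕ → ℝ}
    (hs : IsPositiveOn (A.erase a) s) {m : ℝ} (hm : 0 < m) {k : ℕ} (hk : k < #A) :
    pathOrder A (k + 1) (raise A m s) = m + pathOrder (A.erase a) k s := by
  have hmem : ∀ x, x ∈ levelSet (insert 0 A) (k + 1) (raise A m s) ↔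
      x - m ∈ levelSet (insert 0 (A.erase a)) k s := by
    intro x
    simp only [levelSet, Set.mem_ofPred_eq]
    by_cases hx : m ≤ x
    · have : {i ∈ insert 0 A | raise A m s i ≤ x} =
          insert a {i ∈ insert 0 (A.erase a) | s i ≤ x - m} := by
        ext i
        simp only [mem_filter, mem_insert, mem_erase]
        have hsa : s a = 0 := hs.2 a (by simp)
        have hs0 : s 0 = 0 := hs.2 0 fun h => h0 (mem_of_mem_erase h)
        by_cases hi : i ∈ A
        · have hi0 : i ≠ 0 := fun h => h0 (h ▸ hi)
          by_cases hia : i = a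
          · subst hia
            simp [raise, hi, hsa, hx]
          · simp only [raise, hi, if_true, hi0, hia, or_true, true_and, false_or, not_false_eq_true,
              ne_eq, and_self]
            constructor <;> intro h <;> linarith
        · have hia : i ≠ a := fun h => hi (h ▸ ha)
          by_cases hi0 : i = 0
          · subst hi0
            simp only [raise, hi, if_false, hs0]
            simp only [true_or, true_and, hia, false_or]
            constructor <;> intro h <;> linarith
          · simp [hi, hi0, hia]
      have hna : a ∉ {i ∈ insert 0 (A.erase a) | s i ≤ x - m} := by
        have : a ≠ 0 := fun h => h0 (h ▸ ha)
        simp [this]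
      rw [this, card_insert_of_notMem hna]
      omega
    -- Below `m` only site `0` can remain, so neither count reaches its threshold.
    · have h1 : #{i ∈ insert 0 A | raise A m s i ≤ x} ≤ 1 := by
        refine card_le_one.2 fun i hi j hj => ?_
        have key : ∀ i ∈ insert 0 A, raise A m s i ≤ x → i = 0 := by
          intro i hi hix
          by_contra hi0
          have hiA : i ∈ A := (mem_insert.1 hi).resolve_left hi0
          have := hs.nonneg i
          simp only [raise, hiA, if_true] at hix
          linarith
        rw [key i (mem_filter.1 hi).1 (mem_filter.1 hi).2,
          key j (mem_filter.1 hj).1 (mem_filter.1 hj).2]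
      have h2 : #{i ∈ insert 0 (A.erase a) | s i ≤ x - m} = 0 := by
        rw [card_eq_zero, filter_eq_empty_iff]
        intro i _
        have := hs.nonneg i
        linarith
      omega
  have hcard : k < #(insert 0 (A.erase a)) := by
    rw [card_insert_of_notMem fun h => h0 (mem_of_mem_erase h), card_erase_of_mem ha]
    omega
  have hcard' : k + 1 < #(insert 0 A) := by
    rw [card_insert_of_notMem h0]; omega
  refine eq_of_forall_ge_iff fun x => ?_
  rw [pathOrder, sInf_levelSet_le_iff hcard', ← le_sub_iff_add_le', pathOrder,
    sInf_levelSet_le_iff hcard]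
  exact hmem x

lemma crossings_raise {A : Finset ℕ} {s : ℕ → ℝ} (hs : ∀ i ∉ A, s i = 0) {m v : ℝ} (hm : 0 < m)
    (hv : 0 ≤ v) (n : ℕ) : crossings n (m + v) (raise A m s) = crossings n v s := by
  have h1 : ∀ i, raise A m s i ≤ m + v ↔ s i ≤ v := by
    intro i
    by_cases hi : i ∈ A
    · simp [raise, hi]
    · simp only [raise, hi, if_false, hs i hi]
      constructor <;> intro <;> linarith
  simp only [crossings, ← not_le, h1]

lemma crossings_zero {A : Finset ℕ} {s : ℕ → ℝ} (hs : IsPositiveOn A s) (n : ℕ) :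
    crossings n 0 s = runs n A := by
  have h1 : ∀ i, s i ≤ 0 ↔ i ∉ A := by
    intro i
    by_cases hi : i ∈ A
    · simpa [hi] using hs.1 i hi
    · simp [hi, hs.2 i hi]
  simp only [crossings, runs, ← not_le, h1, not_not]

/-- Entries into `A` and exits from `A` are equally many, because the indicator of `A` vanishes at
both `0` and `n + 1` and its increments telescope to zero. -/
lemma sum_downcrossings_eq_runs {A : Finset ℕ} {n : ℕ} (hA : A ⊆ Icc 1 n) :
    ∑ i ∈ range (n + 1), (if i ∈ A ∧ i + 1 ∉ A then (1 : ℝ) else 0) = runs n A ∧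
    ∑ i ∈ range (n + 1), (if i ∉ A ∧ i + 1 ∈ A then (1 : ℝ) else 0) = runs n A := by
  have hn : n + 1 ∉ A := fun h => by have := mem_Icc.1 (hA h); omega
  have h0 : 0 ∉ A := fun h => by have := mem_Icc.1 (hA h); omega
  have hup : ∑ i ∈ range (n + 1), (if i ∉ A ∧ i + 1 ∈ A then (1 : ℝ) else 0) = runs n A := by
    rw [sum_range_succ, if_neg (fun h => hn h.2), add_zero, runs, card_filter]
    push_cast
    rfl
  refine ⟨?_, hup⟩
  rw [← hup, ← sub_eq_zero, ← sum_sub_distrib]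
  have htel : ∑ i ∈ range (n + 1),
      ((if i + 1 ∈ A then (1 : ℝ) else 0) - (if i ∈ A then 1 else 0)) = 0 := by
    rw [sum_range_sub (fun i => if i ∈ A then (1 : ℝ) else 0)]
    simp [hn, h0]
  refine Eq.trans ?_ ((congrArg Neg.neg htel).trans neg_zero)
  rw [← sum_neg_distrib]
  refine sum_congr rfl fun i _ => ?_
  by_cases h1 : i ∈ A <;> by_cases h2 : i + 1 ∈ A <;> simp [h1, h2]

/-- Only edges between `A` and its complement change length, each by `m`. There are two per run; the
range up to `n + 1` includes the edge that closes the path at zero. -/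
lemma totalVar_raise {A : Finset ℕ} {n : ℕ} (hA : A ⊆ Icc 1 n) {a : ℕ} {s : ℕ → ℝ}
    (hs : IsPositiveOn (A.erase a) s) {m : ℝ} (hm : 0 < m) :
    totalVar n (raise A m s) = 2 * runs n A * m + totalVar n s := by
  obtain ⟨hdown, hup⟩ := sum_downcrossings_eq_runs hA
  have : 2 * (runs n A : ℝ) * m = ∑ i ∈ range (n + 1),
      ((if i ∈ A ∧ i + 1 ∉ A then (1 : ℝ) else 0) +
        (if i ∉ A ∧ i + 1 ∈ A then (1 : ℝ) else 0)) * m := by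
    rw [← sum_mul, sum_add_distrib, hdown, hup]; ring
  rw [this, totalVar, totalVar, ← sum_add_distrib]
  refine sum_congr rfl fun i _ => ?_
  have hz : ∀ j, j ∉ A → s j = 0 := fun j hj => hs.2 j fun h => hj (mem_of_mem_erase h)
  have p0 := hs.nonneg i
  have p1 := hs.nonneg (i + 1)
  by_cases h1 : i ∈ A <;> by_cases h2 : i + 1 ∈ A
  · simp [raise, h1, h2]
  · simp only [raise, h1, h2, if_true, if_false, hz _ h2, true_and, not_false_eq_true, not_true,
      false_and, add_zero, one_mul, zero_sub, abs_neg]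
    rw [abs_of_nonneg (by linarith), abs_of_nonneg p0]
  · simp only [raise, h1, h2, if_true, if_false, hz _ h1, not_false_eq_true, not_true, zero_add, one_mul, sub_zero, and_self]
    rw [abs_of_nonneg (by linarith), abs_of_nonneg p1]
  · simp [raise, h1, h2]

lemma runs_pos {A : Finset ℕ} {n : ℕ} (hA : A ⊆ Icc 1 n) (hne : A.Nonempty) : 0 < runs n A := by
  have hm := A.min'_mem hne
  have h1 := mem_Icc.1 (hA hm)
  refine card_pos.2 ⟨A.min' hne - 1, mem_filter.2 ⟨mem_range.2 (by omega), fun h => ?_, ?_⟩⟩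
  · have := A.min'_le _ h
    omega
  · rwa [Nat.sub_add_cancel h1.1]

/-- The order statistic of rank `#A` is the maximum, and no path crosses it. -/
lemma crossings_pathOrder_card {n : ℕ} {s : ℕ → ℝ} :
    crossings n (pathOrder (Icc 1 n) n s) s = 0 := by
  have hcard : #(insert 0 (Icc 1 n)) = n + 1 := by
    rw [card_insert_of_notMem (by simp)]; simp
  have h := (sInf_levelSet_le_iff (B := insert 0 (Icc 1 n)) (k := n) (by omega) s _).1 le_rfl
  have h2 : {i ∈ insert 0 (Icc 1 n) | s i ≤ sInf (levelSet (insert 0 (Icc 1 n)) n s)} =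
      insert 0 (Icc 1 n) := eq_of_subset_of_card_le (filter_subset _ _) (by omega)
  rw [crossings, card_eq_zero, filter_eq_empty_iff]
  rintro i hi ⟨-, h3⟩
  have h4 : i + 1 ∈ insert 0 (Icc 1 n) :=
    mem_insert_of_mem (mem_Icc.2 ⟨by omega, by have := mem_range.1 hi; omega⟩)
  rw [← h2] at h4
  exact absurd h3 (not_lt.2 (mem_filter.1 h4).2)

/-! ### Integrals of path profiles -/

/-- The paths on `A` whose first `K` excursion counts are `y` and whose first `K` spacings lie
in `B`. -/
def profileSet (n : ℕ) (A : Finset ℕ) (K : ℕ) (y : ℕ → ℕ) (B : ℕ → Set ℝ) : Set (ℕ → ℝ) :=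
  {s | ∀ j < K, j < #A ∧ crossings n (pathOrder A j s) s = y j ∧
    pathOrder A (j + 1) s - pathOrder A j s ∈ B j}

/-- The paths on `A` that do not cross one of their order statistics. -/
def stuckSet (n : ℕ) (A : Finset ℕ) : Set (ℕ → ℝ) :=
  {s | ∃ j < #A, crossings n (pathOrder A j s) s = 0}

/-- The unnormalized density of the Laplace walk on positive paths. -/
noncomputable def pathWeight (n : ℕ) (s : ℕ → ℝ) : ℝ≥0∞ :=
  ENNReal.ofReal (Real.exp (-totalVar n s))

/-- The mass of the paths on `A` with a prescribed profile. -/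
noncomputable def profileMass (n : ℕ) (A : Finset ℕ) (K : ℕ) (y : ℕ → ℕ) (B : ℕ → Set ℝ) : ℝ≥0∞ :=
  (∫⋯∫⁻_A, (fun s => pathWeight n s * (profileSet n A K y B).indicator 1 s) ∂halfLine) 0

lemma measurable_pathWeight (n : ℕ) : Measurable (pathWeight n) :=
  (Real.measurable_exp.comp (measurable_totalVar n).neg).ennreal_ofReal

lemma measurableSet_profileSet (n : ℕ) (A : Finset ℕ) (K : ℕ) (y : ℕ → ℕ) {B : ℕ → Set ℝ}
    (hB : ∀ j, MeasurableSet (B j)) : MeasurableSet (profileSet n A K y B) := by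
  simp only [profileSet, Set.ofPred_forall]
  refine MeasurableSet.iInter fun j => MeasurableSet.iInter fun _ => ?_
  refine (MeasurableSet.const _).inter (MeasurableSet.inter ?_ ?_)
  · exact (measurable_crossings n (measurable_pathOrder A j) measurable_id)
      (measurableSet_singleton (y j))
  · exact ((measurable_pathOrder A (j + 1)).sub (measurable_pathOrder A j)) (hB j)

lemma measurableSet_stuckSet (n : ℕ) (A : Finset ℕ) : MeasurableSet (stuckSet n A) := by
  have : stuckSet n A = ⋃ j, ⋃ _ : j < #A, {s | crossings n (pathOrder A j s) s = 0} := by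
    ext; simp [stuckSet]
  rw [this]
  exact MeasurableSet.iUnion fun j => MeasurableSet.iUnion fun _ =>
    (measurable_crossings n (measurable_pathOrder A j) measurable_id) (measurableSet_singleton 0)

lemma pathWeight_raise {A : Finset ℕ} {n : ℕ} (hA : A ⊆ Icc 1 n) {a : ℕ} {s : ℕ → ℝ}
    (hs : IsPositiveOn (A.erase a) s) {m : ℝ} (hm : 0 < m) :
    pathWeight n (raise A m s) =
      ENNReal.ofReal (Real.exp (-(2 * runs n A * m))) * pathWeight n s := by
  rw [pathWeight, totalVar_raise hA hs hm, neg_add, Real.exp_add,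
    ENNReal.ofReal_mul (Real.exp_nonneg _), pathWeight]

lemma crossings_pathOrder_raise {A : Finset ℕ} {n a : ℕ} (ha : a ∈ A) (h0 : 0 ∉ A) {s : ℕ → ℝ}
    (hs : IsPositiveOn (A.erase a) s) {m : ℝ} (hm : 0 < m) {k : ℕ} (hk : k < #A) :
    crossings n (pathOrder A (k + 1) (raise A m s)) (raise A m s) =
      crossings n (pathOrder (A.erase a) k s) s := by
  rw [pathOrder_raise ha h0 hs hm hk]
  exact crossings_raise (fun i hi => hs.2 i fun h => hi (mem_of_mem_erase h)) hm
    (pathOrder_nonneg hs k) n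

/-- At level `0` the raised path sees the runs of `A` and the spacing `m`. Its higher levels are
those of `s`, one rank lower. -/
lemma raise_mem_profileSet_iff {A : Finset ℕ} {n a : ℕ} (hA : A ⊆ Icc 1 n) (ha : a ∈ A) {s : ℕ → ℝ}
    (hs : IsPositiveOn (A.erase a) s) {m : ℝ} (hm : 0 < m) (K : ℕ) (y : ℕ → ℕ) (B : ℕ → Set ℝ) :
    raise A m s ∈ profileSet n A (K + 1) y B ↔ (runs n A = y 0 ∧ m ∈ B 0) ∧
      s ∈ profileSet n (A.erase a) K (fun j => y (j + 1)) (fun j => B (j + 1)) := by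
  have h0 : 0 ∉ A := fun h => by have := mem_Icc.1 (hA h); omega
  have h0' : 0 ∉ A.erase a := fun h => h0 (mem_of_mem_erase h)
  have hpos : 0 < #A := card_pos.2 ⟨a, ha⟩
  have hcard : ∀ j, j < #(A.erase a) ↔ j + 1 < #A := fun j => by
    rw [card_erase_of_mem ha]; omega
  have hr := hs.raise hm
  have hzero : (0 < #A ∧ crossings n (pathOrder A 0 (raise A m s)) (raise A m s) = y 0 ∧
      pathOrder A (0 + 1) (raise A m s) - pathOrder A 0 (raise A m s) ∈ B 0) ↔
      (runs n A = y 0 ∧ m ∈ B 0) := by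
    rw [pathOrder_zero hr h0, crossings_zero hr, pathOrder_raise ha h0 hs hm hpos,
      pathOrder_zero hs h0']
    simp [hpos]
  have hsucc : ∀ j, (j + 1 < #A ∧
      crossings n (pathOrder A (j + 1) (raise A m s)) (raise A m s) = y (j + 1) ∧
      pathOrder A (j + 1 + 1) (raise A m s) - pathOrder A (j + 1) (raise A m s) ∈ B (j + 1)) ↔
      (j < #(A.erase a) ∧ crossings n (pathOrder (A.erase a) j s) s = y (j + 1) ∧
        pathOrder (A.erase a) (j + 1) s - pathOrder (A.erase a) j s ∈ B (j + 1)) := by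
    intro j
    rw [hcard]
    refine and_congr_right fun hj => ?_
    rw [crossings_pathOrder_raise ha h0 hs hm (by omega), pathOrder_raise ha h0 hs hm hj,
      pathOrder_raise ha h0 hs hm (show j < #A by omega), add_sub_add_left_eq_sub]
  constructor
  · intro h
    exact ⟨hzero.1 (h 0 (by omega)), fun j hj => (hsucc j).1 (h (j + 1) (by omega))⟩
  · rintro ⟨h1, h2⟩ j hj
    cases j with
    | zero => exact hzero.2 h1
    | succ j => exact (hsucc j).2 (h2 j (by omega))

/-- The peeling step. The weight factors as `e^{-2rm}` times the weight of the lowered path, with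
`r` the same for every place `a` of the minimum. Hence the integral over the spacing separates from
the sum over `a`. -/
theorem profileMass_succ {A : Finset ℕ} {n : ℕ} (hA : A ⊆ Icc 1 n) (hne : A.Nonempty) (K : ℕ)
    (y : ℕ → ℕ) {B : ℕ → Set ℝ} (hB : ∀ j, MeasurableSet (B j)) :
    profileMass n A (K + 1) y B = if runs n A = y 0 then
      (∫⁻ m in Set.Ioi 0, ENNReal.ofReal (Real.exp (-(2 * runs n A * m))) * (B 0).indicator 1 m) *
        ∑ a ∈ A, profileMass n (A.erase a) K (fun j => y (j + 1)) (fun j => B (j + 1)) else 0 := by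
  have hFm : ∀ A K y, ∀ B : ℕ → Set ℝ, (∀ j, MeasurableSet (B j)) → Measurable fun s =>
      pathWeight n s * (profileSet n A K y B).indicator (1 : (ℕ → ℝ) → ℝ≥0∞) s :=
    fun A K y B hB => (measurable_pathWeight n).mul
      (measurable_one.indicator (measurableSet_profileSet n A K y hB))
  have key : ∀ a ∈ A, ∀ m ∈ Set.Ioi (0 : ℝ), (∫⋯∫⁻_(A.erase a), (fun s =>
      pathWeight n (raise A m s) * (profileSet n A (K + 1) y B).indicator 1 (raise A m s))
        ∂halfLine) 0 = (if runs n A = y 0 then 1 else 0) *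
      (ENNReal.ofReal (Real.exp (-(2 * runs n A * m))) * (B 0).indicator 1 m) *
        profileMass n (A.erase a) K (fun j => y (j + 1)) (fun j => B (j + 1)) := by
    intro a ha m hm
    rw [profileMass, ← lmarginal_const_mul _ (hFm _ _ _ _ fun j => hB _)]
    refine lmarginal_halfLine_congr fun s hs1 hs2 => ?_
    have hs : IsPositiveOn (A.erase a) s := ⟨hs1, hs2⟩
    have hiff := raise_mem_profileSet_iff hA ha hs hm K y B
    rw [pathWeight_raise hA hs hm]
    by_cases h1 : runs n A = y 0 <;> by_cases h2 : m ∈ B 0 <;>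
      by_cases h3 : s ∈ profileSet n (A.erase a) K (fun j => y (j + 1)) (fun j => B (j + 1)) <;>
      simp [Set.indicator, hiff, h1, h2, h3]
  rw [profileMass, lmarginal_eq_sum_erase hne (hFm _ _ _ _ hB)]
  have key2 : ∀ a ∈ A, ∫⁻ m in Set.Ioi 0, (∫⋯∫⁻_(A.erase a), (fun s =>
      pathWeight n (raise A m s) * (profileSet n A (K + 1) y B).indicator 1 (raise A m s))
        ∂halfLine) 0 = (if runs n A = y 0 then 1 else 0) *
      (∫⁻ m in Set.Ioi 0,
        ENNReal.ofReal (Real.exp (-(2 * runs n A * m))) * (B 0).indicator 1 m) *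
        profileMass n (A.erase a) K (fun j => y (j + 1)) (fun j => B (j + 1)) := by
    intro a ha
    rw [setLIntegral_congr_fun measurableSet_Ioi (key a ha)]
    have hm : Measurable fun m : ℝ =>
        ENNReal.ofReal (Real.exp (-(2 * runs n A * m))) * (B 0).indicator (1 : ℝ → ℝ≥0∞) m :=
      Measurable.mul (by fun_prop) (measurable_one.indicator (hB 0))
    rw [lintegral_mul_const _ (hm.const_mul _), lintegral_const_mul _ hm]
  rw [sum_congr rfl key2, ← mul_sum]
  split_ifs <;> simp

/-- A profile of length one that prescribes the count `runs n A` and an arbitrary spacing holds for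
every path positive exactly on `A`; `profileMass_succ` then applies. -/
theorem profileMass_zero_eq {A : Finset ℕ} {n : ℕ} (hA : A ⊆ Icc 1 n) (hne : A.Nonempty)
    (y : ℕ → ℕ) (B : ℕ → Set ℝ) :
    profileMass n A 0 y B =
      (∫⁻ m in Set.Ioi 0, ENNReal.ofReal (Real.exp (-(2 * runs n A * m)))) *
        ∑ a ∈ A, profileMass n (A.erase a) 0 y B := by
  have h := profileMass_succ hA hne 0 (fun _ => runs n A) (B := fun _ => Set.univ)
    (fun _ => MeasurableSet.univ)
  have hzero : ∀ A y, ∀ B : ℕ → Set ℝ, profileSet n A 0 y B = Set.univ := fun A y B => by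
    ext; simp [profileSet]
  have h1 : profileMass n A (0 + 1) (fun _ => runs n A) (fun _ => Set.univ) =
      profileMass n A 0 y B := by
    refine lmarginal_halfLine_congr fun s hs1 hs2 => ?_
    have h0 : 0 ∉ A := fun h => by have := mem_Icc.1 (hA h); omega
    have : s ∈ profileSet n A (0 + 1) (fun _ => runs n A) (fun _ => Set.univ) := by
      intro j hj
      obtain rfl : j = 0 := by omega
      refine ⟨card_pos.2 hne, ?_, trivial⟩
      rw [pathOrder_zero ⟨hs1, hs2⟩ h0, crossings_zero ⟨hs1, hs2⟩]
    rw [hzero, Set.indicator_of_mem this, Set.indicator_of_mem (Set.mem_univ s)]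
  rw [← h1, h, if_pos rfl]
  simp [profileMass, hzero]

/-- The level `0` is crossed once by each run, and a nonempty `A` has a run; peeling reduces every
higher level to a smaller set. This is what makes the counts below rank `ν` almost surely positive.
-/
theorem lmarginal_stuckSet {A : Finset ℕ} {n : ℕ} (hA : A ⊆ Icc 1 n) :
    (∫⋯∫⁻_A, (fun s => pathWeight n s * (stuckSet n A).indicator 1 s) ∂halfLine) 0 = 0 := by
  induction hN : #A generalizing A with
  | zero =>
    have : stuckSet n A = ∅ := by ext; simp [stuckSet, hN]
    simp [this, lmarginal]
  | succ N ih =>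
    have hne : A.Nonempty := card_pos.1 (by omega)
    have hFm : ∀ A, Measurable fun s =>
        pathWeight n s * (stuckSet n A).indicator (1 : (ℕ → ℝ) → ℝ≥0∞) s :=
      fun A => (measurable_pathWeight n).mul
        (measurable_one.indicator (measurableSet_stuckSet n A))
    rw [lmarginal_eq_sum_erase hne (hFm A)]
    refine sum_eq_zero fun a ha => ?_
    rw [setLIntegral_congr_fun (g := fun _ => 0) measurableSet_Ioi, lintegral_zero]
    intro m hm
    have hm' : (0 : ℝ) < m := hm
    have h0 : 0 ∉ A := fun h => by have := mem_Icc.1 (hA h); omega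
    have hcard : #(A.erase a) = N := by rw [card_erase_of_mem ha, hN]; rfl
    have h1 := ih ((erase_subset a A).trans hA) hcard
    have h2 : (∫⋯∫⁻_(A.erase a), (fun s => pathWeight n (raise A m s) *
        (stuckSet n A).indicator 1 (raise A m s)) ∂halfLine) 0 =
        (∫⋯∫⁻_(A.erase a), (fun s => ENNReal.ofReal (Real.exp (-(2 * runs n A * m))) *
          (pathWeight n s * (stuckSet n (A.erase a)).indicator 1 s)) ∂halfLine) 0 := by
      refine lmarginal_halfLine_congr fun s hs1 hs2 => ?_
      have hs : IsPositiveOn (A.erase a) s := ⟨hs1, hs2⟩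
      have hiff : raise A m s ∈ stuckSet n A ↔ s ∈ stuckSet n (A.erase a) := by
        constructor
        · rintro ⟨j, hj, hz⟩
          cases j with
          | zero =>
            have hr := hs.raise hm'
            rw [pathOrder_zero hr h0, crossings_zero hr] at hz
            exact absurd hz (runs_pos hA hne).ne'
          | succ j =>
            rw [crossings_pathOrder_raise ha h0 hs hm' (by omega)] at hz
            exact ⟨j, by omega, hz⟩
        · rintro ⟨j, hj, hz⟩
          refine ⟨j + 1, by omega, ?_⟩
          rwa [crossings_pathOrder_raise ha h0 hs hm' (by omega)]
      rw [pathWeight_raise hA hs hm', mul_assoc]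
      by_cases h : s ∈ stuckSet n (A.erase a) <;> simp [Set.indicator, hiff, h]
    simp only
    rw [h2, lmarginal_const_mul _ (hFm _), h1, mul_zero]

/-! ### Profile masses in terms of run lengths -/

/-- The weight of all paths with run lengths `L` of total length `n`. -/
noncomputable def tailWeight : ℕ → List ℕ → ℝ≥0∞
  | 0, _ => 1
  | n + 1, L => (4 * (runCount L : ℝ≥0∞))⁻¹ * splitSum (tailWeight n) L

/-- The weight of the paths with run lengths `L` whose first `K` excursion counts are `y`, up to
the masses of the spacings. -/
noncomputable def profileWeight : ℕ → (ℕ → ℕ) → List ℕ → ℝ≥0∞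
  | 0, _, L => tailWeight L.sum L
  | K + 1, y, L =>
    if runCount L = y 0 then 2⁻¹ * splitSum (profileWeight K fun j => y (j + 1)) L else 0

lemma runCount_filter (L : List ℕ) : runCount (L.filter (· ≠ 0)) = runCount L := by
  simp [runCount]

lemma sum_filter_ne_zero (L : List ℕ) : (L.filter (· ≠ 0)).sum = L.sum := by
  induction L with
  | nil => rfl
  | cons l L ih =>
    by_cases h : l = 0
    · subst h; simpa using ih
    · simp only [ne_eq, decide_not] at ih
      simp [h, ih]

lemma runCount_of_forall_ne_zero {L : List ℕ} (h : ∀ l ∈ L, l ≠ 0) : runCount L = L.length := by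
  rw [runCount, List.filter_eq_self.2 fun l hl => by simpa using h l hl]

lemma ignoresZeros_tailWeight (n : ℕ) : IgnoresZeros (tailWeight n) := by
  induction n with
  | zero => exact fun L => rfl
  | succ n ih => exact fun L => by simp only [tailWeight, runCount_filter, ih.splitSum L]

lemma ignoresZeros_profileWeight (K : ℕ) (y : ℕ → ℕ) : IgnoresZeros (profileWeight K y) := by
  induction K generalizing y with
  | zero =>
    exact fun L => by simp only [profileWeight, sum_filter_ne_zero, ignoresZeros_tailWeight _ L]
  | succ K ih =>
    exact fun L => by simp only [profileWeight, runCount_filter, (ih _).splitSum L]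

lemma filter_window_of_subset {A : Finset ℕ} {n : ℕ} (hA : A ⊆ Icc 1 n) :
    A.filter (fun a => 1 ≤ a ∧ a < 1 + n) = A :=
  filter_true_of_mem fun a ha => by have := mem_Icc.1 (hA ha); omega

lemma sum_erase_eq_splitSum {A : Finset ℕ} {n : ℕ} (hA : A ⊆ Icc 1 n) (F : List ℕ → ℝ≥0∞) :
    ∑ a ∈ A, F (runLengths (A.erase a) 0 1 n) = splitSum F (runLengths A 0 1 n) := by
  rw [← sum_runLengths_erase A 0 1 n F, filter_window_of_subset hA]
  simp

lemma sum_runLengths_eq_card {A : Finset ℕ} {n : ℕ} (hA : A ⊆ Icc 1 n) :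
    (runLengths A 0 1 n).sum = #A := by
  rw [sum_runLengths, filter_window_of_subset hA, zero_add]

lemma runCount_runLengths_eq_runs {A : Finset ℕ} {n : ℕ} (hA : A ⊆ Icc 1 n) :
    runCount (runLengths A 0 1 n) = runs n A := by
  have h0 : 0 ∉ A := fun h => by have := mem_Icc.1 (hA h); omega
  have := runCount_runLengths A 0 0 n (by simp [h0])
  rw [zero_add, if_neg h0, zero_add] at this
  rw [this, runs, card_filter]
  simp only [zero_add]

lemma setLIntegral_exp_mul_indicator {r : ℝ} (hr : 0 < r) {B : Set ℝ} (hB : MeasurableSet B) :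
    ∫⁻ m in Set.Ioi 0, ENNReal.ofReal (Real.exp (-(r * m))) * B.indicator 1 m =
      (ENNReal.ofReal r)⁻¹ * expMeasure r B := by
  have h1 : expMeasure r B = ∫⁻ m in B, exponentialPDF r m := by
    rw [expMeasure, gammaMeasure, withDensity_apply _ hB]; rfl
  have h2 : ∫⁻ m in B, exponentialPDF r m =
      ∫⁻ m in Set.Ioi 0, ENNReal.ofReal r * (ENNReal.ofReal (Real.exp (-(r * m))) *
        B.indicator 1 m) := by
    rw [restrict_Ioi_eq_restrict_Ici, ← lintegral_indicator hB,
      ← lintegral_indicator measurableSet_Ici]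
    refine lintegral_congr fun m => ?_
    by_cases hm : 0 ≤ m
    · rw [Set.indicator_of_mem (show m ∈ Set.Ici 0 from hm), ← mul_assoc,
        ← ENNReal.ofReal_mul hr.le]
      by_cases hmB : m ∈ B
      · simp [hmB, exponentialPDF_of_nonneg hm]
      · simp [hmB]
    · rw [Set.indicator_of_notMem (show m ∉ Set.Ici 0 from hm)]
      by_cases hmB : m ∈ B
      · simp [hmB, exponentialPDF_of_neg (not_le.1 hm)]
      · simp [hmB]
  have hr0 : ENNReal.ofReal r ≠ 0 := by simpa using hr
  rw [h1, h2, lintegral_const_mul' _ _ ENNReal.ofReal_ne_top, ← mul_assoc,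
    ENNReal.inv_mul_cancel hr0 ENNReal.ofReal_ne_top, one_mul]

lemma setLIntegral_exp {r : ℝ} (hr : 0 < r) :
    ∫⁻ m in Set.Ioi 0, ENNReal.ofReal (Real.exp (-(r * m))) = (ENNReal.ofReal r)⁻¹ := by
  have := isProbabilityMeasure_expMeasure hr
  simpa using setLIntegral_exp_mul_indicator hr MeasurableSet.univ

lemma profileMass_empty_zero (n : ℕ) (y : ℕ → ℕ) (B : ℕ → Set ℝ) :
    profileMass n ∅ 0 y B = 1 := by
  simp [profileMass, profileSet, pathWeight, totalVar]

lemma profileMass_empty_succ (n K : ℕ) (y : ℕ → ℕ) (B : ℕ → Set ℝ) :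
    profileMass n ∅ (K + 1) y B = 0 := by
  have : profileSet n ∅ (K + 1) y B = ∅ := by
    ext s
    simp only [profileSet, Set.mem_ofPred_eq, Set.mem_empty_iff_false, iff_false]
    intro h
    simpa using (h 0 (by omega)).1
  simp [profileMass, this]

lemma ofReal_two_mul_natCast (r : ℕ) : ENNReal.ofReal (2 * (r : ℝ)) = 2 * (r : ℝ≥0∞) := by
  rw [ENNReal.ofReal_mul (by norm_num)]; simp

/-- The `1/2` of the Laplace density, one per site, joins the `1 / (2r)` of the exponential integral
to form the `1 / (4r)` in `tailWeight`. -/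
lemma two_inv_pow_mul_profileMass_zero {A : Finset ℕ} {n : ℕ} (hA : A ⊆ Icc 1 n) (y : ℕ → ℕ)
    (B : ℕ → Set ℝ) :
    2⁻¹ ^ #A * profileMass n A 0 y B = tailWeight #A (runLengths A 0 1 n) := by
  induction hN : #A generalizing A with
  | zero =>
    rw [card_eq_zero] at hN
    simp [hN, profileMass_empty_zero, tailWeight]
  | succ N ih =>
    have hne : A.Nonempty := card_pos.1 (by omega)
    have hr : (0 : ℝ) < 2 * runs n A := by have := runs_pos hA hne; positivity
    have h1 : ∀ a ∈ A, 2⁻¹ ^ N * profileMass n (A.erase a) 0 y B =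
        tailWeight N (runLengths (A.erase a) 0 1 n) := fun a ha =>
      ih ((erase_subset a A).trans hA) (by rw [card_erase_of_mem ha, hN]; rfl)
    rw [profileMass_zero_eq hA hne, setLIntegral_exp hr, tailWeight, runCount_runLengths_eq_runs hA,
      ← sum_erase_eq_splitSum hA, ← sum_congr rfl h1, ← mul_sum, ofReal_two_mul_natCast, pow_succ]
    have h4 : (4 * (runs n A : ℝ≥0∞))⁻¹ = 2⁻¹ * (2 * (runs n A : ℝ≥0∞))⁻¹ := by
      rw [← ENNReal.mul_inv (by simp) (by simp), ← mul_assoc]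
      norm_num
    rw [h4]
    ring

/-- For prescribed counts the rates `2 y j` are constants, so the spacing integrals come out as a
product and the remainder depends on `A` only through its run lengths. -/
theorem two_inv_pow_mul_profileMass {A : Finset ℕ} {n : ℕ} (hA : A ⊆ Icc 1 n) (K : ℕ)
    {y : ℕ → ℕ} (hy : ∀ j < K, 0 < y j) {B : ℕ → Set ℝ} (hB : ∀ j, MeasurableSet (B j)) :
    2⁻¹ ^ #A * profileMass n A K y B =
      (∏ j ∈ range K, (2 * (y j : ℝ≥0∞))⁻¹ * expMeasure (2 * y j) (B j)) *
        profileWeight K y (runLengths A 0 1 n) := by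
  induction K generalizing A y B with
  | zero =>
    rw [two_inv_pow_mul_profileMass_zero hA]
    simp [profileWeight, sum_runLengths_eq_card hA]
  | succ K ih =>
    rw [profileWeight, runCount_runLengths_eq_runs hA]
    rcases A.eq_empty_or_nonempty with rfl | hne
    · have h0 : runs n ∅ ≠ y 0 := by
        have := hy 0 (by omega)
        simp only [runs, notMem_empty, and_false, filter_false, card_empty]
        omega
      simp [profileMass_empty_succ, h0]
    · rw [profileMass_succ hA hne K y hB]
      by_cases hr : runs n A = y 0
      · have hpos : (0 : ℝ) < 2 * runs n A := by have := runs_pos hA hne; positivity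
        obtain ⟨N, hN⟩ : ∃ N, #A = N + 1 := ⟨#A - 1, by have := card_pos.2 hne; omega⟩
        have h1 : ∀ a ∈ A, 2⁻¹ ^ N *
            profileMass n (A.erase a) K (fun j => y (j + 1)) (fun j => B (j + 1)) =
            (∏ j ∈ range K, (2 * (y (j + 1) : ℝ≥0∞))⁻¹ *
              expMeasure (2 * y (j + 1)) (B (j + 1))) *
            profileWeight K (fun j => y (j + 1)) (runLengths (A.erase a) 0 1 n) := by
          intro a ha
          have := ih ((erase_subset a A).trans hA) (y := fun j => y (j + 1))
            (fun j hj => hy (j + 1) (by omega)) (B := fun j => B (j + 1)) fun j => hB (j + 1)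
          rwa [card_erase_of_mem ha, hN, Nat.add_sub_cancel] at this
        rw [if_pos hr, if_pos hr, setLIntegral_exp_mul_indicator hpos (hB 0),
          ← sum_erase_eq_splitSum hA, prod_range_succ', hN, pow_succ]
        have h2 : 2⁻¹ ^ N * ∑ a ∈ A,
            profileMass n (A.erase a) K (fun j => y (j + 1)) (fun j => B (j + 1)) =
            (∏ j ∈ range K, (2 * (y (j + 1) : ℝ≥0∞))⁻¹ *
              expMeasure (2 * y (j + 1)) (B (j + 1))) *
            ∑ a ∈ A, profileWeight K (fun j => y (j + 1)) (runLengths (A.erase a) 0 1 n) := by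
          rw [mul_sum, mul_sum]
          exact sum_congr rfl h1
        rw [hr, ofReal_two_mul_natCast]
        calc _ = 2⁻¹ * ((2 * (y 0 : ℝ≥0∞))⁻¹ * expMeasure (2 * y 0) (B 0)) * (2⁻¹ ^ N * ∑ a ∈ A,
            profileMass n (A.erase a) K (fun j => y (j + 1)) (fun j => B (j + 1))) := by ring
          _ = _ := by rw [h2]; ring
      · simp [hr]

/-! ### Summation over all run lengths -/

lemma tailWeight_of_ne_zero {L : List ℕ} (h : ∀ l ∈ L, l ≠ 0) (hL : L ≠ []) :
    tailWeight L.sum L =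
      (4 * (L.length : ℝ≥0∞))⁻¹ * splitSum (fun L => tailWeight L.sum L) L := by
  obtain ⟨N, hN⟩ : ∃ N, L.sum = N + 1 := by
    cases L with
    | nil => exact absurd rfl hL
    | cons l L =>
      have := h l (by simp)
      exact ⟨l + L.sum - 1, by simp; omega⟩
  rw [hN, tailWeight, runCount_of_forall_ne_zero h]
  congr 1
  refine splitSum_congr L fun L' hL' => ?_
  have : L'.sum = N := by omega
  rw [this]

/-- The factor `r + 1`, for the choice of the run that loses an element, cancels the rate; the
weights become harmonic for the lazy walk. -/
lemma runSum_profileWeight_zero_succ (y : ℕ → ℕ) (r : ℕ) :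
    runSum (r + 1) (profileWeight 0 y) = 4⁻¹ * (runSum r (profileWeight 0 y) +
      2 * runSum (r + 1) (profileWeight 0 y) + runSum (r + 2) (profileWeight 0 y)) := by
  have h1 : runSum (r + 1) (profileWeight 0 y) = runSum (r + 1) fun L =>
      (4 * ((r + 1 : ℕ) : ℝ≥0∞))⁻¹ * splitSum (profileWeight 0 y) L := by
    refine runSum_congr fun L hL h0 => ?_
    have hne : L ≠ [] := by rintro rfl; simp at hL
    rw [profileWeight, tailWeight_of_ne_zero h0 hne, hL]
    rfl
  conv_lhs => rw [h1, runSum_const_mul, runSum_splitSum (ignoresZeros_profileWeight 0 y)]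
  rw [ENNReal.mul_inv (by simp) (by simp), ← mul_assoc, mul_assoc 4⁻¹]
  have : ((r + 1 : ℕ) : ℝ≥0∞)⁻¹ * ((r : ℝ≥0∞) + 1) = 1 := by
    rw [← Nat.cast_succ]
    exact ENNReal.inv_mul_cancel (by simp) (by simp)
  rw [this, mul_one]

lemma runSum_profileWeight_succ (K : ℕ) (y : ℕ → ℕ) (r : ℕ) :
    runSum (r + 1) (profileWeight (K + 1) y) = if r + 1 = y 0 then
      2⁻¹ * (r + 1) * (runSum r (profileWeight K fun j => y (j + 1)) +
        2 * runSum (r + 1) (profileWeight K fun j => y (j + 1)) +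
        runSum (r + 2) (profileWeight K fun j => y (j + 1))) else 0 := by
  have h1 : runSum (r + 1) (profileWeight (K + 1) y) = runSum (r + 1) fun L =>
      (if r + 1 = y 0 then 2⁻¹ else 0) * splitSum (profileWeight K fun j => y (j + 1)) L := by
    refine runSum_congr fun L hL h0 => ?_
    rw [profileWeight, runCount_of_forall_ne_zero h0, hL]
    split_ifs <;> simp
  rw [h1, runSum_const_mul, runSum_splitSum (ignoresZeros_profileWeight K _)]
  split_ifs
  · ring
  · simp

/-- The recursion says that second differences vanish, once finiteness is known. The affine function
has slope at most `0` by `h1`, and a negative slope would contradict nonnegativity. -/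
lemma eq_one_of_discrete_harmonic {q : ℕ → ℝ≥0∞} (h0 : q 0 = 1) (h1 : q 1 ≤ 1)
    (hq : ∀ r, q (r + 1) = 4⁻¹ * (q r + 2 * q (r + 1) + q (r + 2))) (r : ℕ) : q r = 1 := by
  have h4 : ∀ r, 4 * q (r + 1) = q r + 2 * q (r + 1) + q (r + 2) := fun r => by
    conv_lhs => rw [hq r]
    rw [← mul_assoc, ENNReal.mul_inv_cancel (by simp) (by simp), one_mul]
  have hfin : ∀ r, q r ≠ ∞ := by
    intro r
    induction r using Nat.twoStepInduction with
    | zero => simp [h0]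
    | one => exact ne_top_of_le_ne_top ENNReal.one_ne_top h1
    | more r _ ih =>
      refine ne_top_of_le_ne_top (ENNReal.mul_ne_top (by simp : (4 : ℝ≥0∞) ≠ ∞) ih) ?_
      rw [h4]
      exact le_add_self
  have hreal : ∀ r, (q (r + 2)).toReal = 2 * (q (r + 1)).toReal - (q r).toReal := by
    intro r
    have := congrArg ENNReal.toReal (h4 r)
    rw [ENNReal.toReal_add (ENNReal.add_ne_top.2 ⟨hfin _, ENNReal.mul_ne_top (by simp) (hfin _)⟩)
      (hfin _), ENNReal.toReal_add (hfin _) (ENNReal.mul_ne_top (by simp) (hfin _)),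
      ENNReal.toReal_mul, ENNReal.toReal_mul] at this
    norm_num at this
    linarith
  have hlin : ∀ r : ℕ, (q r).toReal = 1 - r * (1 - (q 1).toReal) := by
    intro r
    induction r using Nat.twoStepInduction with
    | zero => simp [h0]
    | one => simp
    | more r ih1 ih2 =>
      rw [hreal, ih1, ih2]; push_cast; ring
  have hle : (q 1).toReal ≤ 1 := by
    simpa using ENNReal.toReal_mono ENNReal.one_ne_top h1
  have hone : (q 1).toReal = 1 := by
    by_contra hne
    have hlt : 0 < 1 - (q 1).toReal := by
      rcases lt_or_eq_of_le hle with h | h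
      · linarith
      · exact absurd h hne
    obtain ⟨N, hN⟩ := exists_nat_gt (1 / (1 - (q 1).toReal))
    rw [div_lt_iff₀ hlt] at hN
    have := hlin N
    have hnn : 0 ≤ (q N).toReal := ENNReal.toReal_nonneg
    linarith
  have := hlin r
  rw [hone, sub_self, mul_zero, sub_zero] at this
  rw [← ENNReal.ofReal_toReal (hfin r), this, ENNReal.ofReal_one]

/-! ### The lazy matrix -/

lemma lazyMatrix_zero (j : ℕ) : lazyMatrix 0 j = if j = 0 then 1 else 0 := by
  by_cases h : j = 0
  · subst h; norm_num [lazyMatrix, P₀]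
  · simp [lazyMatrix, P₀, h, Matrix.one_apply_ne (Ne.symm h)]

lemma lazyMatrix_of_pos {i : ℕ} (hi : 0 < i) (j : ℕ) :
    lazyMatrix i j = if j = i then 1 / 2 else if j = i + 1 ∨ j + 1 = i then 1 / 4 else 0 := by
  have hi' : i ≠ 0 := hi.ne'
  by_cases h : j = i
  · subst h
    simp [lazyMatrix, P₀, hi']
  · rw [if_neg h]
    by_cases h2 : j = i + 1 ∨ j + 1 = i
    · rw [if_pos h2]
      norm_num [lazyMatrix, P₀, hi', h2, Matrix.one_apply_ne (Ne.symm h)]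
    · rw [if_neg h2]
      simp [lazyMatrix, P₀, hi', h2, Matrix.one_apply_ne (Ne.symm h)]

lemma lazyMatrix_nonneg (i j : ℕ) : 0 ≤ lazyMatrix i j := by
  rcases Nat.eq_zero_or_pos i with rfl | hi
  · rw [lazyMatrix_zero]; split_ifs <;> norm_num
  · rw [lazyMatrix_of_pos hi]; split_ifs <;> norm_num

/-- The probability that the lazy chain, started at `y 0`, follows `y` for `K` steps. -/
noncomputable def pathProb (y : ℕ → ℕ) (K : ℕ) : ℝ≥0∞ :=
  ∏ j ∈ range K, ENNReal.ofReal (lazyMatrix (y j) (y (j + 1)))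

lemma ofReal_quarter : ENNReal.ofReal (1 / 4) = 4⁻¹ := by
  rw [one_div, ENNReal.ofReal_inv_of_pos (by norm_num)]; simp

lemma ofReal_half : ENNReal.ofReal (1 / 2) = 2⁻¹ := by
  rw [one_div, ENNReal.ofReal_inv_of_pos (by norm_num)]; simp

/-- The total weight after the last prescribed count is `1` by harmonicity, so only the transition
probabilities remain, up to factors `2 y j` that later cancel against the exponential integrals. -/
theorem runSum_profileWeight {y0 : ℕ → ℕ} (h1 : runSum 1 (profileWeight 0 y0) ≤ 1) (K : ℕ)
    {y : ℕ → ℕ} (hy : ∀ j ≤ K, 0 < y j) (r : ℕ) :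
    runSum r (profileWeight (K + 1) y) =
      if r = y 0 then (∏ j ∈ range (K + 1), 2 * (y j : ℝ≥0∞)) * pathProb y K else 0 := by
  have hq : ∀ y r, runSum r (profileWeight 0 y) = 1 := by
    intro y r
    have : profileWeight 0 y = profileWeight 0 y0 := rfl
    rw [this]
    exact eq_one_of_discrete_harmonic (q := fun r => runSum r (profileWeight 0 y0)) rfl h1 (runSum_profileWeight_zero_succ y0) r
  induction K generalizing y r with
  | zero =>
    rcases r with _ | r
    · have := hy 0 le_rfl
      rw [if_neg (by omega)]
      simp [runSum, profileWeight, splitSum]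
    · rw [runSum_profileWeight_succ]
      split_ifs with h
      · simp only [hq, pathProb, range_zero, prod_empty, zero_add, prod_range_one, ← h]
        have h2 : (1 + 2 * 1 + 1 : ℝ≥0∞) = 2 * 2 := by norm_num
        rw [h2, mul_assoc, mul_comm ((r : ℝ≥0∞) + 1), ← mul_assoc, ← mul_assoc,
          ENNReal.inv_mul_cancel (by simp) (by simp)]
        push_cast; ring
      · rfl
  | succ K ih =>
    rcases r with _ | r
    · have := hy 0 (by omega)
      rw [if_neg (by omega)]
      simp [runSum, profileWeight, splitSum]
    · rw [runSum_profileWeight_succ]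
      split_ifs with h
      · have hy' : ∀ j ≤ K, 0 < y (j + 1) := fun j hj => hy (j + 1) (by omega)
        simp only [ih hy']
        set c := (∏ j ∈ range (K + 1), 2 * (y (j + 1) : ℝ≥0∞)) * pathProb (fun j => y (j + 1)) K
        have hp : pathProb y (K + 1) = pathProb (fun j => y (j + 1)) K *
            ENNReal.ofReal (lazyMatrix (r + 1) (y 1)) := by
          rw [pathProb, prod_range_succ', ← h]; rfl
        -- The coefficients `(r + 1) / 2` times `1, 2, 1` equal `2 (r + 1)` times the lazy
        -- transition probabilities `1/4, 1/2, 1/4`.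
        have hmain : 2⁻¹ * ((r : ℝ≥0∞) + 1) * ((if r = y (0 + 1) then c else 0) +
            2 * (if r + 1 = y (0 + 1) then c else 0) + if r + 2 = y (0 + 1) then c else 0) =
            2 * ((r : ℝ≥0∞) + 1) * ENNReal.ofReal (lazyMatrix (r + 1) (y 1)) * c := by
          have h22 : (2 : ℝ≥0∞) * 4⁻¹ = 2⁻¹ := by
            rw [show (4 : ℝ≥0∞) = 2 * 2 by norm_num, ENNReal.mul_inv (by simp) (by simp),
              ← mul_assoc, ENNReal.mul_inv_cancel (by simp) (by simp), one_mul]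
          have hy1 := hy 1 (by omega)
          rw [lazyMatrix_of_pos (by omega : 0 < r + 1), zero_add]
          by_cases e1 : y 1 = r + 1
          · have a1 : r ≠ y 1 := by omega
            have a2 : r + 2 ≠ y 1 := by omega
            rw [if_pos e1, if_pos e1.symm, if_neg a1, if_neg a2, ofReal_half, zero_add, add_zero]
            ring
          · rw [if_neg e1, if_neg (Ne.symm e1)]
            by_cases e2 : y 1 = r + 2
            · have a1 : r ≠ y 1 := by omega
              rw [if_pos (Or.inl e2), if_pos e2.symm, if_neg a1, ofReal_quarter, mul_zero, zero_add,
                zero_add, ← h22]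
              ring
            · by_cases e3 : y 1 = r
              · rw [if_pos (Or.inr (by omega)), if_neg (Ne.symm e2), if_pos e3.symm, ofReal_quarter,
                  mul_zero, add_zero, add_zero, ← h22]
                ring
              · rw [if_neg (show ¬ (y 1 = r + 1 + 1 ∨ y 1 + 1 = r + 1) by omega), if_neg (Ne.symm e2),
                  if_neg (Ne.symm e3)]
                simp
        rw [hmain, hp, prod_range_succ', ← h]
        simp only [c]
        push_cast
        ring
      · rfl

/-! ### The law of the walk killed below zero -/

/-- The Laplace density of a jump from `a` to `b`. -/
noncomputable def jumpDensity (a b : ℝ) : ℝ≥0∞ := ENNReal.ofReal (1 / 2 * Real.exp (-|b - a|))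

lemma Measurable.jumpDensity {α : Type*} [MeasurableSpace α] {f g : α → ℝ} (hf : Measurable f)
    (hg : Measurable g) : Measurable fun a => jumpDensity (f a) (g a) := by
  unfold LaplaceWalk.jumpDensity
  fun_prop

/-- The walk up to time `n`, extended by zero. -/
noncomputable def stoppedPath {Ω : Type*} (X : ℕ → Ω → ℝ) (n : ℕ) (ω : Ω) (i : ℕ) : ℝ :=
  if i ≤ n then walk X i ω else 0

/-- The paths that are nonnegative at the times `1, …, n`. -/
def nonnegSet (n : ℕ) : Set (ℕ → ℝ) := {s | ∀ i ∈ Icc 1 n, 0 ≤ s i}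

lemma measurableSet_nonnegSet (n : ℕ) : MeasurableSet (nonnegSet n) := by
  simp only [nonnegSet, Set.ofPred_forall]
  exact MeasurableSet.iInter fun i => MeasurableSet.iInter fun _ =>
    measurableSet_le measurable_const (measurable_pi_apply i)

lemma lintegral_laplaceMeasure {g : ℝ → ℝ≥0∞} (hg : Measurable g) (a : ℝ) :
    ∫⁻ x, g (a + x) ∂laplaceMeasure = ∫⁻ t, jumpDensity a t * g t := by
  have hd : Measurable fun x : ℝ => ENNReal.ofReal (1 / 2 * Real.exp (-|x|)) := by fun_prop
  rw [laplaceMeasure, lintegral_withDensity_eq_lintegral_mul _ hd (by fun_prop),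
    ← lintegral_add_left_eq_self (fun t => jumpDensity a t * g t) a]
  simp [jumpDensity]

lemma laplaceMeasure_tail {a : ℝ} (ha : 0 ≤ a) :
    laplaceMeasure {x | a + x < 0} = ENNReal.ofReal (1 / 2 * Real.exp (-a)) := by
  have h1 : {x : ℝ | a + x < 0} = Set.Iio (-a) := by
    ext x
    simp only [Set.mem_ofPred_eq, Set.mem_Iio]
    constructor <;> intro h <;> linarith
  rw [h1, laplaceMeasure, withDensity_apply _ measurableSet_Iio,
    setLIntegral_congr Iio_ae_eq_Iic, ← integral_exp_Iic (-a), ← integral_const_mul,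
    ofReal_integral_eq_lintegral_ofReal]
  · refine setLIntegral_congr_fun measurableSet_Iic fun x hx => ?_
    have hx' : x ≤ 0 := le_trans hx (by linarith)
    simp only [abs_of_nonpos hx', neg_neg]
  · exact (integrableOn_exp_Iic (-a)).const_mul _
  · exact Eventually.of_forall fun x => by positivity

lemma stoppedPath_self {Ω : Type*} (X : ℕ → Ω → ℝ) (n : ℕ) (ω : Ω) : stoppedPath X n ω n = walk X n ω := by
  simp [stoppedPath]

lemma stoppedPath_succ {Ω : Type*} (X : ℕ → Ω → ℝ) (n : ℕ) (ω : Ω) : stoppedPath X (n + 1) ω =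
    Function.update (stoppedPath X n ω) (n + 1) (stoppedPath X n ω n + X n ω) := by
  ext i
  by_cases h : i = n + 1
  · subst h
    simp [stoppedPath, walk, sum_range_succ]
  · have : i ≤ n + 1 ↔ i ≤ n := by omega
    simp [stoppedPath, h, this]

section

variable {Ω : Type*} [MeasurableSpace Ω] {P : Measure Ω} {X : ℕ → Ω → ℝ}

lemma measurable_walk (hmeas : ∀ i, Measurable (X i)) (n : ℕ) : Measurable (walk X n) :=
  Finset.measurable_sum _ fun i _ => hmeas i

lemma measurable_stoppedPath (hmeas : ∀ i, Measurable (X i)) (n : ℕ) :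
    Measurable (stoppedPath X n) := by
  refine measurable_pi_lambda _ fun i => ?_
  by_cases h : i ≤ n
  · simpa only [stoppedPath, h, if_true] using measurable_walk hmeas i
  · simp only [stoppedPath, h, if_false, measurable_const]

lemma indepFun_stoppedPath (hmeas : ∀ i, Measurable (X i)) (hindep : iIndepFun X P) (n : ℕ) :
    IndepFun (stoppedPath X n) (X n) P := by
  have h := hindep.indepFun_finset (range n) {n} (by simp) hmeas
  let φ : (range n → ℝ) → ℕ → ℝ := fun z i =>
    if i ≤ n then ∑ j ∈ range i, (if h : j ∈ range n then z ⟨j, h⟩ else 0) else 0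
  let ψ : (({n} : Finset ℕ) → ℝ) → ℝ := fun z => z ⟨n, mem_singleton_self n⟩
  have hφ : Measurable φ := by
    refine measurable_pi_lambda _ fun i => ?_
    simp only [φ]
    split_ifs
    · refine Finset.measurable_sum _ fun j _ => ?_
      split_ifs
      · exact measurable_pi_apply _
      · exact measurable_const
    · exact measurable_const
  have hψ : Measurable ψ := measurable_pi_apply _
  have h2 := h.comp hφ hψ
  convert! h2 using 1
  ext ω i
  simp only [stoppedPath, φ, Function.comp_apply, walk]
  split_ifs with hi
  · refine sum_congr rfl fun j hj => ?_
    have : j ∈ range n := mem_range.2 ((mem_range.1 hj).trans_le hi)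
    rw [dif_pos this]
  · rfl

lemma lintegral_stoppedPath_step [IsProbabilityMeasure P] (hmeas : ∀ i, Measurable (X i))
    (hlaw : ∀ i, P.map (X i) = laplaceMeasure) (hindep : iIndepFun X P) (n : ℕ)
    {H : (ℕ → ℝ) → ℝ → ℝ≥0∞} (hH : Measurable (Function.uncurry H)) :
    ∫⁻ ω, H (stoppedPath X n ω) (X n ω) ∂P =
      ∫⁻ ω, ∫⁻ x, H (stoppedPath X n ω) x ∂laplaceMeasure ∂P := by
  have hm := measurable_stoppedPath hmeas n
  have h1 := (indepFun_iff_map_prod_eq_prod_map_map hm.aemeasurable (hmeas n).aemeasurable).1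
    (indepFun_stoppedPath hmeas hindep n)
  have hsf : SFinite laplaceMeasure := by rw [← hlaw 0]; infer_instance
  rw [hlaw] at h1
  have h2 : ∫⁻ ω, H (stoppedPath X n ω) (X n ω) ∂P =
      ∫⁻ p, Function.uncurry H p ∂(P.map fun ω => (stoppedPath X n ω, X n ω)) :=
    (lintegral_map hH (hm.prodMk (hmeas n))).symm
  rw [h2, h1, lintegral_prod _ hH.aemeasurable, lintegral_map (hH.lintegral_prod_right') hm]
  rfl

/-- Induction on `n`: by independence the last jump is integrated out first, and the result is
absorbed into a functional `G'` of the shorter path. Passing from nonnegative to positive heights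
costs only a null set. -/
theorem lintegral_stoppedPath [IsProbabilityMeasure P] (hmeas : ∀ i, Measurable (X i))
    (hlaw : ∀ i, P.map (X i) = laplaceMeasure) (hindep : iIndepFun X P) (n : ℕ)
    {G : (ℕ → ℝ) → ℝ≥0∞} (hG : Measurable G) :
    ∫⁻ ω, (nonnegSet n).indicator 1 (stoppedPath X n ω) * G (stoppedPath X n ω) ∂P =
      (∫⋯∫⁻_(Icc 1 n), (fun s => G s * ∏ i ∈ range n, jumpDensity (s i) (s (i + 1)))
        ∂halfLine) 0 := by
  induction n generalizing G with
  | zero =>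
    have h0 : ∀ ω, stoppedPath X 0 ω = 0 := fun ω => by
      ext i
      by_cases h : i = 0
      · subst h; simp [stoppedPath, walk]
      · simp [stoppedPath, h]
    simp [h0, nonnegSet]
  | succ n ih =>
    have hIcc : Icc 1 (n + 1) = insert (n + 1) (Icc 1 n) := by
      ext i; simp only [mem_Icc, mem_insert]; omega
    have hupd : Measurable fun p : (ℕ → ℝ) × ℝ => Function.update p.1 (n + 1) p.2 :=
      measurable_update'
    have hmem : ∀ (s : ℕ → ℝ) (t : ℝ), Function.update s (n + 1) t ∈ nonnegSet (n + 1) ↔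
        s ∈ nonnegSet n ∧ 0 ≤ t := by
      intro s t
      simp only [nonnegSet, Set.mem_ofPred_eq, hIcc, forall_mem_insert, Function.update_self]
      rw [and_comm]
      refine and_congr_left fun _ => forall₂_congr fun i hi => ?_
      rw [Function.update_of_ne (by have := mem_Icc.1 hi; omega)]
    set G' : (ℕ → ℝ) → ℝ≥0∞ := fun s =>
      ∫⁻ t in Set.Ioi 0, jumpDensity (s n) t * G (Function.update s (n + 1) t) with hG'
    have hjm : Measurable fun p : (ℕ → ℝ) × ℝ => jumpDensity (p.1 n) p.2 :=
      Measurable.jumpDensity ((measurable_pi_apply n).comp measurable_fst) measurable_snd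
    have hGu : Measurable fun p : (ℕ → ℝ) × ℝ => G (Function.update p.1 (n + 1) p.2) :=
      hG.comp hupd
    have hG'm : Measurable G' := (hjm.mul hGu).lintegral_prod_right'
    set H : (ℕ → ℝ) → ℝ → ℝ≥0∞ := fun s x =>
      (nonnegSet (n + 1)).indicator 1 (Function.update s (n + 1) (s n + x)) *
        G (Function.update s (n + 1) (s n + x)) with hHdef
    have hupd2 : Measurable fun p : (ℕ → ℝ) × ℝ => Function.update p.1 (n + 1) (p.1 n + p.2) :=
      hupd.comp (measurable_fst.prodMk
        (((measurable_pi_apply n).comp measurable_fst).add measurable_snd))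
    have hind : Measurable ((nonnegSet (n + 1)).indicator (1 : (ℕ → ℝ) → ℝ≥0∞)) :=
      measurable_one.indicator (measurableSet_nonnegSet (n + 1))
    have hHm : Measurable (Function.uncurry H) := by
      have h1 : Measurable fun p : (ℕ → ℝ) × ℝ => (nonnegSet (n + 1)).indicator
          (1 : (ℕ → ℝ) → ℝ≥0∞) (Function.update p.1 (n + 1) (p.1 n + p.2)) := hind.comp hupd2
      have h2 : Measurable fun p : (ℕ → ℝ) × ℝ =>
          G (Function.update p.1 (n + 1) (p.1 n + p.2)) := hG.comp hupd2
      exact h1.mul h2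
    have hinner : ∀ s, ∫⁻ x, H s x ∂laplaceMeasure = (nonnegSet n).indicator 1 s * G' s := by
      intro s
      have hus : Measurable fun t => Function.update s (n + 1) t := measurable_update s
      have hgm : Measurable fun t =>
          (nonnegSet (n + 1)).indicator (1 : (ℕ → ℝ) → ℝ≥0∞) (Function.update s (n + 1) t) *
            G (Function.update s (n + 1) t) := (hind.comp hus).mul (hG.comp hus)
      have h1 := lintegral_laplaceMeasure hgm (s n)
      have hGs : G' s =
          ∫⁻ t in Set.Ioi 0, jumpDensity (s n) t * G (Function.update s (n + 1) t) := rfl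
      simp only [hHdef]
      rw [h1, hGs, restrict_Ioi_eq_restrict_Ici, ← lintegral_indicator measurableSet_Ici]
      by_cases hs : s ∈ nonnegSet n
      · rw [Set.indicator_of_mem hs, Pi.one_apply, one_mul]
        refine lintegral_congr fun t => ?_
        by_cases ht : 0 ≤ t
        · simp [Set.indicator, hmem, hs, ht]
        · simp [Set.indicator, hmem, ht]
      · simp [Set.indicator, hmem, hs]
    have h2 : ∀ ω, (nonnegSet (n + 1)).indicator 1 (stoppedPath X (n + 1) ω) *
        G (stoppedPath X (n + 1) ω) = H (stoppedPath X n ω) (X n ω) := fun ω => by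
      simp only [hHdef, stoppedPath_succ]
    simp only [h2]
    rw [lintegral_stoppedPath_step hmeas hlaw hindep n hHm]
    simp only [hinner]
    rw [ih hG'm, hIcc, lmarginal_insert' _ _ (by simp)]
    · congr 1
      ext s
      have hprod : ∀ t, ∏ i ∈ range (n + 1), jumpDensity (Function.update s (n + 1) t i)
          (Function.update s (n + 1) t (i + 1)) =
          (∏ i ∈ range n, jumpDensity (s i) (s (i + 1))) * jumpDensity (s n) t := by
        intro t
        rw [prod_range_succ, Function.update_self, Function.update_of_ne (by omega)]
        congr 1
        refine prod_congr rfl fun i hi => ?_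
        have := mem_range.1 hi
        rw [Function.update_of_ne (by omega), Function.update_of_ne (by omega)]
      simp only [hprod, hG']
      rw [← lintegral_mul_const]
      · refine lintegral_congr fun t => ?_
        ring
      · exact (hjm.comp measurable_prodMk_left).mul (hG.comp (measurable_update s))
    · refine hG.mul (Finset.measurable_prod _ fun i _ => ?_)
      exact Measurable.jumpDensity (measurable_pi_apply i) (measurable_pi_apply _)

/-- The law of the walk on the event that it becomes negative for the first time at `n + 1`. -/
theorem measure_stoppedPath [IsProbabilityMeasure P] (hmeas : ∀ i, Measurable (X i))
    (hlaw : ∀ i, P.map (X i) = laplaceMeasure) (hindep : iIndepFun X P) (n : ℕ)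
    {S : Set (ℕ → ℝ)} (hS : MeasurableSet S) :
    P {ω | stoppedPath X n ω ∈ nonnegSet n ∧ walk X (n + 1) ω < 0 ∧ stoppedPath X n ω ∈ S} =
      2⁻¹ ^ (n + 1) *
        (∫⋯∫⁻_(Icc 1 n), (fun s => pathWeight n s * S.indicator 1 s) ∂halfLine) 0 := by
  set H : (ℕ → ℝ) → ℝ → ℝ≥0∞ := fun s x =>
    ((nonnegSet n ∩ S).indicator 1 s) * ({x : ℝ | s n + x < 0}.indicator 1 x) with hHdef
  have hlt : MeasurableSet {p : (ℕ → ℝ) × ℝ | p.1 n + p.2 < 0} :=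
    measurableSet_lt (((measurable_pi_apply n).comp measurable_fst).add measurable_snd)
      measurable_const
  have hHm : Measurable (Function.uncurry H) :=
    ((measurable_one.indicator ((measurableSet_nonnegSet n).inter hS)).comp measurable_fst).mul
      (measurable_one.indicator hlt)
  have hm := measurable_stoppedPath hmeas n
  have hE : MeasurableSet
      {ω | stoppedPath X n ω ∈ nonnegSet n ∧ walk X (n + 1) ω < 0 ∧ stoppedPath X n ω ∈ S} :=
    (hm (measurableSet_nonnegSet n)).inter
      ((measurableSet_lt (measurable_walk hmeas (n + 1)) measurable_const).inter (hm hS))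
  have h1 : P {ω | stoppedPath X n ω ∈ nonnegSet n ∧ walk X (n + 1) ω < 0 ∧
      stoppedPath X n ω ∈ S} = ∫⁻ ω, H (stoppedPath X n ω) (X n ω) ∂P := by
    rw [← lintegral_indicator_one hE]
    refine lintegral_congr fun ω => ?_
    have hw : walk X (n + 1) ω = stoppedPath X n ω n + X n ω := by
      rw [stoppedPath_self, walk, sum_range_succ, walk]
    simp only [hHdef, Set.indicator, Set.mem_ofPred_eq, Set.mem_inter_iff, hw, Pi.one_apply]
    by_cases a1 : stoppedPath X n ω ∈ nonnegSet n <;>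
      by_cases a2 : stoppedPath X n ω n + X n ω < 0 <;>
      by_cases a3 : stoppedPath X n ω ∈ S <;> simp [hw, a1, a2, a3]
  have h2 : ∀ ω, ∫⁻ x, H (stoppedPath X n ω) x ∂laplaceMeasure =
      (nonnegSet n).indicator 1 (stoppedPath X n ω) * (S.indicator 1 (stoppedPath X n ω) *
        ENNReal.ofReal (1 / 2 * Real.exp (-(stoppedPath X n ω n)))) := by
    intro ω
    have hlt' : MeasurableSet {x : ℝ | stoppedPath X n ω n + x < 0} :=
      measurableSet_lt (measurable_const.add measurable_id) measurable_const
    simp only [hHdef]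
    rw [lintegral_const_mul _ (measurable_one.indicator hlt'), lintegral_indicator_one hlt']
    by_cases a1 : stoppedPath X n ω ∈ nonnegSet n
    · have hnn : 0 ≤ stoppedPath X n ω n := by
        rcases Nat.eq_zero_or_pos n with rfl | hn
        · simp [stoppedPath, walk]
        · exact a1 n (mem_Icc.2 ⟨hn, le_rfl⟩)
      rw [laplaceMeasure_tail hnn]
      by_cases a3 : stoppedPath X n ω ∈ S <;> simp [Set.indicator, a1, a3]
    · simp [Set.indicator, a1]
  have hGm : Measurable fun s : ℕ → ℝ => S.indicator (1 : (ℕ → ℝ) → ℝ≥0∞) s *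
      ENNReal.ofReal (1 / 2 * Real.exp (-(s n))) :=
    (measurable_one.indicator hS).mul (by fun_prop)
  rw [h1, lintegral_stoppedPath_step hmeas hlaw hindep n hHm]
  simp only [h2]
  have hWm : Measurable fun s => pathWeight n s * S.indicator (1 : (ℕ → ℝ) → ℝ≥0∞) s :=
    (measurable_pathWeight n).mul (measurable_one.indicator hS)
  rw [lintegral_stoppedPath hmeas hlaw hindep n hGm, ← lmarginal_const_mul _ hWm]
  refine lmarginal_halfLine_congr fun s hs1 hs2 => ?_
  have hnn : 0 ≤ s n := IsPositiveOn.nonneg ⟨hs1, hs2⟩ n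
  have hz : s (n + 1) = 0 := hs2 _ (by simp)
  have hw : ENNReal.ofReal (1 / 2 * Real.exp (-(s n))) *
      ∏ i ∈ range n, jumpDensity (s i) (s (i + 1)) = 2⁻¹ ^ (n + 1) * pathWeight n s := by
    -- The tail of the jump below zero equals the density of a jump from `s n` to `s (n + 1) = 0`.
    -- It supplies the closing edge of the total variation.
    have h3 : ENNReal.ofReal (1 / 2 * Real.exp (-(s n))) = jumpDensity (s n) (s (n + 1)) := by
      rw [jumpDensity, hz, zero_sub, abs_neg, abs_of_nonneg hnn]
    rw [h3, mul_comm, ← prod_range_succ (fun i => jumpDensity (s i) (s (i + 1)))]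
    simp only [jumpDensity]
    rw [← ENNReal.ofReal_prod_of_nonneg fun i _ => by positivity, prod_mul_distrib, prod_const,
      card_range, ENNReal.ofReal_mul (by positivity), ENNReal.ofReal_pow (by norm_num), ofReal_half,
      ← Real.exp_sum, sum_neg_distrib]
    rfl
  rw [mul_assoc, hw]
  ring

end

/-! ### The excursion counts and spacings of the walk -/

lemma walk_zero {Ω : Type*} (X : ℕ → Ω → ℝ) (ω : Ω) : walk X 0 ω = 0 := by simp [walk]

/-- Since `S_0 = 0` is not negative, the value `0` of the infimum occurs only for the empty set; a
successor value is a genuine ladder time. -/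
lemma ladderTime_eq_succ_iff {Ω : Type*} (X : ℕ → Ω → ℝ) (ω : Ω) (n : ℕ) :
    ladderTime X ω = n + 1 ↔ stoppedPath X n ω ∈ nonnegSet n ∧ walk X (n + 1) ω < 0 := by
  have hmem : stoppedPath X n ω ∈ nonnegSet n ↔ ∀ i ≤ n, 0 ≤ walk X i ω := by
    constructor
    · intro h i hi
      rcases Nat.eq_zero_or_pos i with rfl | h0
      · rw [walk_zero]
      · simpa [stoppedPath, hi] using h i (mem_Icc.2 ⟨h0, hi⟩)
    · intro h i hi
      have hi' := (mem_Icc.1 hi).2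
      simpa [stoppedPath, hi'] using h i hi'
  rw [hmem, ladderTime]
  constructor
  · intro h
    have hne : {n : ℕ | walk X n ω < 0}.Nonempty := by
      by_contra hne
      rw [Set.not_nonempty_iff_eq_empty.1 hne] at h
      simp at h
    refine ⟨fun i hi => ?_, ?_⟩
    · exact not_lt.1 fun hlt => Nat.notMem_of_lt_sInf (m := i) (by rw [h]; omega) hlt
    · have := Nat.sInf_mem hne
      rwa [h] at this
  · rintro ⟨h1, h2⟩
    refine le_antisymm (Nat.sInf_le h2) (le_csInf ⟨n + 1, h2⟩ fun i hi => ?_)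
    by_contra hlt
    exact absurd hi (not_lt.2 (h1 i (by omega)))

lemma orderStat_eq_pathOrder {Ω : Type*} (X : ℕ → Ω → ℝ) (k : ℕ) (ω : Ω) :
    orderStat X k ω =
      pathOrder (Icc 1 (lastTime X ω)) k (stoppedPath X (lastTime X ω) ω) := by
  have hset : range (lastTime X ω + 1) = insert 0 (Icc 1 (lastTime X ω)) := by
    ext i; simp only [mem_range, mem_insert, mem_Icc]; omega
  rw [orderStat, pathOrder, levelSet, ← hset]
  congr 1
  ext x
  simp only [Set.mem_ofPred_eq]
  have : ∀ i ∈ range (lastTime X ω + 1), (walk X i ω ≤ x ↔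
      stoppedPath X (lastTime X ω) ω i ≤ x) := fun i hi => by
    have := mem_range.1 hi
    rw [stoppedPath, if_pos (by omega)]
  rw [filter_congr this]

lemma excursionsAbove_eq_crossings {Ω : Type*} (X : ℕ → Ω → ℝ) (v : ℝ) (ω : Ω) :
    excursionsAbove X v ω = crossings (lastTime X ω) v (stoppedPath X (lastTime X ω) ω) := by
  rw [excursionsAbove, crossings]
  congr 1
  refine filter_congr fun i hi => ?_
  have := mem_range.1 hi
  rw [stoppedPath, stoppedPath, if_pos (by omega), if_pos (by omega)]

/-- At `k = ν` the level is the maximum of the path and nothing crosses it; beyond that the count is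
zero by convention. -/
lemma excursionChain_of_lastTime_le {Ω : Type*} (X : ℕ → Ω → ℝ) {k : ℕ} {ω : Ω}
    (h : lastTime X ω ≤ k) : excursionChain X k ω = 0 := by
  rw [excursionChain]
  split_ifs with hk
  · have : lastTime X ω = k := le_antisymm h hk
    rw [excursionsAbove_eq_crossings, orderStat_eq_pathOrder, this, crossings_pathOrder_card]
  · rfl

lemma lt_lastTime_of_pos {Ω : Type*} (X : ℕ → Ω → ℝ) {k : ℕ} {ω : Ω}
    (h : 0 < excursionChain X k ω) : k < lastTime X ω := by
  by_contra hle
  rw [excursionChain_of_lastTime_le X (not_lt.1 hle)] at h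
  exact lt_irrefl _ h

lemma mem_profileSet_iff {Ω : Type*} (X : ℕ → Ω → ℝ) (ω : Ω) (K : ℕ) (y : ℕ → ℕ) (B : ℕ → Set ℝ) :
    stoppedPath X (lastTime X ω) ω ∈
        profileSet (lastTime X ω) (Icc 1 (lastTime X ω)) K y B ↔
      ∀ j < K, j < lastTime X ω ∧ excursionChain X j ω = y j ∧ spacing X j ω ∈ B j := by
  simp only [profileSet, Set.mem_ofPred_eq, Nat.card_Icc, Nat.add_sub_cancel, spacing,
    orderStat_eq_pathOrder]
  refine forall₂_congr fun j _ => and_congr_right fun hj => ?_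
  rw [excursionChain, if_pos hj.le, excursionsAbove_eq_crossings, orderStat_eq_pathOrder]

section

variable {Ω : Type*} [MeasurableSpace Ω] {P : Measure Ω} {X : ℕ → Ω → ℝ}

lemma measurableSet_ladderTime_eq_succ (hmeas : ∀ i, Measurable (X i)) (n : ℕ) :
    MeasurableSet {ω | ladderTime X ω = n + 1} := by
  simp only [ladderTime_eq_succ_iff]
  exact ((measurable_stoppedPath hmeas n) (measurableSet_nonnegSet n)).inter
    (measurableSet_lt (measurable_walk hmeas (n + 1)) measurable_const)

lemma measurable_ladderTime (hmeas : ∀ i, Measurable (X i)) : Measurable (ladderTime X) := by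
  refine measurable_to_countable' fun n => ?_
  cases n with
  | succ n => exact measurableSet_ladderTime_eq_succ hmeas n
  | zero =>
    have : ladderTime X ⁻¹' {0} = (⋃ n, {ω | ladderTime X ω = n + 1})ᶜ := by
      ext ω
      simp only [Set.mem_preimage, Set.mem_singleton_iff, Set.mem_compl_iff, Set.mem_iUnion,
        Set.mem_ofPred_eq, not_exists]
      constructor
      · intro h n; omega
      · intro h
        by_contra h0
        exact h (ladderTime X ω - 1) (by omega)
    rw [this]
    exact (MeasurableSet.iUnion fun n => measurableSet_ladderTime_eq_succ hmeas n).compl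

lemma measurable_lastTime (hmeas : ∀ i, Measurable (X i)) : Measurable (lastTime X) :=
  (measurable_of_countable fun n : ℕ => n - 1).comp (measurable_ladderTime hmeas)

lemma measurable_comp_nat {β : Type*} [MeasurableSpace β] {g : ℕ → Ω → β} {N : Ω → ℕ}
    (hg : ∀ n, Measurable (g n)) (hN : Measurable N) : Measurable fun ω => g (N ω) ω :=
  (measurable_from_prod_countable_right (f := fun p : ℕ × Ω => g p.1 p.2) hg).comp
    (hN.prodMk measurable_id)

lemma measurable_orderStat (hmeas : ∀ i, Measurable (X i)) (k : ℕ) : Measurable (orderStat X k) := by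
  have : orderStat X k = fun ω =>
      pathOrder (Icc 1 (lastTime X ω)) k (stoppedPath X (lastTime X ω) ω) :=
    funext fun ω => orderStat_eq_pathOrder X k ω
  rw [this]
  exact measurable_comp_nat (g := fun n ω => pathOrder (Icc 1 n) k (stoppedPath X n ω))
    (fun n => (measurable_pathOrder _ k).comp (measurable_stoppedPath hmeas n))
    (measurable_lastTime hmeas)

theorem measurable_spacing (hmeas : ∀ i, Measurable (X i)) (k : ℕ) : Measurable (spacing X k) :=
  (measurable_orderStat hmeas (k + 1)).sub (measurable_orderStat hmeas k)

theorem measurable_excursionChain (hmeas : ∀ i, Measurable (X i)) (k : ℕ) :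
    Measurable (excursionChain X k) := by
  have hm : Measurable fun ω => excursionsAbove X (orderStat X k ω) ω := by
    simp only [excursionsAbove_eq_crossings]
    exact measurable_comp_nat (g := fun n ω => crossings n (orderStat X k ω) (stoppedPath X n ω))
      (fun n => measurable_crossings n (measurable_orderStat hmeas k)
        (measurable_stoppedPath hmeas n)) (measurable_lastTime hmeas)
  exact Measurable.ite (measurableSet_le measurable_const (measurable_lastTime hmeas)) hm
    measurable_const

variable [IsProbabilityMeasure P]

lemma runLengths_Icc (n : ℕ) : runLengths (Icc 1 n) 0 1 n = [n] := by
  have h : ∀ len k i, 1 ≤ i → i + len = n + 1 → runLengths (Icc 1 n) k i len = [k + len] := by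
    intro len
    induction len with
    | zero => intro k i _ _; rfl
    | succ len ih =>
      intro k i hi hlen
      rw [runLengths, if_pos (mem_Icc.2 ⟨hi, by omega⟩), ih (k + 1) (i + 1) (by omega) (by omega)]
      congr 1
      omega
  simpa using h n 0 1 le_rfl (by omega)

lemma measure_stoppedPath_mem_of_ladderTime (hmeas : ∀ i, Measurable (X i))
    (hlaw : ∀ i, P.map (X i) = laplaceMeasure) (hindep : iIndepFun X P) (n : ℕ)
    {S : Set (ℕ → ℝ)} (hS : MeasurableSet S) :
    P {ω | ladderTime X ω = n + 1 ∧ stoppedPath X n ω ∈ S} = 2⁻¹ ^ (n + 1) *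
      (∫⋯∫⁻_(Icc 1 n), (fun s => pathWeight n s * S.indicator 1 s) ∂halfLine) 0 := by
  simp only [ladderTime_eq_succ_iff, and_assoc]
  exact measure_stoppedPath hmeas hlaw hindep n hS

/-- The mass of a profile, summed over the time at which the walk becomes negative. -/
lemma measure_profile (hmeas : ∀ i, Measurable (X i))
    (hlaw : ∀ i, P.map (X i) = laplaceMeasure) (hindep : iIndepFun X P) (K : ℕ) {y : ℕ → ℕ}
    (hy : ∀ j < K, 0 < y j) {B : ℕ → Set ℝ} (hB : ∀ j, MeasurableSet (B j)) :
    P {ω | ladderTime X ω ≠ 0 ∧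
      ∀ j < K, j < lastTime X ω ∧ excursionChain X j ω = y j ∧ spacing X j ω ∈ B j} =
    2⁻¹ * (∏ j ∈ range K, (2 * (y j : ℝ≥0∞))⁻¹ * expMeasure (2 * y j) (B j)) *
      (runSum 0 (profileWeight K y) + runSum 1 (profileWeight K y)) := by
  set S : ℕ → Set (ℕ → ℝ) := fun n => profileSet n (Icc 1 n) K y B
  have hSm : ∀ n, MeasurableSet (S n) := fun n => measurableSet_profileSet n _ K y hB
  have hset : {ω | ladderTime X ω ≠ 0 ∧
      ∀ j < K, j < lastTime X ω ∧ excursionChain X j ω = y j ∧ spacing X j ω ∈ B j} =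
      ⋃ n, {ω | ladderTime X ω = n + 1 ∧ stoppedPath X n ω ∈ S n} := by
    ext ω
    simp only [Set.mem_ofPred_eq, Set.mem_iUnion, ← mem_profileSet_iff]
    constructor
    · rintro ⟨h0, h⟩
      exact ⟨lastTime X ω, by unfold lastTime; omega, h⟩
    · rintro ⟨n, hn, h⟩
      have : lastTime X ω = n := by unfold lastTime; omega
      rw [this]
      exact ⟨by omega, h⟩
  rw [hset, measure_iUnion]
  · have hn : ∀ n, P {ω | ladderTime X ω = n + 1 ∧ stoppedPath X n ω ∈ S n} =
        2⁻¹ * (∏ j ∈ range K, (2 * (y j : ℝ≥0∞))⁻¹ * expMeasure (2 * y j) (B j)) *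
          profileWeight K y [n] := by
      intro n
      have h := two_inv_pow_mul_profileMass (Subset.refl (Icc 1 n)) K hy hB
      rw [runLengths_Icc, Nat.card_Icc, Nat.add_sub_cancel] at h
      rw [measure_stoppedPath_mem_of_ladderTime hmeas hlaw hindep n (hSm n), mul_assoc, ← h, pow_succ]
      simp only [profileMass, S]
      ring
    simp only [hn]
    -- The term `n = 0` has the single empty run `[0]` and gives `runSum 0`; the terms `n ≥ 1` form
    -- `runSum 1`.
    rw [ENNReal.tsum_mul_left, tsum_eq_zero_add' ENNReal.summable,
      (ignoresZeros_profileWeight K y).zero_cons]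
    rfl
  · intro m n hmn
    refine Set.disjoint_left.2 fun ω h1 h2 => hmn ?_
    have a1 := h1.1
    have a2 := h2.1
    omega
  · intro n
    exact (measurableSet_ladderTime_eq_succ hmeas n).inter
      ((measurable_stoppedPath hmeas n) (hSm n))

/-- With no prescribed counts, `measure_profile` evaluates the probability of a finite ladder time
as `(1 + q) / 2`, with `q` the weight in question. This bound is the probabilistic input that pins
down the harmonic function. -/
lemma runSum_one_le_one (hmeas : ∀ i, Measurable (X i))
    (hlaw : ∀ i, P.map (X i) = laplaceMeasure) (hindep : iIndepFun X P) (y : ℕ → ℕ) :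
    runSum 1 (profileWeight 0 y) ≤ 1 := by
  have h := measure_profile hmeas hlaw hindep 0 (y := y) (by simp) (B := fun _ => Set.univ)
    fun _ => MeasurableSet.univ
  have h1 : 2⁻¹ * (1 + runSum 1 (profileWeight 0 y)) ≤ 1 := by
    have : runSum 0 (profileWeight 0 y) = 1 := rfl
    rw [prod_range_zero, mul_one, this] at h
    rw [← h]
    exact prob_le_one
  rw [ENNReal.inv_mul_le_iff (by simp) (by simp), mul_one, ← one_add_one_eq_two] at h1
  exact (ENNReal.add_le_add_iff_left ENNReal.one_ne_top).1 h1

theorem ae_ladderTime_ne_zero (hmeas : ∀ i, Measurable (X i))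
    (hlaw : ∀ i, P.map (X i) = laplaceMeasure) (hindep : iIndepFun X P) :
    ∀ᵐ ω ∂P, ladderTime X ω ≠ 0 := by
  have h := measure_profile hmeas hlaw hindep 0 (y := 0) (by simp) (B := fun _ => Set.univ)
    fun _ => MeasurableSet.univ
  have h0 : runSum 0 (profileWeight 0 0) = 1 := rfl
  have h1 : runSum 1 (profileWeight 0 0) = 1 :=
    eq_one_of_discrete_harmonic (q := fun r => runSum r (profileWeight 0 0)) rfl
      (runSum_one_le_one hmeas hlaw hindep 0) (runSum_profileWeight_zero_succ 0) 1
  rw [prod_range_zero, mul_one, h0, h1, one_add_one_eq_two,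
    ENNReal.inv_mul_cancel (by simp) (by simp)] at h
  have hm : MeasurableSet {ω | ladderTime X ω ≠ 0} :=
    (measurable_ladderTime hmeas) (measurableSet_singleton 0).compl
  refine (prob_compl_eq_zero_iff hm).2 ?_
  rw [← h]
  simp

/-- Almost surely the excursion counts are positive exactly below the last time. -/
theorem ae_excursionChain_pos_iff (hmeas : ∀ i, Measurable (X i))
    (hlaw : ∀ i, P.map (X i) = laplaceMeasure) (hindep : iIndepFun X P) :
    ∀ᵐ ω ∂P, ∀ k, 0 < excursionChain X k ω ↔ k < lastTime X ω := by
  have hstuck : ∀ᵐ ω ∂P, ∀ n, ¬ (ladderTime X ω = n + 1 ∧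
      stoppedPath X n ω ∈ stuckSet n (Icc 1 n)) := by
    rw [ae_all_iff]
    intro n
    have h := measure_stoppedPath_mem_of_ladderTime hmeas hlaw hindep n
      (measurableSet_stuckSet n (Icc 1 n))
    rw [lmarginal_stuckSet (Subset.refl _), mul_zero] at h
    rw [ae_iff]
    simpa using h
  filter_upwards [hstuck, ae_ladderTime_ne_zero hmeas hlaw hindep] with ω h h0 k
  refine ⟨lt_lastTime_of_pos X, fun hk => Nat.pos_of_ne_zero fun hz => ?_⟩
  refine h (lastTime X ω) ⟨by unfold lastTime; omega, k, by simpa using hk, ?_⟩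
  rw [excursionChain, if_pos hk.le, excursionsAbove_eq_crossings, orderStat_eq_pathOrder] at hz
  exact hz

/-- The joint law of the excursion counts and the spacings. -/
theorem measure_excursionChain_spacing (hmeas : ∀ i, Measurable (X i))
    (hlaw : ∀ i, P.map (X i) = laplaceMeasure) (hindep : iIndepFun X P) (K : ℕ) {y : ℕ → ℕ}
    (hy : ∀ j ≤ K, 0 < y j) {B : ℕ → Set ℝ} (hB : ∀ j, MeasurableSet (B j)) :
    P {ω | ∀ j ≤ K, excursionChain X j ω = y j ∧ spacing X j ω ∈ B j} =
      2⁻¹ * (if y 0 = 1 then pathProb y K else 0) *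
        ∏ j ∈ range (K + 1), expMeasure (2 * y j) (B j) := by
  have h := measure_profile hmeas hlaw hindep (K + 1) (fun j hj => hy j (by omega)) hB
  have hset : {ω | ladderTime X ω ≠ 0 ∧ ∀ j < K + 1, j < lastTime X ω ∧
      excursionChain X j ω = y j ∧ spacing X j ω ∈ B j} =
      {ω | ∀ j ≤ K, excursionChain X j ω = y j ∧ spacing X j ω ∈ B j} := by
    ext ω
    simp only [Set.mem_ofPred_eq, Nat.lt_succ_iff]
    constructor
    · exact fun h j hj => (h.2 j hj).2
    · intro h
      have hlt : ∀ j ≤ K, j < lastTime X ω := fun j hj =>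
        lt_lastTime_of_pos X (by rw [(h j hj).1]; exact hy j hj)
      refine ⟨fun h0 => ?_, fun j hj => ⟨hlt j hj, h j hj⟩⟩
      have := hlt 0 (by omega)
      unfold lastTime at this
      omega
  have h0 := hy 0 (by omega)
  have h1 := runSum_one_le_one hmeas hlaw hindep y
  rw [hset, runSum_profileWeight h1 K hy 0, runSum_profileWeight h1 K hy 1, if_neg (by omega),
    zero_add] at h
  rw [h]
  -- The factors `2 y j` from the run sums cancel the normalisations `(2 y j)⁻¹` of the exponential
  -- densities.
  have hc : (∏ j ∈ range (K + 1), (2 * (y j : ℝ≥0∞))⁻¹ * expMeasure (2 * y j) (B j)) *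
      ∏ j ∈ range (K + 1), 2 * (y j : ℝ≥0∞) = ∏ j ∈ range (K + 1), expMeasure (2 * y j) (B j) := by
    rw [← prod_mul_distrib]
    refine prod_congr rfl fun j hj => ?_
    have hj' := hy j (by have := mem_range.1 hj; omega)
    rw [mul_right_comm, ENNReal.inv_mul_cancel, one_mul]
    · simpa using hj'.ne'
    · exact ENNReal.mul_ne_top (by simp) (by simp)
  by_cases hy1 : y 0 = 1
  · rw [if_pos hy1, if_pos hy1.symm, ← hc]; ring
  · rw [if_neg hy1, if_neg (Ne.symm hy1)]; simp

end

/-! ### The lazy chain and its survival probabilities -/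

lemma one_add_P₀_succ (k j : ℕ) : (1 + P₀ : Matrix ℕ ℕ ℝ) (k + 1) j =
    if j = k + 1 then 1 else if j = k ∨ j = k + 2 then 1 / 2 else 0 := by
  have h := lazyMatrix_of_pos (Nat.succ_pos k) j
  rw [lazyMatrix, Matrix.smul_apply, smul_eq_mul] at h
  have h2 : (1 + P₀ : Matrix ℕ ℕ ℝ) (k + 1) j = 2 * (1 / 2 * (1 + P₀ : Matrix ℕ ℕ ℝ) (k + 1) j) := by
    ring
  rw [h2, h]
  by_cases h3 : j = k + 1
  · simp [h3]
  · rw [if_neg h3, if_neg h3]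
    by_cases h4 : j = k ∨ j = k + 2
    · rw [if_pos h4, if_pos (by omega)]; norm_num
    · rw [if_neg h4, if_neg (by omega)]; norm_num

lemma one_add_P₀_zero (j : ℕ) : (1 + P₀ : Matrix ℕ ℕ ℝ) 0 j = if j = 0 then 2 else 0 := by
  have h := lazyMatrix_zero j
  rw [lazyMatrix, Matrix.smul_apply, smul_eq_mul] at h
  have h2 : (1 + P₀ : Matrix ℕ ℕ ℝ) 0 j = 2 * (1 / 2 * (1 + P₀ : Matrix ℕ ℕ ℝ) 0 j) := by ring
  rw [h2, h]
  split_ifs <;> norm_num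

lemma lazyMatrix_succ_eq_zero {k b : ℕ} (hb : b ∉ ({k, k + 1, k + 2} : Finset ℕ)) :
    lazyMatrix (k + 1) b = 0 := by
  simp only [mem_insert, mem_singleton, not_or] at hb
  rw [lazyMatrix_of_pos (Nat.succ_pos k), if_neg hb.2.1, if_neg (by omega)]

lemma lazyMatrix_succ_self (k : ℕ) : lazyMatrix (k + 1) (k + 1) = 1 / 2 := by
  rw [lazyMatrix_of_pos (Nat.succ_pos k), if_pos rfl]

lemma lazyMatrix_succ_left (k : ℕ) : lazyMatrix (k + 1) k = 1 / 4 := by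
  rw [lazyMatrix_of_pos (Nat.succ_pos k), if_neg (by omega), if_pos (by omega)]

lemma lazyMatrix_succ_right (k : ℕ) : lazyMatrix (k + 1) (k + 2) = 1 / 4 := by
  rw [lazyMatrix_of_pos (Nat.succ_pos k), if_neg (by omega), if_pos (by omega)]

lemma sum_three {M : Type*} [AddCommMonoid M] (k : ℕ) (f : ℕ → M) :
    ∑ b ∈ ({k, k + 1, k + 2} : Finset ℕ), f b = f k + (f (k + 1) + f (k + 2)) := by
  rw [sum_insert (by simp), sum_insert (by simp), sum_singleton]

lemma tsum_lazyMatrix_succ_mul (k : ℕ) (f : ℕ → ℝ≥0∞) :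
    ∑' b, ENNReal.ofReal (lazyMatrix (k + 1) b) * f b =
      4⁻¹ * (f k + 2 * f (k + 1) + f (k + 2)) := by
  rw [tsum_eq_sum (s := {k, k + 1, k + 2}) fun b hb => by rw [lazyMatrix_succ_eq_zero hb]; simp,
    sum_three, lazyMatrix_succ_self, lazyMatrix_succ_left, lazyMatrix_succ_right, ofReal_half,
    ofReal_quarter]
  have h22 : (2⁻¹ : ℝ≥0∞) = 2 * 4⁻¹ := by
    rw [show (4 : ℝ≥0∞) = 2 * 2 by norm_num, ENNReal.mul_inv (by simp) (by simp),
      ← mul_assoc, ENNReal.mul_inv_cancel (by simp) (by simp), one_mul]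
  rw [h22]
  ring

lemma tsum_lazyMatrix (i : ℕ) : ∑' b, ENNReal.ofReal (lazyMatrix i b) = 1 := by
  cases i with
  | zero =>
    rw [tsum_eq_single 0 fun b hb => by simp [lazyMatrix_zero, hb]]
    simp [lazyMatrix_zero]
  | succ k =>
    have h := tsum_lazyMatrix_succ_mul k fun _ => 1
    simp only [mul_one] at h
    rw [h, show (1 + 2 + 1 : ℝ≥0∞) = 4 by norm_num, ENNReal.inv_mul_cancel (by simp) (by simp)]

theorem hasSum_lazyMatrix_mul (i : ℕ) :
    HasSum (fun j : ℕ => lazyMatrix i j * (j : ℝ)) (i : ℝ) := by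
  cases i with
  | zero =>
    convert! hasSum_zero (α := ℝ) (β := ℕ) using 1
    · ext j
      rw [lazyMatrix_zero]
      split_ifs with h <;> simp [h]
    · simp
  | succ k =>
    have h : HasSum (fun j : ℕ => lazyMatrix (k + 1) j * (j : ℝ))
        (∑ j ∈ ({k, k + 1, k + 2} : Finset ℕ), lazyMatrix (k + 1) j * (j : ℝ)) :=
      hasSum_sum_of_ne_finset_zero fun b hb => by rw [lazyMatrix_succ_eq_zero hb, zero_mul]
    rw [sum_three, lazyMatrix_succ_self, lazyMatrix_succ_left, lazyMatrix_succ_right] at h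
    convert! h using 1
    push_cast
    ring

/-- The probability that the lazy chain started at `i` is positive after `t` steps. -/
noncomputable def survival : ℕ → ℕ → ℝ≥0∞
  | 0, i => if i = 0 then 0 else 1
  | t + 1, i => ∑' b, ENNReal.ofReal (lazyMatrix i b) * survival t b

/-- The number of walks of `2 t` simple steps from `2 i` that avoid zero. -/
def survivalCount (t i : ℕ) : ℕ := ∑ l ∈ range i, (2 * t + 1).choose (t + 1 + l)

lemma survival_zero_right (t : ℕ) : survival t 0 = 0 := by
  induction t with
  | zero => simp [survival]
  | succ t ih =>
    rw [survival, ENNReal.tsum_eq_zero]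
    intro b
    rw [lazyMatrix_zero]
    split_ifs with h
    · rw [h, ih, mul_zero]
    · simp

lemma choose_add_three (t l : ℕ) : (2 * (t + 1) + 1).choose (t + 1 + 1 + l) =
    (2 * t + 1).choose (t + l) + 2 * (2 * t + 1).choose (t + 1 + l) +
      (2 * t + 1).choose (t + 1 + (l + 1)) := by
  have e1 : 2 * (t + 1) + 1 = 2 * t + 1 + 1 + 1 := by ring
  have e2 : t + 1 + 1 + l = t + l + 1 + 1 := by ring
  have e3 : t + 1 + l = t + l + 1 := by ring
  have e4 : t + 1 + (l + 1) = t + l + 1 + 1 := by ring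
  rw [e1, e2, e3, e4, Nat.choose_succ_succ' (2 * t + 1 + 1), Nat.choose_succ_succ' (2 * t + 1),
    Nat.choose_succ_succ' (2 * t + 1)]
  ring

/-- Pascal's rule applied twice gives the increments in `k`. At `k = 0` the binomial lying outside
the sum is replaced by its mirror image in row `2t + 1`; this encodes killing at zero. -/
lemma survivalCount_succ (t k : ℕ) : survivalCount (t + 1) (k + 1) =
    survivalCount t k + 2 * survivalCount t (k + 1) + survivalCount t (k + 2) := by
  induction k with
  | zero =>
    have hsymm : (2 * t + 1).choose t = (2 * t + 1).choose (t + 1) := by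
      rw [← Nat.choose_symm_half]
    have h := choose_add_three t 0
    simp only [add_zero, zero_add, survivalCount, sum_range_zero, sum_range_succ] at h ⊢
    rw [h, hsymm]
    ring
  | succ k ih =>
    have h1 : ∀ t k, survivalCount t (k + 1) = survivalCount t k +
        (2 * t + 1).choose (t + 1 + k) := fun t k => sum_range_succ _ _
    have h := choose_add_three t (k + 1)
    have e : t + (k + 1) = t + 1 + k := by ring
    rw [e] at h
    rw [h1 (t + 1) (k + 1), ih, h, h1 t (k + 2), h1 t (k + 1), h1 t k]
    ring

lemma survival_eq (t i : ℕ) : survival t i = 4⁻¹ ^ t * (survivalCount t i : ℝ≥0∞) := by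
  induction t generalizing i with
  | zero =>
    have : ∀ i, survivalCount 0 i = if i = 0 then 0 else 1 := by
      intro i
      cases i with
      | zero => simp [survivalCount]
      | succ i =>
        rw [survivalCount, sum_range_succ', sum_eq_zero fun l _ => ?_]
        · simp
        · exact Nat.choose_eq_zero_of_lt (by omega)
    rw [this, survival]
    split_ifs <;> simp
  | succ t ih =>
    cases i with
    | zero => rw [survival_zero_right]; simp [survivalCount]
    | succ k =>
      rw [survival, tsum_lazyMatrix_succ_mul, ih, ih, ih, survivalCount_succ]
      push_cast
      ring

lemma survivalCount_one_pos (t : ℕ) : 0 < survivalCount t 1 := by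
  simp only [survivalCount, sum_range_one, add_zero]
  exact Nat.choose_pos (by omega)

lemma survival_one_ne_zero (t : ℕ) : survival t 1 ≠ 0 := by
  rw [survival_eq]
  refine mul_ne_zero (pow_ne_zero _ (by simp)) ?_
  exact_mod_cast (survivalCount_one_pos t).ne'

lemma tendsto_choose_ratio (l : ℕ) :
    Tendsto (fun t : ℕ => ((2 * t + 1).choose (t + 1 + l) : ℝ) / (2 * t + 1).choose (t + 1))
      atTop (𝓝 1) := by
  induction l with
  | zero =>
    refine tendsto_const_nhds.congr fun t => ?_
    have : ((2 * t + 1).choose (t + 1) : ℝ) ≠ 0 := by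
      exact_mod_cast (Nat.choose_pos (by omega)).ne'
    rw [add_zero, div_self this]
  | succ l ih =>
    have hr : Tendsto (fun t : ℕ => ((t : ℝ) - l) / (t + 2 + l)) atTop (𝓝 1) := by
      have h1 : Tendsto (fun t : ℕ => 1 - (2 * (l : ℝ) + 2) / ((t : ℝ) + (2 + l))) atTop
          (𝓝 (1 - 0)) := by
        refine tendsto_const_nhds.sub (Tendsto.div_atTop tendsto_const_nhds ?_)
        exact tendsto_atTop_add_const_right _ _ tendsto_natCast_atTop_atTop
      rw [sub_zero] at h1
      refine h1.congr fun t => ?_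
      have : (t : ℝ) + (2 + l) ≠ 0 := by positivity
      have : (t : ℝ) + 2 + l ≠ 0 := by positivity
      field_simp
      ring
    have h := ih.mul hr
    rw [one_mul] at h
    refine h.congr' ?_
    filter_upwards [eventually_ge_atTop l] with t ht
    have h1 := Nat.choose_succ_right_eq (2 * t + 1) (t + 1 + l)
    have h2 : 2 * t + 1 - (t + 1 + l) = t - l := by omega
    rw [h2] at h1
    have h3 : ((2 * t + 1).choose (t + 1 + (l + 1)) : ℝ) * (t + 2 + l) =
        (2 * t + 1).choose (t + 1 + l) * (t - l) := by
      rw [← Nat.cast_sub ht]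
      have h4 : (2 * t + 1).choose (t + 1 + (l + 1)) * (t + 2 + l) =
          (2 * t + 1).choose (t + 1 + l) * (t - l) := by
        rw [← h1, ← add_assoc]; ring_nf
      exact_mod_cast h4
    have h5 : ((2 * t + 1).choose (t + 1) : ℝ) ≠ 0 := by
      exact_mod_cast (Nat.choose_pos (by omega)).ne'
    have h6 : (t : ℝ) + 2 + l ≠ 0 := by positivity
    rw [div_mul_div_comm, div_eq_div_iff (mul_ne_zero h5 h6) h5, ← h3]
    ring

/-- The count from `i` is a sum of `i` near-central binomials, each asymptotic to the single one
counted from `1`. This is how `h(j) = j` arises. -/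
lemma tendsto_survivalCount_ratio (i : ℕ) :
    Tendsto (fun t : ℕ => (survivalCount t i : ℝ) / survivalCount t 1) atTop (𝓝 i) := by
  have h : Tendsto (fun t : ℕ => ∑ l ∈ range i,
      ((2 * t + 1).choose (t + 1 + l) : ℝ) / (2 * t + 1).choose (t + 1)) atTop
      (𝓝 (∑ _l ∈ range i, (1 : ℝ))) := tendsto_finsetSum _ fun l _ => tendsto_choose_ratio l
  simp only [sum_const, card_range, nsmul_eq_mul, mul_one] at h
  refine h.congr fun t => ?_
  simp only [survivalCount, sum_range_one, add_zero]
  push_cast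
  rw [sum_div]

lemma survival_div_eq (t K i : ℕ) : survival t i / survival (t + K) 1 =
    ENNReal.ofReal ((survivalCount t i : ℝ) / survivalCount t 1 *
      (4 ^ K * survivalCount t 1 / survivalCount (t + K) 1)) := by
  have hp := survivalCount_one_pos t
  have hp2 := survivalCount_one_pos (t + K)
  have hr : ∀ t i, survival t i = ENNReal.ofReal ((4 : ℝ)⁻¹ ^ t * survivalCount t i) := by
    intro t i
    rw [survival_eq, ENNReal.ofReal_mul (by positivity), ENNReal.ofReal_pow (by norm_num),
      ENNReal.ofReal_inv_of_pos (by norm_num)]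
    simp
  rw [hr, hr, ← ENNReal.ofReal_div_of_pos (by positivity)]
  congr 1
  have h1 : (survivalCount t 1 : ℝ) ≠ 0 := by exact_mod_cast hp.ne'
  have h2 : (survivalCount (t + K) 1 : ℝ) ≠ 0 := by exact_mod_cast hp2.ne'
  rw [pow_add]
  field_simp
  rw [mul_assoc, ← mul_pow]
  norm_num

/-- The recursion gives `survivalCount (t + 1) 1` as twice the count from `1` plus the count from
`2`. Since the ratio of these two tends to `2`, each extra step multiplies the count by
asymptotically `4`. -/
lemma tendsto_survivalCount_shift (K : ℕ) :
    Tendsto (fun t : ℕ => 4 ^ K * (survivalCount t 1 : ℝ) / survivalCount (t + K) 1)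
      atTop (𝓝 1) := by
  have hpos : ∀ t, (survivalCount t 1 : ℝ) ≠ 0 := fun t => by
    exact_mod_cast (survivalCount_one_pos t).ne'
  have hone : Tendsto (fun t : ℕ => 4 * (survivalCount t 1 : ℝ) / survivalCount (t + 1) 1)
      atTop (𝓝 1) := by
    have h := (tendsto_survivalCount_ratio 2).const_add (2 : ℝ)
    have h2 := (h.div_const 4).inv₀ (by norm_num)
    norm_num at h2
    refine h2.congr fun t => ?_
    have h3 := survivalCount_succ t 0
    have h4 : survivalCount t 0 = 0 := by simp [survivalCount]
    rw [h4] at h3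
    have h5 : (survivalCount (t + 1) 1 : ℝ) = 2 * survivalCount t 1 + survivalCount t 2 := by
      exact_mod_cast (by simpa using h3)
    have h6 := hpos t
    have h7 := hpos (t + 1)
    rw [h5] at h7
    rw [h5]
    field_simp
  induction K with
  | zero =>
    refine tendsto_const_nhds.congr fun t => ?_
    rw [pow_zero, one_mul, add_zero, div_self (hpos t)]
  | succ K ih =>
    have h := ih.mul (hone.comp (tendsto_add_atTop_nat K))
    rw [one_mul] at h
    refine h.congr fun t => ?_
    have h1 := hpos t
    have h2 := hpos (t + K)
    have h3 := hpos (t + K + 1)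
    simp only [Function.comp_apply]
    rw [← add_assoc, pow_succ]
    field_simp

theorem tendsto_survival_ratio (K i : ℕ) :
    Tendsto (fun t : ℕ => survival t i / survival (t + K) 1) atTop (𝓝 (i : ℝ≥0∞)) := by
  simp only [survival_div_eq]
  have h := (tendsto_survivalCount_ratio i).mul (tendsto_survivalCount_shift K)
  rw [mul_one] at h
  have h2 := (ENNReal.continuous_ofReal.tendsto _).comp h
  rw [ENNReal.ofReal_natCast] at h2
  exact h2

/-! ### Powers of `1 + P₀` -/

lemma matPow_succ_apply (p : Matrix ℕ ℕ ℝ) (m i j : ℕ) :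
    matPow p (m + 1) i j = ∑' l, p i l * matPow p m l j := rfl

lemma matPow_one_add_P₀_zero (m : ℕ) {j : ℕ} (hj : 1 ≤ j) : matPow (1 + P₀) m 0 j = 0 := by
  induction m with
  | zero => exact Matrix.one_apply_ne (by omega)
  | succ m ih =>
    rw [matPow_succ_apply, tsum_eq_single 0 fun b hb => by rw [one_add_P₀_zero, if_neg hb, zero_mul], ih,
      mul_zero]

lemma matPow_one_add_P₀_succ (m k j : ℕ) : matPow (1 + P₀) (m + 1) (k + 1) j =
    1 / 2 * matPow (1 + P₀) m k j + matPow (1 + P₀) m (k + 1) j +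
      1 / 2 * matPow (1 + P₀) m (k + 2) j := by
  rw [matPow_succ_apply, tsum_eq_sum (s := {k, k + 1, k + 2}), sum_three]
  · simp only [one_add_P₀_succ]
    simp
    ring
  · intro b hb
    simp only [mem_insert, mem_singleton, not_or] at hb
    rw [one_add_P₀_succ, if_neg hb.2.1, if_neg (by tauto), zero_mul]

lemma matPow_one_add_P₀_nonneg (m i j : ℕ) : 0 ≤ matPow (1 + P₀) m i j := by
  induction m generalizing i with
  | zero =>
    rw [matPow, Matrix.one_apply]
    split_ifs <;> norm_num
  | succ m ih =>
    rw [matPow_succ_apply]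
    refine tsum_nonneg fun b => mul_nonneg ?_ (ih b)
    cases i with
    | zero => rw [one_add_P₀_zero]; split_ifs <;> norm_num
    | succ k => rw [one_add_P₀_succ]; split_ifs <;> norm_num

/-! ### Finite trajectories -/

/-- The event that `Y` starts with `y 0, …, y n`. -/
abbrev prefixSet {Ω : Type*} (Y : ℕ → Ω → ℕ) (y : ℕ → ℕ) (n : ℕ) : Set Ω :=
  {ω | ∀ i ≤ n, Y i ω = y i}

lemma prefixSet_succ {Ω : Type*} (Y : ℕ → Ω → ℕ) (y : ℕ → ℕ) (n : ℕ) :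
    prefixSet Y y (n + 1) = prefixSet Y y n ∩ {ω | Y (n + 1) ω = y (n + 1)} := by
  ext ω
  simp only [prefixSet, Set.mem_ofPred_eq, Set.mem_inter_iff]
  constructor
  · exact fun h => ⟨fun i hi => h i (by omega), h _ le_rfl⟩
  · rintro ⟨h1, h2⟩ i hi
    rcases Nat.lt_or_eq_of_le hi with h | rfl
    · exact h1 i (by omega)
    · exact h2

/-- A finite sequence extended by zero. -/
def extendZero {K : ℕ} (y : Fin (K + 1) → ℕ) (j : ℕ) : ℕ :=
  if h : j < K + 1 then y ⟨j, h⟩ else 0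

/-- The product of the exponential distributions with rates `2 y_0, …, 2 y_K`. -/
noncomputable abbrev spacingLaw (y : ℕ → ℕ) (K : ℕ) : Measure (Fin (K + 1) → ℝ) :=
  Measure.pi fun j : Fin (K + 1) => expMeasure (2 * (y j : ℝ))

/-- The probability that the lazy chain started at `1` follows `y` for `K` steps and stays
positive. -/
noncomputable def prefixProb (y : ℕ → ℕ) (K : ℕ) : ℝ≥0∞ :=
  open Classical in if ∀ j ≤ K, 0 < y j then (if y 0 = 1 then pathProb y K else 0) else 0

/-- The mixture of the laws `spacingLaw y K` with weights `prefixProb y K * g (y K)`. -/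
noncomputable def mixture (K : ℕ) (g : ℕ → ℝ≥0∞) (C : Set (Fin (K + 1) → ℝ)) : ℝ≥0∞ :=
  ∑' y : Fin (K + 1) → ℕ,
    prefixProb (extendZero y) K * g (extendZero y K) * spacingLaw (extendZero y) K C

lemma prefixProb_of_pos {y : ℕ → ℕ} {K : ℕ} (h : ∀ j ≤ K, 0 < y j) :
    prefixProb y K = if y 0 = 1 then pathProb y K else 0 := by
  rw [prefixProb, if_pos h]

lemma prefixProb_of_not_pos {y : ℕ → ℕ} {K : ℕ} (h : ¬ ∀ j ≤ K, 0 < y j) :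
    prefixProb y K = 0 := by
  rw [prefixProb, if_neg h]

lemma pathProb_succ (y : ℕ → ℕ) (K : ℕ) :
    pathProb y (K + 1) = pathProb y K * ENNReal.ofReal (lazyMatrix (y K) (y (K + 1))) :=
  prod_range_succ _ _

lemma pathProb_congr {y z : ℕ → ℕ} {K : ℕ} (h : ∀ j ≤ K, y j = z j) :
    pathProb y K = pathProb z K := by
  refine prod_congr rfl fun j hj => ?_
  have := mem_range.1 hj
  rw [h j (by omega), h (j + 1) (by omega)]

lemma prefixProb_ne_top (y : ℕ → ℕ) (K : ℕ) : prefixProb y K ≠ ∞ := by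
  rw [prefixProb]
  split_ifs
  · exact ENNReal.prod_ne_top fun _ _ => ENNReal.ofReal_ne_top
  · simp
  · simp

lemma le_of_prefixProb_ne_zero {y : ℕ → ℕ} {K : ℕ} (h : prefixProb y K ≠ 0) {j : ℕ} (hj : j ≤ K) :
    y j ≤ j + 1 := by
  rw [prefixProb] at h
  split_ifs at h with hpos h0
  · induction j with
    | zero => omega
    | succ j ih =>
      have h1 := ih (by omega)
      have h2 := Finset.prod_ne_zero_iff.1 h j (mem_range.2 (by omega))
      have h3 : lazyMatrix (y j) (y (j + 1)) ≠ 0 := fun h3 => h2 (by rw [h3]; simp)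
      rw [lazyMatrix_of_pos (hpos j (by omega))] at h3
      by_contra hlt
      exact h3 (by rw [if_neg (by omega), if_neg (by omega)])
  · exact absurd rfl h
  · exact absurd rfl h

lemma isProbabilityMeasure_spacingLaw {y : ℕ → ℕ} {K : ℕ} (h : ∀ j ≤ K, 0 < y j) :
    IsProbabilityMeasure (spacingLaw y K) := by
  have : ∀ j : Fin (K + 1), IsProbabilityMeasure (expMeasure (2 * (y j : ℝ))) := fun j =>
    isProbabilityMeasure_expMeasure (by have := h j (by omega); positivity)
  infer_instance

/-- The chain starts at `1` and rises by at most one per step, so only finitely many paths carry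
weight and the limit is taken termwise. -/
theorem tendsto_mixture (K : ℕ) {g : ℕ → ℕ → ℝ≥0∞} {c : ℕ → ℝ≥0∞}
    (hg : ∀ i, Tendsto (fun t => g t i / c t) atTop (𝓝 (i : ℝ≥0∞)))
    (C : Set (Fin (K + 1) → ℝ)) :
    Tendsto (fun t => mixture K (g t) C / c t) atTop (𝓝 (mixture K (fun i => (i : ℝ≥0∞)) C)) := by
  have hsupp : ∀ (g : ℕ → ℝ≥0∞), mixture K g C =
      ∑ y ∈ Fintype.piFinset (fun _ : Fin (K + 1) => range (K + 2)),
        prefixProb (extendZero y) K * g (extendZero y K) * spacingLaw (extendZero y) K C := by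
    intro g
    refine tsum_eq_sum fun y hy => ?_
    have : prefixProb (extendZero y) K = 0 := by
      by_contra hne
      refine hy (Fintype.mem_piFinset.2 fun j => mem_range.2 ?_)
      have h1 := le_of_prefixProb_ne_zero hne (j := j) (by omega)
      simp only [extendZero, j.is_lt, dif_pos, Fin.eta] at h1
      omega
    rw [this, zero_mul, zero_mul]
  simp only [hsupp, div_eq_mul_inv, sum_mul]
  refine tendsto_finsetSum _ fun y _ => ?_
  by_cases hpos : ∀ j ≤ K, 0 < extendZero y j
  · have := isProbabilityMeasure_spacingLaw hpos
    have h1 := ENNReal.Tendsto.mul_const (b := spacingLaw (extendZero y) K C)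
      (ENNReal.Tendsto.const_mul (a := prefixProb (extendZero y) K) (hg (extendZero y K))
        (Or.inr (prefixProb_ne_top _ _))) (Or.inr (measure_ne_top _ _))
    refine h1.congr fun t => ?_
    rw [div_eq_mul_inv]
    ring
  · simp only [prefixProb_of_not_pos hpos, zero_mul]
    exact tendsto_const_nhds

section

variable {Ω : Type*} [MeasurableSpace Ω]

lemma measure_eq_tsum_fiber {ι : Type*} [Countable ι] [MeasurableSpace ι]
    [MeasurableSingletonClass ι] (μ : Measure Ω) {V : Ω → ι} (hV : Measurable V) {E : Set Ω}
    (hE : MeasurableSet E) : μ E = ∑' v, μ ({ω | V ω = v} ∩ E) := by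
  have hm : ∀ v, MeasurableSet {ω | V ω = v} := fun v => hV (measurableSet_singleton v)
  rw [← measure_iUnion (fun v w hvw => ?_) fun v => (hm v).inter hE]
  · congr 1
    ext ω
    simp
  · refine Set.disjoint_left.2 fun ω h1 h2 => hvw ?_
    exact h1.1.symm.trans h2.1

lemma measurableSet_prefixSet {Y : ℕ → Ω → ℕ} (hY : ∀ n, Measurable (Y n)) (y : ℕ → ℕ) (n : ℕ) :
    MeasurableSet (prefixSet Y y n) := by
  simp only [prefixSet, Set.ofPred_forall]
  exact MeasurableSet.iInter fun i => MeasurableSet.iInter fun _ =>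
    hY i (measurableSet_singleton (y i))

lemma measure_eq_tsum_prefixSet (μ : Measure Ω) {Y : ℕ → Ω → ℕ} (hY : ∀ n, Measurable (Y n))
    (K : ℕ) {E : Set Ω} (hE : MeasurableSet E) :
    μ E = ∑' y : Fin (K + 1) → ℕ, μ (prefixSet Y (extendZero y) K ∩ E) := by
  rw [measure_eq_tsum_fiber μ (V := fun ω (j : Fin (K + 1)) => Y j ω)
    (measurable_pi_lambda _ fun j => hY j) hE]
  refine tsum_congr fun y => ?_
  congr 2
  ext ω
  simp only [prefixSet, Set.mem_ofPred_eq, funext_iff]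
  constructor
  · intro h i hi
    simpa [extendZero, Nat.lt_succ_of_le hi] using h ⟨i, Nat.lt_succ_of_le hi⟩
  · intro h j
    have hj := Nat.le_of_lt_succ j.is_lt
    have := h j hj
    simpa [extendZero, hj] using this

lemma measurableSet_forall_le_mem {D : ℕ → Ω → ℝ} (hD : ∀ j, Measurable (D j)) (K : ℕ)
    {B : ℕ → Set ℝ} (hB : ∀ j, MeasurableSet (B j)) :
    MeasurableSet {ω | ∀ j ≤ K, D j ω ∈ B j} := by
  simp only [Set.ofPred_forall]
  exact MeasurableSet.iInter fun i => MeasurableSet.iInter fun _ => hD i (hB i)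

/-- A law that has product form on rectangles, on some event, is a product measure. -/
lemma measure_inter_eq_mul_spacingLaw {μ : Measure Ω} [IsFiniteMeasure μ] {D : ℕ → Ω → ℝ}
    (hD : ∀ j, Measurable (D j)) {H : Set Ω} {y : ℕ → ℕ} {K : ℕ}
    (hy : ∀ j ≤ K, 0 < y j)
    (h : ∀ B : ℕ → Set ℝ, (∀ j, MeasurableSet (B j)) → μ (H ∩ {ω | ∀ j ≤ K, D j ω ∈ B j}) =
      μ H * ∏ j ∈ range (K + 1), expMeasure (2 * (y j : ℝ)) (B j))
    {C : Set (Fin (K + 1) → ℝ)} (hC : MeasurableSet C) :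
    μ (H ∩ {ω | (fun j : Fin (K + 1) => D j ω) ∈ C}) = μ H * spacingLaw y K C := by
  by_cases h0 : μ H = 0
  · rw [h0, zero_mul]
    exact measure_mono_null Set.inter_subset_left h0
  have hDm : Measurable fun ω (j : Fin (K + 1)) => D j ω := measurable_pi_lambda _ fun j => hD j
  have hprob : ∀ j : Fin (K + 1), IsProbabilityMeasure (expMeasure (2 * (y j : ℝ))) := fun j =>
    isProbabilityMeasure_expMeasure (by have := hy j (by omega); positivity)
  have hval : ∀ {C : Set (Fin (K + 1) → ℝ)}, MeasurableSet C →
      ((μ H)⁻¹ • (μ.restrict H).map fun ω (j : Fin (K + 1)) => D j ω) C =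
        (μ H)⁻¹ * μ (H ∩ {ω | (fun j : Fin (K + 1) => D j ω) ∈ C}) := by
    intro C hC
    rw [Measure.smul_apply, smul_eq_mul, Measure.map_apply hDm hC,
      Measure.restrict_apply (hDm hC), Set.inter_comm]
    rfl
  -- The normalised law of `D` on `H` is identified with the product measure by its values on boxes.
  have heq : spacingLaw y K = (μ H)⁻¹ • (μ.restrict H).map fun ω (j : Fin (K + 1)) => D j ω := by
    refine Measure.pi_eq fun s hs => ?_
    rw [hval (MeasurableSet.univ_pi hs)]
    set B : ℕ → Set ℝ := fun j => if hj : j < K + 1 then s ⟨j, hj⟩ else Set.univ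
    have hB : ∀ j, MeasurableSet (B j) := fun j => by
      simp only [B]; split_ifs
      · exact hs _
      · exact MeasurableSet.univ
    have hset : {ω | (fun j : Fin (K + 1) => D j ω) ∈ Set.univ.pi s} =
        {ω | ∀ j ≤ K, D j ω ∈ B j} := by
      ext ω
      simp only [Set.mem_ofPred_eq, Set.mem_univ_pi]
      constructor
      · intro h j hj
        simpa [B, hj] using h ⟨j, Nat.lt_succ_of_le hj⟩
      · intro h j
        have hj := Nat.le_of_lt_succ j.is_lt
        simpa [B, hj] using h j hj
    rw [hset, h B hB, ← mul_assoc, ENNReal.inv_mul_cancel h0 (measure_ne_top _ _), one_mul,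
      Finset.prod_range]
    refine prod_congr rfl fun j _ => ?_
    simp [B, Nat.le_of_lt_succ j.is_lt]
  rw [heq, hval hC, ← mul_assoc, ENNReal.mul_inv_cancel h0 (measure_ne_top _ _), one_mul]

/-- The common form of all laws to be compared: the spacings of the walk, and the exponentials
divided by the lazy chain or by its Doob transform, differ only in `a` and `g`. -/
theorem measure_inter_eq_mixture {μ : Measure Ω} [IsFiniteMeasure μ] {Y : ℕ → Ω → ℕ}
    {D : ℕ → Ω → ℝ} (hY : ∀ n, Measurable (Y n)) (hD : ∀ j, Measurable (D j)) {H : Set Ω}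
    (hH : MeasurableSet H) (K : ℕ) (a : ℝ≥0∞) (g : ℕ → ℝ≥0∞)
    (hpos : ∀ y : ℕ → ℕ, (∀ j ≤ K, 0 < y j) → ∀ B : ℕ → Set ℝ, (∀ j, MeasurableSet (B j)) →
      μ ((prefixSet Y y K ∩ H) ∩ {ω | ∀ j ≤ K, D j ω ∈ B j}) =
        a * (prefixProb y K * g (y K)) * ∏ j ∈ range (K + 1), expMeasure (2 * (y j : ℝ)) (B j))
    (hzero : ∀ y : ℕ → ℕ, (¬ ∀ j ≤ K, 0 < y j) → μ (prefixSet Y y K ∩ H) = 0)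
    {C : Set (Fin (K + 1) → ℝ)} (hC : MeasurableSet C) :
    μ (H ∩ {ω | (fun j : Fin (K + 1) => D j ω) ∈ C}) = a * mixture K g C := by
  have hDm : Measurable fun ω (j : Fin (K + 1)) => D j ω := measurable_pi_lambda _ fun j => hD j
  have hm : MeasurableSet (H ∩ {ω | (fun j : Fin (K + 1) => D j ω) ∈ C}) := hH.inter (hDm hC)
  rw [measure_eq_tsum_prefixSet μ hY K hm, mixture, ← ENNReal.tsum_mul_left]
  refine tsum_congr fun y => ?_
  rw [← Set.inter_assoc]
  by_cases h : ∀ j ≤ K, 0 < extendZero y j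
  · have hmass : μ (prefixSet Y (extendZero y) K ∩ H) =
        a * (prefixProb (extendZero y) K * g (extendZero y K)) := by
      have h1 := hpos _ h (fun _ => Set.univ) fun _ => MeasurableSet.univ
      have h2 : ∏ j ∈ range (K + 1), expMeasure (2 * (extendZero y j : ℝ)) Set.univ = 1 := by
        refine prod_eq_one fun j hj => ?_
        have hj' := h j (by have := mem_range.1 hj; omega)
        have := isProbabilityMeasure_expMeasure (r := 2 * (extendZero y j : ℝ)) (by positivity)
        exact measure_univ
      rw [h2, mul_one] at h1
      simpa using h1
    have h3 := measure_inter_eq_mul_spacingLaw hD (H := prefixSet Y (extendZero y) K ∩ H) h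
      (fun B hB => by rw [hmass]; exact hpos _ h B hB) hC
    rw [hmass] at h3
    rw [mul_assoc] at h3
    exact h3
  · rw [prefixProb_of_not_pos h, zero_mul, zero_mul, mul_zero]
    exact measure_mono_null Set.inter_subset_left (hzero _ h)

/-! ### Markov chains -/

lemma IsMarkovChain.measure_prefixSet_zero {μ : Measure Ω} [IsProbabilityMeasure μ]
    {Y : ℕ → Ω → ℕ} {y₀ : ℕ} {p : Matrix ℕ ℕ ℝ} (hY : IsMarkovChain μ Y y₀ p) (y : ℕ → ℕ) :
    μ (prefixSet Y y 0) = if y 0 = y₀ then 1 else 0 := by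
  have h0 := hY.initial
  split_ifs with h
  · have : μ (prefixSet Y y 0) = μ Set.univ := by
      refine measure_congr ?_
      filter_upwards [h0] with ω hω
      refine eq_iff_iff.2 ⟨fun _ => trivial, fun _ i hi => ?_⟩
      obtain rfl : i = 0 := by omega
      rw [hω, h]
    rw [this, measure_univ]
  · refine measure_mono_null (fun ω hω => ?_) h0
    intro h1
    exact h ((hω 0 le_rfl).symm.trans h1)

lemma IsMarkovChain.measure_prefixSet_inter {μ : Measure Ω} [IsProbabilityMeasure μ]
    {Y : ℕ → Ω → ℕ} {y₀ : ℕ} {p : Matrix ℕ ℕ ℝ} (hY : IsMarkovChain μ Y y₀ p) (y : ℕ → ℕ)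
    (n b : ℕ) : μ (prefixSet Y y n ∩ {ω | Y (n + 1) ω = b}) =
      μ (prefixSet Y y n) * ENNReal.ofReal (p (y n) b) := by
  by_cases h0 : μ (prefixSet Y y n) = 0
  · rw [h0, zero_mul]
    exact measure_mono_null Set.inter_subset_left h0
  · have h := hY.transition n y h0 b
    rw [cond_apply (measurableSet_prefixSet hY.measurable y n)] at h
    rw [← h, ← mul_assoc, ENNReal.mul_inv_cancel h0 (measure_ne_top _ _), one_mul]

theorem IsMarkovChain.measure_prefixSet {μ : Measure Ω} [IsProbabilityMeasure μ]
    {Y : ℕ → Ω → ℕ} {y₀ : ℕ} {p : Matrix ℕ ℕ ℝ} (hY : IsMarkovChain μ Y y₀ p) (y : ℕ → ℕ)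
    (n : ℕ) : μ (prefixSet Y y n) =
      (if y 0 = y₀ then 1 else 0) * ∏ j ∈ range n, ENNReal.ofReal (p (y j) (y (j + 1))) := by
  induction n with
  | zero => rw [hY.measure_prefixSet_zero, prod_range_zero, mul_one]
  | succ n ih => rw [prefixSet_succ, hY.measure_prefixSet_inter, ih, prod_range_succ, mul_assoc]

lemma IsMarkovChain.ae_pos_of_doobTransform {μ : Measure Ω} [IsProbabilityMeasure μ]
    {Y : ℕ → Ω → ℕ} (hY : IsMarkovChain μ Y 1 (doobTransform lazyMatrix fun j => (j : ℝ))) :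
    ∀ᵐ ω ∂μ, ∀ n, 0 < Y n ω := by
  rw [ae_all_iff]
  intro n
  cases n with
  | zero => filter_upwards [hY.initial] with ω hω; rw [hω]; exact one_pos
  | succ n =>
    have hm : MeasurableSet {ω | Y (n + 1) ω = 0} := hY.measurable _ (measurableSet_singleton 0)
    have h0 : μ {ω | Y (n + 1) ω = 0} = 0 := by
      rw [measure_eq_tsum_prefixSet μ hY.measurable n hm, ENNReal.tsum_eq_zero]
      intro y
      rw [hY.measure_prefixSet_inter]
      simp [doobTransform]
    rw [ae_iff]
    simpa using h0

lemma ofReal_doobTransform {i b : ℕ} :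
    ENNReal.ofReal (doobTransform lazyMatrix (fun j => (j : ℝ)) i b) =
      ENNReal.ofReal (lazyMatrix i b) * ENNReal.ofReal ((b : ℝ) / i) := by
  rw [← ENNReal.ofReal_mul (lazyMatrix_nonneg i b), doobTransform, mul_div_assoc]

/-- The ratios `h(y_{j+1}) / h(y_j)` telescope to `h(y_n)`, as `h` equals `1` at the starting state.
-/
lemma IsMarkovChain.measure_prefixSet_doobTransform {μ : Measure Ω} [IsProbabilityMeasure μ]
    {Y : ℕ → Ω → ℕ} (hY : IsMarkovChain μ Y 1 (doobTransform lazyMatrix fun j => (j : ℝ)))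
    {y : ℕ → ℕ} {n : ℕ} (hy : ∀ j ≤ n, 0 < y j) :
    μ (prefixSet Y y n) = prefixProb y n * y n := by
  rw [prefixProb_of_pos hy]
  induction n with
  | zero =>
    rw [hY.measure_prefixSet_zero]
    split_ifs with h <;> simp [pathProb, h]
  | succ n ih =>
    rw [prefixSet_succ, hY.measure_prefixSet_inter, ih fun j hj => hy j (by omega),
      ofReal_doobTransform]
    have h1 := hy n (by omega)
    have h2 : (y n : ℝ≥0∞) * ENNReal.ofReal ((y (n + 1) : ℝ) / y n) = y (n + 1) := by
      rw [← ENNReal.ofReal_natCast (y n), ← ENNReal.ofReal_mul (by positivity),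
        mul_div_cancel₀ _ (by positivity), ENNReal.ofReal_natCast]
    split_ifs with h
    · rw [pathProb_succ, mul_assoc, mul_left_comm (y n : ℝ≥0∞), h2, mul_assoc]
    · simp

lemma IsMarkovChain.measure_prefixSet_lazyMatrix {μ : Measure Ω} [IsProbabilityMeasure μ]
    {Y : ℕ → Ω → ℕ} (hY : IsMarkovChain μ Y 1 lazyMatrix) {y : ℕ → ℕ} {n : ℕ}
    (hy : ∀ j ≤ n, 0 < y j) : μ (prefixSet Y y n) = prefixProb y n := by
  rw [prefixProb_of_pos hy, hY.measure_prefixSet, pathProb]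
  split_ifs <;> simp

lemma exists_zero_pos_succ {y : ℕ → ℕ} {n : ℕ} (h : ¬ ∀ j ≤ n, 0 < y j) (hn : 0 < y n) :
    ∃ j < n, y j = 0 ∧ 0 < y (j + 1) := by
  induction n with
  | zero =>
    exact absurd (fun j hj => by obtain rfl : j = 0 := by omega
                                 exact hn) h
  | succ n ih =>
    rcases Nat.eq_zero_or_pos (y n) with h0 | h0
    · exact ⟨n, by omega, h0, hn⟩
    · obtain ⟨j, hj, h1⟩ := ih (fun h' => h fun j hj => by
        rcases Nat.lt_or_eq_of_le hj with h2 | rfl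
        · exact h' j (by omega)
        · exact hn) h0
      exact ⟨j, by omega, h1⟩

lemma IsMarkovChain.measure_prefixSet_lazyMatrix_of_not_pos {μ : Measure Ω}
    [IsProbabilityMeasure μ] {Y : ℕ → Ω → ℕ} (hY : IsMarkovChain μ Y 1 lazyMatrix) {y : ℕ → ℕ}
    {n : ℕ} (hy : ¬ ∀ j ≤ n, 0 < y j) (hn : 0 < y n) : μ (prefixSet Y y n) = 0 := by
  obtain ⟨j, hj, h0, h1⟩ := exists_zero_pos_succ hy hn
  rw [hY.measure_prefixSet, prod_eq_zero (mem_range.2 hj), mul_zero]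
  rw [h0, lazyMatrix_zero, if_neg h1.ne', ENNReal.ofReal_zero]

/-- Induction on `m` by decomposing over the next state `b`; the ratios `b / y n` and `j / b`
combine to `j / y n`. -/
lemma IsMarkovChain.measure_prefixSet_inter_add {μ : Measure Ω} [IsProbabilityMeasure μ]
    {Y : ℕ → Ω → ℕ} (hY : IsMarkovChain μ Y 1 (doobTransform lazyMatrix fun j => (j : ℝ)))
    (m : ℕ) {j : ℕ} (hj : 1 ≤ j) (n : ℕ) {y : ℕ → ℕ} (hy : 1 ≤ y n) :
    μ (prefixSet Y y n ∩ {ω | Y (n + m) ω = j}) = μ (prefixSet Y y n) *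
      ENNReal.ofReal ((1 / 2) ^ m * matPow (1 + P₀) m (y n) j * ((j : ℝ) / (y n : ℝ))) := by
  induction m generalizing n y with
  | zero =>
    have hyn : (y n : ℝ) ≠ 0 := by positivity
    simp only [add_zero, pow_zero, one_mul, matPow, Matrix.one_apply]
    split_ifs with h
    · have : prefixSet Y y n ∩ {ω | Y n ω = j} = prefixSet Y y n := by
        refine Set.inter_eq_left.2 fun ω hω => ?_
        exact (hω n le_rfl).trans h
      rw [this, ← h, div_self hyn]
      simp
    · have : prefixSet Y y n ∩ {ω | Y n ω = j} = ∅ := by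
        ext ω
        simp only [Set.mem_inter_iff, Set.mem_ofPred_eq, Set.mem_empty_iff_false, iff_false, not_and]
        intro hω h1
        exact h ((hω n le_rfl).symm.trans h1)
      rw [this]
      simp
  | succ m ih =>
    have hm1 : MeasurableSet (prefixSet Y y n ∩ {ω | Y (n + (m + 1)) ω = j}) :=
      (measurableSet_prefixSet hY.measurable y n).inter
        (hY.measurable _ (measurableSet_singleton j))
    have hterm : ∀ b, μ ({ω | Y (n + 1) ω = b} ∩ (prefixSet Y y n ∩ {ω | Y (n + (m + 1)) ω = j})) =
        μ (prefixSet Y y n) * ENNReal.ofReal ((1 / 2) ^ m * ((j : ℝ) / (y n : ℝ))) *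
          (ENNReal.ofReal (lazyMatrix (y n) b) * ENNReal.ofReal (matPow (1 + P₀) m b j)) := by
      intro b
      -- The state `0`, where the ratio `j / b` has no meaning, is handled apart: it is almost
      -- surely never visited, and the matrix powers vanish from `0` to `j ≥ 1`.
      rcases Nat.eq_zero_or_pos b with rfl | hb
      · rw [matPow_one_add_P₀_zero m hj, ENNReal.ofReal_zero, mul_zero, mul_zero]
        refine measure_mono_null (fun ω hω => ?_) (ae_iff.1 hY.ae_pos_of_doobTransform)
        intro h
        exact (h (n + 1)).ne' hω.1
      · set y' : ℕ → ℕ := Function.update y (n + 1) b with hy'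
        have hpre : prefixSet Y y' n = prefixSet Y y n := by
          ext ω
          refine forall₂_congr fun i hi => ?_
          rw [hy', Function.update_of_ne (by omega)]
        have hyn : y' n = y n := by rw [hy', Function.update_of_ne (by omega)]
        have hyb : y' (n + 1) = b := by rw [hy', Function.update_self]
        have hset : {ω | Y (n + 1) ω = b} ∩ (prefixSet Y y n ∩ {ω | Y (n + (m + 1)) ω = j}) =
            prefixSet Y y' (n + 1) ∩ {ω | Y (n + 1 + m) ω = j} := by
          rw [prefixSet_succ, hpre, hyb, ← Set.inter_assoc,
            Set.inter_comm {ω | Y (n + 1) ω = b}, show n + (m + 1) = n + 1 + m by ring]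
        rw [hset, ih (n + 1) (by rw [hyb]; exact hb), prefixSet_succ, hY.measure_prefixSet_inter,
          hpre, hyn, hyb, ofReal_doobTransform]
        have hM := matPow_one_add_P₀_nonneg m b j
        have hb' : (b : ℝ) ≠ 0 := by positivity
        have hyn' : (y n : ℝ) ≠ 0 := by positivity
        have hreal : ENNReal.ofReal ((b : ℝ) / y n) *
            ENNReal.ofReal ((1 / 2) ^ m * matPow (1 + P₀) m b j * ((j : ℝ) / b)) =
            ENNReal.ofReal ((1 / 2) ^ m * ((j : ℝ) / y n)) *
              ENNReal.ofReal (matPow (1 + P₀) m b j) := by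
          rw [← ENNReal.ofReal_mul (by positivity), ← ENNReal.ofReal_mul (by positivity)]
          congr 1
          field_simp
        rw [mul_assoc, mul_assoc, hreal, mul_assoc, mul_left_comm (ENNReal.ofReal (lazyMatrix _ _))]
    rw [measure_eq_tsum_fiber μ (hY.measurable (n + 1)) hm1]
    simp only [hterm]
    obtain ⟨k, hk⟩ : ∃ k, y n = k + 1 := ⟨y n - 1, by omega⟩
    rw [ENNReal.tsum_mul_left, hk, tsum_lazyMatrix_succ_mul, mul_assoc, matPow_one_add_P₀_succ]
    congr 1
    have p1 := matPow_one_add_P₀_nonneg m k j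
    have p2 := matPow_one_add_P₀_nonneg m (k + 1) j
    have p3 := matPow_one_add_P₀_nonneg m (k + 2) j
    have h2 : (2 : ℝ≥0∞) = ENNReal.ofReal 2 := by simp
    rw [← ofReal_quarter, h2, ← ENNReal.ofReal_mul (by norm_num),
      ← ENNReal.ofReal_add p1 (by positivity), ← ENNReal.ofReal_add (by positivity) p3,
      ← ENNReal.ofReal_mul (by norm_num), ← ENNReal.ofReal_mul (by positivity)]
    congr 1
    rw [pow_succ]
    ring

theorem IsMarkovChain.cond_doobTransform_add {μ : Measure Ω} [IsProbabilityMeasure μ]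
    {Y : ℕ → Ω → ℕ} (hY : IsMarkovChain μ Y 1 (doobTransform lazyMatrix fun j => (j : ℝ)))
    (n m : ℕ) {i j : ℕ} (hi : 1 ≤ i) (hj : 1 ≤ j) (h0 : μ {ω | Y n ω = i} ≠ 0) :
    μ[|{ω | Y n ω = i}] {ω | Y (n + m) ω = j} =
      ENNReal.ofReal ((1 / 2) ^ m * matPow (1 + P₀) m i j * ((j : ℝ) / (i : ℝ))) := by
  have hmi : MeasurableSet {ω | Y n ω = i} := hY.measurable n (measurableSet_singleton i)
  have hmj : MeasurableSet {ω | Y (n + m) ω = j} := hY.measurable _ (measurableSet_singleton j)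
  set c := ENNReal.ofReal ((1 / 2) ^ m * matPow (1 + P₀) m i j * ((j : ℝ) / (i : ℝ))) with hc
  have h : μ ({ω | Y n ω = i} ∩ {ω | Y (n + m) ω = j}) = μ {ω | Y n ω = i} * c := by
    rw [measure_eq_tsum_prefixSet μ hY.measurable n (hmi.inter hmj),
      measure_eq_tsum_prefixSet μ hY.measurable n hmi, ← ENNReal.tsum_mul_right]
    refine tsum_congr fun y => ?_
    rw [← Set.inter_assoc]
    by_cases hyi : extendZero y n = i
    · have : prefixSet Y (extendZero y) n ∩ {ω | Y n ω = i} = prefixSet Y (extendZero y) n :=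
        Set.inter_eq_left.2 fun ω hω => (hω n le_rfl).trans hyi
      rw [this, hY.measure_prefixSet_inter_add m hj n (by omega), hyi]
    · have : prefixSet Y (extendZero y) n ∩ {ω | Y n ω = i} = ∅ := by
        ext ω
        simp only [Set.mem_inter_iff, Set.mem_ofPred_eq, Set.mem_empty_iff_false, iff_false,
          not_and]
        exact fun hω h1 => hyi ((hω n le_rfl).symm.trans h1)
      rw [this]
      simp
  rw [cond_apply hmi, h, ← mul_assoc, ENNReal.inv_mul_cancel h0 (measure_ne_top _ _), one_mul]

/-! ### Independent exponential variables -/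

lemma expMeasure_one_preimage_div {r : ℝ} (hr : 0 < r) {B : Set ℝ} (hB : MeasurableSet B) :
    expMeasure 1 ((fun x => x / r) ⁻¹' B) = expMeasure r B := by
  have h1 := isProbabilityMeasure_expMeasure one_pos
  have h2 := isProbabilityMeasure_expMeasure hr
  have hm : Measurable fun x : ℝ => x / r := by fun_prop
  have h3 : IsProbabilityMeasure ((expMeasure 1).map fun x => x / r) :=
    Measure.isProbabilityMeasure_map hm.aemeasurable
  have heq : (expMeasure 1).map (fun x => x / r) = expMeasure r := by
    refine Measure.eq_of_cdf _ _ ?_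
    ext x
    rw [cdf_expMeasure_eq hr, cdf_eq_real, measureReal_def, Measure.map_apply hm measurableSet_Iic]
    have hpre : (fun x : ℝ => x / r) ⁻¹' Set.Iic x = Set.Iic (r * x) := by
      ext z
      simp [div_le_iff₀ hr, mul_comm]
    rw [hpre, ← measureReal_def, ← cdf_eq_real, cdf_expMeasure_eq one_pos, one_mul]
    simp [mul_nonneg_iff_of_pos_left hr]
  rw [← heq, Measure.map_apply hm hB]

/-- On the prefix event the random rates are the constants `2 y j`, so independence of the two
sequences factors the probability and scaling gives the exponential laws. -/
lemma measure_prefixSet_inter_div {μ : Measure Ω} [IsProbabilityMeasure μ] {Y : ℕ → Ω → ℕ}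
    {ε : ℕ → Ω → ℝ} (hε : ∀ j, Measurable (ε j))
    (hlaw : ∀ j, μ.map (ε j) = expMeasure 1) (hind : iIndepFun ε μ)
    (hYε : IndepFun (fun ω j => Y j ω) (fun ω j => ε j ω) μ) {y : ℕ → ℕ} {K : ℕ}
    (hy : ∀ j ≤ K, 0 < y j) {B : ℕ → Set ℝ} (hB : ∀ j, MeasurableSet (B j)) :
    μ (prefixSet Y y K ∩ {ω | ∀ j ≤ K, ε j ω / (2 * (Y j ω : ℝ)) ∈ B j}) =
      μ (prefixSet Y y K) * ∏ j ∈ range (K + 1), expMeasure (2 * (y j : ℝ)) (B j) := by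
  set T : ℕ → Set ℝ := fun j => (fun x => x / (2 * (y j : ℝ))) ⁻¹' B j with hT
  have hTm : ∀ j, MeasurableSet (T j) := fun j =>
    (by fun_prop : Measurable fun x : ℝ => x / (2 * (y j : ℝ))) (hB j)
  have hset : prefixSet Y y K ∩ {ω | ∀ j ≤ K, ε j ω / (2 * (Y j ω : ℝ)) ∈ B j} =
      (fun ω j => Y j ω) ⁻¹' {z : ℕ → ℕ | ∀ j ≤ K, z j = y j} ∩
        (fun ω j => ε j ω) ⁻¹' {z : ℕ → ℝ | ∀ j ≤ K, z j ∈ T j} := by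
    ext ω
    simp only [prefixSet, Set.mem_inter_iff, Set.mem_ofPred_eq, Set.mem_preimage, hT]
    refine and_congr_right fun h => forall₂_congr fun j hj => ?_
    rw [h j hj]
  have hm1 : MeasurableSet {z : ℕ → ℕ | ∀ j ≤ K, z j = y j} := by
    simp only [Set.ofPred_forall]
    exact MeasurableSet.iInter fun j => MeasurableSet.iInter fun _ =>
      measurableSet_eq_fun (measurable_pi_apply j) measurable_const
  have hm2 : MeasurableSet {z : ℕ → ℝ | ∀ j ≤ K, z j ∈ T j} := by
    simp only [Set.ofPred_forall]
    exact MeasurableSet.iInter fun j => MeasurableSet.iInter fun _ =>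
      (measurable_pi_apply j) (hTm j)
  rw [hset, hYε.measure_inter_preimage_eq_mul _ _ hm1 hm2]
  congr 1
  have hset2 : (fun ω j => ε j ω) ⁻¹' {z : ℕ → ℝ | ∀ j ≤ K, z j ∈ T j} =
      ⋂ j ∈ range (K + 1), ε j ⁻¹' T j := by
    ext ω
    simp
  rw [hset2, hind.measure_inter_preimage_eq_mul _ fun j _ => hTm j]
  refine prod_congr rfl fun j hj => ?_
  have hyj := hy j (by have := mem_range.1 hj; omega)
  rw [← Measure.map_apply (hε j) (hTm j), hlaw, hT,
    expMeasure_one_preimage_div (by positivity) (hB j)]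

end

/-! ### The joint law of excursion counts and spacings -/

lemma prefixSet_subset_le_lastTime {Ω : Type*} (X : ℕ → Ω → ℝ) {y : ℕ → ℕ} {n : ℕ}
    (h : 0 < y 0) :
    prefixSet (excursionChain X) y n ⊆ {ω | 1 ≤ lastTime X ω} := fun ω hω =>
  lt_lastTime_of_pos X (by rw [hω 0 (Nat.zero_le _)]; exact h)

section

variable {Ω : Type*} [MeasurableSpace Ω] {P : Measure Ω} [IsProbabilityMeasure P] {X : ℕ → Ω → ℝ}

lemma measure_prefixSet_inter_spacing (hmeas : ∀ i, Measurable (X i))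
    (hlaw : ∀ i, P.map (X i) = laplaceMeasure) (hindep : iIndepFun X P) (K : ℕ) {y : ℕ → ℕ}
    (hy : ∀ j ≤ K, 0 < y j) {B : ℕ → Set ℝ} (hB : ∀ j, MeasurableSet (B j)) :
    P (prefixSet (excursionChain X) y K ∩ {ω | ∀ j ≤ K, spacing X j ω ∈ B j}) =
      2⁻¹ * prefixProb y K * ∏ j ∈ range (K + 1), expMeasure (2 * (y j : ℝ)) (B j) := by
  rw [prefixProb_of_pos hy, ← measure_excursionChain_spacing hmeas hlaw hindep K hy hB]
  congr 1
  ext ω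
  simp only [Set.mem_inter_iff, Set.mem_ofPred_eq, forall_and]

lemma prod_expMeasure_univ {y : ℕ → ℕ} {K : ℕ} (hy : ∀ j ≤ K, 0 < y j) :
    ∏ j ∈ range (K + 1), expMeasure (2 * (y j : ℝ)) Set.univ = 1 := by
  refine prod_eq_one fun j hj => ?_
  have hj' := hy j (by have := mem_range.1 hj; omega)
  have := isProbabilityMeasure_expMeasure (r := 2 * (y j : ℝ)) (by positivity)
  exact measure_univ

lemma measure_prefixSet_excursionChain (hmeas : ∀ i, Measurable (X i))
    (hlaw : ∀ i, P.map (X i) = laplaceMeasure) (hindep : iIndepFun X P) (K : ℕ) {y : ℕ → ℕ}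
    (hy : ∀ j ≤ K, 0 < y j) :
    P (prefixSet (excursionChain X) y K) = 2⁻¹ * prefixProb y K := by
  have h := measure_prefixSet_inter_spacing hmeas hlaw hindep K hy (B := fun _ => Set.univ)
    fun _ => MeasurableSet.univ
  rw [prod_expMeasure_univ hy, mul_one] at h
  simpa using h

lemma ae_excursionChain_pos_of_le (hmeas : ∀ i, Measurable (X i))
    (hlaw : ∀ i, P.map (X i) = laplaceMeasure) (hindep : iIndepFun X P) :
    ∀ᵐ ω ∂P, ∀ j k, j ≤ k → 0 < excursionChain X k ω → 0 < excursionChain X j ω := by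
  filter_upwards [ae_excursionChain_pos_iff hmeas hlaw hindep] with ω hω j k hjk hk
  rw [hω] at hk ⊢
  omega

lemma measure_prefixSet_eq_zero (hmeas : ∀ i, Measurable (X i))
    (hlaw : ∀ i, P.map (X i) = laplaceMeasure) (hindep : iIndepFun X P) {K k : ℕ} (hk : K ≤ k)
    {y : ℕ → ℕ} (hy : ¬ ∀ j ≤ K, 0 < y j) :
    P (prefixSet (excursionChain X) y K ∩ {ω | 0 < excursionChain X k ω}) = 0 := by
  refine measure_mono_null (fun ω hω => ?_)
    (ae_iff.1 (ae_excursionChain_pos_of_le hmeas hlaw hindep))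
  intro h
  refine hy fun j hj => ?_
  rw [← hω.1 j hj]
  exact h j k (by omega) hω.2

/-- Induction on `t` with `K` varying: a split over the next count turns survival for `t + 1` steps
after `K` into survival for `t` steps after `K + 1`, matching the recursion of `survival`. -/
theorem measure_prefixSet_inter_survival (hmeas : ∀ i, Measurable (X i))
    (hlaw : ∀ i, P.map (X i) = laplaceMeasure) (hindep : iIndepFun X P) (t K : ℕ) {y : ℕ → ℕ}
    (hy : ∀ j ≤ K, 0 < y j) {B : ℕ → Set ℝ} (hB : ∀ j, MeasurableSet (B j)) :
    P ((prefixSet (excursionChain X) y K ∩ {ω | 0 < excursionChain X (K + t) ω}) ∩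
        {ω | ∀ j ≤ K, spacing X j ω ∈ B j}) =
      2⁻¹ * (prefixProb y K * survival t (y K)) *
        ∏ j ∈ range (K + 1), expMeasure (2 * (y j : ℝ)) (B j) := by
  have hYm := measurable_excursionChain hmeas
  have hDm := measurable_spacing hmeas
  induction t generalizing K y B with
  | zero =>
    have hset : prefixSet (excursionChain X) y K ∩ {ω | 0 < excursionChain X (K + 0) ω} =
        prefixSet (excursionChain X) y K := Set.inter_eq_left.2 fun ω hω => by
      change 0 < excursionChain X (K + 0) ω
      rw [add_zero, hω K le_rfl]
      exact hy K le_rfl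
    rw [hset, measure_prefixSet_inter_spacing hmeas hlaw hindep K hy hB, survival,
      if_neg (hy K le_rfl).ne', mul_one]
  | succ t ih =>
    have hE : MeasurableSet ((prefixSet (excursionChain X) y K ∩
        {ω | 0 < excursionChain X (K + (t + 1)) ω}) ∩ {ω | ∀ j ≤ K, spacing X j ω ∈ B j}) :=
      ((measurableSet_prefixSet hYm y K).inter (measurableSet_lt measurable_const (hYm _))).inter
        (measurableSet_forall_le_mem hDm K hB)
    rw [measure_eq_tsum_fiber P (hYm (K + 1)) hE, survival, ← ENNReal.tsum_mul_left,
      ← ENNReal.tsum_mul_left, ← ENNReal.tsum_mul_right]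
    refine tsum_congr fun b => ?_
    rcases Nat.eq_zero_or_pos b with rfl | hb
    · rw [survival_zero_right, mul_zero, mul_zero, mul_zero, zero_mul]
      refine measure_mono_null (fun ω hω => ?_)
        (ae_iff.1 (ae_excursionChain_pos_of_le hmeas hlaw hindep))
      intro h
      exact (h (K + 1) (K + (t + 1)) (by omega) hω.2.1.2).ne' hω.1
    · set y' : ℕ → ℕ := Function.update y (K + 1) b with hy'
      -- The additional spacing is left unconstrained, so its exponential factor is `1`.
      set B' : ℕ → Set ℝ := Function.update B (K + 1) Set.univ with hB'
      have hyj : ∀ j ≤ K, y' j = y j := fun j hj => by rw [hy', Function.update_of_ne (by omega)]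
      have hBj : ∀ j ≤ K, B' j = B j := fun j hj => by rw [hB', Function.update_of_ne (by omega)]
      have hyb : y' (K + 1) = b := by rw [hy', Function.update_self]
      have hBb : B' (K + 1) = Set.univ := by rw [hB', Function.update_self]
      have hypos : ∀ j ≤ K + 1, 0 < y' j := fun j hj => by
        rcases Nat.lt_or_eq_of_le hj with h | rfl
        · rw [hyj j (by omega)]; exact hy j (by omega)
        · rw [hyb]; exact hb
      have hBm : ∀ j, MeasurableSet (B' j) := fun j => by
        rcases eq_or_ne j (K + 1) with rfl | h
        · rw [hBb]; exact MeasurableSet.univ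
        · rw [hB', Function.update_of_ne h]; exact hB j
      have hpre : prefixSet (excursionChain X) y' K = prefixSet (excursionChain X) y K := by
        ext ω
        exact forall₂_congr fun i hi => by rw [hyj i hi]
      have hset : {ω | excursionChain X (K + 1) ω = b} ∩ ((prefixSet (excursionChain X) y K ∩
          {ω | 0 < excursionChain X (K + (t + 1)) ω}) ∩ {ω | ∀ j ≤ K, spacing X j ω ∈ B j}) =
          (prefixSet (excursionChain X) y' (K + 1) ∩ {ω | 0 < excursionChain X (K + 1 + t) ω}) ∩
            {ω | ∀ j ≤ K + 1, spacing X j ω ∈ B' j} := by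
        have hspace : {ω | ∀ j ≤ K + 1, spacing X j ω ∈ B' j} =
            {ω | ∀ j ≤ K, spacing X j ω ∈ B j} := by
          ext ω
          simp only [Set.mem_ofPred_eq]
          constructor
          · intro h j hj
            rw [← hBj j hj]
            exact h j (by omega)
          · intro h j hj
            rcases Nat.lt_or_eq_of_le hj with h1 | rfl
            · rw [hBj j (by omega)]; exact h j (by omega)
            · rw [hBb]; trivial
        rw [hspace, prefixSet_succ, hpre, hyb, show K + (t + 1) = K + 1 + t by ring,
          ← Set.inter_assoc, ← Set.inter_assoc, Set.inter_comm {ω | excursionChain X (K + 1) ω = b}]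
      have hprob : prefixProb y' (K + 1) =
          prefixProb y K * ENNReal.ofReal (lazyMatrix (y K) b) := by
        rw [prefixProb_of_pos hypos, prefixProb_of_pos hy, pathProb_succ, hyb, hyj 0 (by omega),
          hyj K le_rfl, pathProb_congr hyj]
        split_ifs <;> simp
      have hprod : ∏ j ∈ range (K + 1 + 1), expMeasure (2 * (y' j : ℝ)) (B' j) =
          ∏ j ∈ range (K + 1), expMeasure (2 * (y j : ℝ)) (B j) := by
        have := isProbabilityMeasure_expMeasure (r := 2 * (b : ℝ)) (by positivity)
        rw [prod_range_succ, hyb, hBb, measure_univ, mul_one]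
        refine prod_congr rfl fun j hj => ?_
        have := mem_range.1 hj
        rw [hyj j (by omega), hBj j (by omega)]
      rw [hset, ih (K + 1) hypos hBm, hprob, hprod, hyb, mul_assoc (prefixProb y K)]

theorem measure_pos_inter_spacing_mem (hmeas : ∀ i, Measurable (X i))
    (hlaw : ∀ i, P.map (X i) = laplaceMeasure) (hindep : iIndepFun X P) (t K : ℕ)
    {C : Set (Fin (K + 1) → ℝ)} (hC : MeasurableSet C) :
    P ({ω | 0 < excursionChain X (K + t) ω} ∩
        {ω | (fun j : Fin (K + 1) => spacing X j ω) ∈ C}) = 2⁻¹ * mixture K (survival t) C := by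
  have hYm := measurable_excursionChain hmeas
  exact measure_inter_eq_mixture hYm (measurable_spacing hmeas)
    (measurableSet_lt measurable_const (hYm _)) K _ _
    (fun y hy B hB => measure_prefixSet_inter_survival hmeas hlaw hindep t K hy hB)
    (fun y hy => measure_prefixSet_eq_zero hmeas hlaw hindep (by omega) hy) hC

theorem measure_lastTime_inter_spacing_mem (hmeas : ∀ i, Measurable (X i))
    (hlaw : ∀ i, P.map (X i) = laplaceMeasure) (hindep : iIndepFun X P) (t K : ℕ)
    {C : Set (Fin (K + 1) → ℝ)} (hC : MeasurableSet C) :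
    P ({ω | K + t + 1 ≤ lastTime X ω} ∩ {ω | (fun j : Fin (K + 1) => spacing X j ω) ∈ C}) =
      2⁻¹ * mixture K (survival t) C := by
  rw [← measure_pos_inter_spacing_mem hmeas hlaw hindep t K hC]
  refine measure_congr ?_
  filter_upwards [ae_excursionChain_pos_iff hmeas hlaw hindep] with ω hω
  exact congrArg (· ∧ _) (propext (hω (K + t)).symm)

lemma mixture_zero_univ (g : ℕ → ℝ≥0∞) : mixture 0 g Set.univ = g 1 := by
  rw [mixture, tsum_eq_single (fun _ => 1)]
  · have hpos : ∀ j ≤ 0, 0 < extendZero (K := 0) (fun _ => 1) j := by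
      intro j hj
      obtain rfl : j = 0 := by omega
      simp [extendZero]
    have := isProbabilityMeasure_spacingLaw hpos
    rw [measure_univ, prefixProb_of_pos hpos]
    simp [extendZero, pathProb]
  · intro y hy
    have h1 : extendZero y 0 ≠ 1 := fun h => hy (by
      ext j
      obtain rfl : j = 0 := Fin.ext (by omega)
      simpa [extendZero] using h)
    rw [prefixProb, if_neg h1]
    simp

theorem measure_succ_le_lastTime (hmeas : ∀ i, Measurable (X i))
    (hlaw : ∀ i, P.map (X i) = laplaceMeasure) (hindep : iIndepFun X P) (m : ℕ) :
    P {ω | m + 1 ≤ lastTime X ω} = 2⁻¹ * survival m 1 := by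
  have h := measure_lastTime_inter_spacing_mem hmeas hlaw hindep m 0 MeasurableSet.univ
  rw [mixture_zero_univ, zero_add] at h
  simpa using h

theorem measure_le_lastTime_ne_zero (hmeas : ∀ i, Measurable (X i))
    (hlaw : ∀ i, P.map (X i) = laplaceMeasure) (hindep : iIndepFun X P) (m : ℕ) :
    P {ω | m ≤ lastTime X ω} ≠ 0 := by
  cases m with
  | zero => simp
  | succ m =>
    rw [measure_succ_le_lastTime hmeas hlaw hindep]
    exact mul_ne_zero (by simp) (survival_one_ne_zero m)

theorem ae_exists_walk_neg (hmeas : ∀ i, Measurable (X i))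
    (hlaw : ∀ i, P.map (X i) = laplaceMeasure) (hindep : iIndepFun X P) :
    ∀ᵐ ω ∂P, ∃ n, walk X n ω < 0 := by
  filter_upwards [ae_ladderTime_ne_zero hmeas hlaw hindep] with ω hω
  obtain ⟨n, hn⟩ := Nat.exists_eq_succ_of_ne_zero hω
  exact ⟨n + 1, ((ladderTime_eq_succ_iff X ω n).1 hn).2⟩

lemma measurableSet_le_lastTime (hmeas : ∀ i, Measurable (X i)) (m : ℕ) :
    MeasurableSet {ω | m ≤ lastTime X ω} :=
  measurableSet_le measurable_const (measurable_lastTime hmeas)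

/-! ### The Markov property of the excursion counts -/

lemma measure_prefixSet_inter_succ (hmeas : ∀ i, Measurable (X i))
    (hlaw : ∀ i, P.map (X i) = laplaceMeasure) (hindep : iIndepFun X P) (n : ℕ) {y : ℕ → ℕ}
    (hy : ∀ j ≤ n, 0 < y j) (b : ℕ) :
    P (prefixSet (excursionChain X) y n ∩ {ω | excursionChain X (n + 1) ω = b}) =
      P (prefixSet (excursionChain X) y n) * ENNReal.ofReal (lazyMatrix (y n) b) := by
  have hYm := measurable_excursionChain hmeas
  set E := prefixSet (excursionChain X) y n
  have hposb : ∀ b, 0 < b → P (E ∩ {ω | excursionChain X (n + 1) ω = b}) =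
      P E * ENNReal.ofReal (lazyMatrix (y n) b) := by
    intro b hb
    set y' : ℕ → ℕ := Function.update y (n + 1) b with hy'
    have hyj : ∀ j ≤ n, y' j = y j := fun j hj => by rw [hy', Function.update_of_ne (by omega)]
    have hyb : y' (n + 1) = b := by rw [hy', Function.update_self]
    have hypos : ∀ j ≤ n + 1, 0 < y' j := fun j hj => by
      rcases Nat.lt_or_eq_of_le hj with h | rfl
      · rw [hyj j (by omega)]; exact hy j (by omega)
      · rw [hyb]; exact hb
    have hpre : prefixSet (excursionChain X) y' n = E := by
      ext ω
      exact forall₂_congr fun i hi => by rw [hyj i hi]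
    have h := measure_prefixSet_excursionChain hmeas hlaw hindep (n + 1) hypos
    rw [prefixSet_succ, hpre, hyb] at h
    rw [h, measure_prefixSet_excursionChain hmeas hlaw hindep n hy, prefixProb_of_pos hypos,
      prefixProb_of_pos hy, pathProb_succ, hyb, hyj 0 (by omega), hyj n le_rfl, pathProb_congr hyj]
    split_ifs <;> simp [mul_assoc]
  -- The joint law is known only for positive counts. The case `b = 0` follows by complement, since
  -- each row of the lazy matrix sums to `1`.
  rcases Nat.eq_zero_or_pos b with rfl | hb
  · have h1 : P E = ∑' b, P (E ∩ {ω | excursionChain X (n + 1) ω = b}) := by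
      rw [measure_eq_tsum_fiber P (hYm (n + 1)) (measurableSet_prefixSet hYm y n)]
      exact tsum_congr fun b => by rw [Set.inter_comm]
    have h2 : P E = ∑' b, P E * ENNReal.ofReal (lazyMatrix (y n) b) := by
      rw [ENNReal.tsum_mul_left, tsum_lazyMatrix, mul_one]
    rw [h2, tsum_eq_zero_add' ENNReal.summable] at h1
    rw [tsum_eq_zero_add' (f := fun b => P (E ∩ {ω | excursionChain X (n + 1) ω = b}))
      ENNReal.summable] at h1
    simp only [hposb _ (Nat.succ_pos _)] at h1
    refine ((ENNReal.add_left_inj ?_).1 h1).symm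
    refine ne_top_of_le_ne_top (measure_ne_top P E) ?_
    nth_rw 2 [h2]
    rw [tsum_eq_zero_add' (f := fun b => P E * ENNReal.ofReal (lazyMatrix (y n) b))
      ENNReal.summable]
    exact le_add_self
  · exact hposb b hb

theorem isMarkovChain_excursionChain (hmeas : ∀ i, Measurable (X i))
    (hlaw : ∀ i, P.map (X i) = laplaceMeasure) (hindep : iIndepFun X P) :
    IsMarkovChain (P[|{ω | 1 ≤ lastTime X ω}]) (excursionChain X) 1 lazyMatrix := by
  have hYm := measurable_excursionChain hmeas
  have hN := measurableSet_le_lastTime hmeas 1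
  refine ⟨hYm, ?_, ?_⟩
  · rw [ae_iff, cond_apply hN]
    have h0 : P ({ω | 1 ≤ lastTime X ω} ∩ {ω | ¬ excursionChain X 0 ω = 1}) = 0 := by
      have hm : MeasurableSet ({ω | 1 ≤ lastTime X ω} ∩ {ω | ¬ excursionChain X 0 ω = 1}) :=
        hN.inter (hYm 0 (measurableSet_singleton 1)).compl
      rw [measure_eq_tsum_fiber P (hYm 0) hm, ENNReal.tsum_eq_zero]
      intro b
      rcases eq_or_ne b 1 with rfl | hb
      · refine measure_mono_null (fun ω hω => ?_) (measure_empty (μ := P))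
        exact hω.2.2 hω.1
      rcases Nat.eq_zero_or_pos b with rfl | hb0
      · refine measure_mono_null (fun ω hω => ?_)
          (ae_iff.1 (ae_excursionChain_pos_iff hmeas hlaw hindep))
        intro h
        exact ((h 0).2 hω.2.1).ne' hω.1
      · have h := measure_prefixSet_excursionChain hmeas hlaw hindep 0 (y := fun _ => b)
          fun _ _ => hb0
        rw [prefixProb, if_neg hb, ite_self, mul_zero] at h
        refine measure_mono_null (fun ω hω => ?_) h
        intro i hi
        obtain rfl : i = 0 := by omega
        exact hω.1
    rw [h0, mul_zero]
  · intro n y hne b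
    have hpm := measurableSet_prefixSet hYm y n
    rw [cond_apply hN] at hne
    have hne' : P ({ω | 1 ≤ lastTime X ω} ∩ prefixSet (excursionChain X) y n) ≠ 0 :=
      fun h => hne (by rw [h, mul_zero])
    rw [cond_cond_eq_cond_inter hN hpm, cond_apply (hN.inter hpm)]
    have key : P ({ω | 1 ≤ lastTime X ω} ∩ prefixSet (excursionChain X) y n ∩
        {ω | excursionChain X (n + 1) ω = b}) =
        P ({ω | 1 ≤ lastTime X ω} ∩ prefixSet (excursionChain X) y n) *
          ENNReal.ofReal (lazyMatrix (y n) b) := by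
      -- From `0` the chain stays at `0`, because positivity of a count almost surely forces
      -- positivity of all earlier ones. A positive `y n` likewise forces a positive prefix, where
      -- the joint law applies.
      rcases Nat.eq_zero_or_pos (y n) with h0 | hpos
      · have hnext : ∀ᵐ ω ∂P, ω ∈ prefixSet (excursionChain X) y n →
            excursionChain X (n + 1) ω = 0 := by
          filter_upwards [ae_excursionChain_pos_of_le hmeas hlaw hindep] with ω hω h
          by_contra hne
          have := hω n (n + 1) (Nat.le_succ n) (Nat.pos_of_ne_zero hne)
          rw [h n le_rfl] at this
          omega
        rw [h0, lazyMatrix_zero]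
        split_ifs with hb
        · rw [ENNReal.ofReal_one, mul_one]
          refine measure_congr ?_
          filter_upwards [hnext] with ω hω
          refine propext ⟨fun h => h.1, fun h => ⟨h, ?_⟩⟩
          exact (hω h.2).trans hb.symm
        · rw [ENNReal.ofReal_zero, mul_zero]
          refine measure_mono_null (fun ω hω => ?_) (ae_iff.1 hnext)
          intro h
          exact hb (hω.2.symm.trans (h hω.1.2))
      · have hall : ∀ j ≤ n, 0 < y j := by
          by_contra hnot
          refine hne' (measure_mono_null (fun ω hω => ?_)
            (measure_prefixSet_eq_zero hmeas hlaw hindep le_rfl hnot))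
          refine ⟨hω.2, ?_⟩
          change 0 < excursionChain X n ω
          rw [hω.2 n le_rfl]
          exact hpos
        rw [Set.inter_eq_right.2 (prefixSet_subset_le_lastTime X (hall 0 (Nat.zero_le _)))]
        exact measure_prefixSet_inter_succ hmeas hlaw hindep n hall b
    rw [key, ← mul_assoc, ENNReal.inv_mul_cancel hne' (measure_ne_top _ _), one_mul]

theorem map_spacing_cond_prefixSet (hmeas : ∀ i, Measurable (X i))
    (hlaw : ∀ i, P.map (X i) = laplaceMeasure) (hindep : iIndepFun X P) (k : ℕ) (y : ℕ → ℕ)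
    (hk : 0 < y k)
    (hne : (P[|{ω | 1 ≤ lastTime X ω}]) (prefixSet (excursionChain X) y k) ≠ 0) :
    ((P[|{ω | 1 ≤ lastTime X ω}])[|prefixSet (excursionChain X) y k]).map
        (fun ω (j : Fin (k + 1)) => spacing X j ω) = spacingLaw y k := by
  have hYm := measurable_excursionChain hmeas
  have hDm := measurable_spacing hmeas
  have hN := measurableSet_le_lastTime hmeas 1
  have hpm := measurableSet_prefixSet hYm y k
  rw [cond_apply hN] at hne
  have hne' : P ({ω | 1 ≤ lastTime X ω} ∩ prefixSet (excursionChain X) y k) ≠ 0 :=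
    fun h => hne (by rw [h, mul_zero])
  have hall : ∀ j ≤ k, 0 < y j := by
    by_contra hnot
    refine hne' (measure_mono_null (fun ω hω => ?_)
      (measure_prefixSet_eq_zero hmeas hlaw hindep le_rfl hnot))
    refine ⟨hω.2, ?_⟩
    change 0 < excursionChain X k ω
    rw [hω.2 k le_rfl]
    exact hk
  rw [cond_cond_eq_cond_inter hN hpm]
  rw [Set.inter_eq_right.2 (prefixSet_subset_le_lastTime X (hall 0 (Nat.zero_le _)))] at hne' ⊢
  ext C hC
  have h := measure_inter_eq_mul_spacingLaw (μ := P) hDm (H := prefixSet (excursionChain X) y k)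
    hall (fun B hB => by
      rw [measure_prefixSet_excursionChain hmeas hlaw hindep k hall]
      exact measure_prefixSet_inter_spacing hmeas hlaw hindep k hall hB) hC
  have hvec : Measurable fun ω (j : Fin (k + 1)) => spacing X j ω :=
    measurable_pi_lambda _ fun j => hDm j
  rw [Measure.map_apply hvec hC, cond_apply hpm]
  change _ * P (_ ∩ {ω | (fun j : Fin (k + 1) => spacing X j ω) ∈ C}) = _
  rw [h, ← mul_assoc, ENNReal.inv_mul_cancel hne' (measure_ne_top _ _), one_mul]

end

/-! ### Exponential variables weighted by a Markov chain -/

section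

variable {Ω : Type*} [MeasurableSpace Ω] {μ : Measure Ω} [IsProbabilityMeasure μ] {Y : ℕ → Ω → ℕ}
  {ε : ℕ → Ω → ℝ}

lemma measurable_div_chain (hY : ∀ n, Measurable (Y n)) (hε : ∀ j, Measurable (ε j)) (j : ℕ) :
    Measurable fun ω => ε j ω / (2 * (Y j ω : ℝ)) :=
  (hε j).div (measurable_const.mul (measurable_from_nat.comp (hY j)))

theorem IsMarkovChain.measure_pos_inter_div_mem (hY : IsMarkovChain μ Y 1 lazyMatrix)
    (hε : ∀ j, Measurable (ε j)) (hlaw : ∀ j, μ.map (ε j) = expMeasure 1) (hind : iIndepFun ε μ)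
    (hYε : IndepFun (fun ω j => Y j ω) (fun ω j => ε j ω) μ) (K : ℕ)
    {C : Set (Fin (K + 1) → ℝ)} (hC : MeasurableSet C) :
    μ ({ω | 0 < Y K ω} ∩ {ω | (fun j : Fin (K + 1) => ε j ω / (2 * (Y j ω : ℝ))) ∈ C}) =
      mixture K (survival 0) C := by
  rw [measure_inter_eq_mixture (D := fun j ω => ε j ω / (2 * (Y j ω : ℝ))) hY.measurable
    (measurable_div_chain hY.measurable hε) (measurableSet_lt measurable_const (hY.measurable K)) K
    1 (survival 0) (fun y hy B hB => ?_) (fun y hy => ?_) hC, one_mul]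
  · have hset : prefixSet Y y K ∩ {ω | 0 < Y K ω} = prefixSet Y y K :=
      Set.inter_eq_left.2 fun ω hω => by
        change 0 < Y K ω
        rw [hω K le_rfl]
        exact hy K le_rfl
    rw [hset, measure_prefixSet_inter_div hε hlaw hind hYε hy hB,
      hY.measure_prefixSet_lazyMatrix hy, survival, if_neg (hy K le_rfl).ne', mul_one, one_mul]
  · rcases Nat.eq_zero_or_pos (y K) with h0 | h0
    · refine measure_mono_null (fun ω hω => ?_) (measure_empty (μ := μ))
      have h1 : 0 < Y K ω := hω.2
      rw [hω.1 K le_rfl, h0] at h1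
      exact lt_irrefl _ h1
    · exact measure_mono_null Set.inter_subset_left
        (hY.measure_prefixSet_lazyMatrix_of_not_pos hy h0)

theorem IsMarkovChain.measure_div_mem_of_doobTransform
    (hY : IsMarkovChain μ Y 1 (doobTransform lazyMatrix fun j => (j : ℝ)))
    (hε : ∀ j, Measurable (ε j)) (hlaw : ∀ j, μ.map (ε j) = expMeasure 1) (hind : iIndepFun ε μ)
    (hYε : IndepFun (fun ω j => Y j ω) (fun ω j => ε j ω) μ) (K : ℕ)
    {C : Set (Fin (K + 1) → ℝ)} (hC : MeasurableSet C) :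
    μ {ω | (fun j : Fin (K + 1) => ε j ω / (2 * (Y j ω : ℝ))) ∈ C} =
      mixture K (fun i => (i : ℝ≥0∞)) C := by
  have h := measure_inter_eq_mixture (μ := μ) (D := fun j ω => ε j ω / (2 * (Y j ω : ℝ)))
    hY.measurable (measurable_div_chain hY.measurable hε) MeasurableSet.univ K 1
    (fun i => (i : ℝ≥0∞)) (fun y hy B hB => ?_) (fun y hy => ?_) hC
  · rwa [Set.univ_inter, one_mul] at h
  · rw [Set.inter_univ, measure_prefixSet_inter_div hε hlaw hind hYε hy hB,
      hY.measure_prefixSet_doobTransform hy, one_mul]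
  · rw [Set.inter_univ]
    refine measure_mono_null (fun ω hω => ?_) (ae_iff.1 hY.ae_pos_of_doobTransform)
    intro h
    exact hy fun j hj => by rw [← hω j hj]; exact h j

end

/-! ### Spacings conditioned on a long walk -/

section

variable {Ω : Type*} [MeasurableSpace Ω] {P : Measure Ω} [IsProbabilityMeasure P] {X : ℕ → Ω → ℝ}

theorem cond_spacing_mem (hmeas : ∀ i, Measurable (X i))
    (hlaw : ∀ i, P.map (X i) = laplaceMeasure) (hindep : iIndepFun X P) (t K : ℕ)
    {C : Set (Fin (K + 1) → ℝ)} (hC : MeasurableSet C) :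
    P[|{ω | K + t + 1 ≤ lastTime X ω}] {ω | (fun j : Fin (K + 1) => spacing X j ω) ∈ C} =
      mixture K (survival t) C / survival (t + K) 1 := by
  have h2 : (2⁻¹ : ℝ≥0∞) ≠ 0 := by simp
  have h2' : (2⁻¹ : ℝ≥0∞) ≠ ∞ := by simp
  rw [cond_apply (measurableSet_le_lastTime hmeas _),
    measure_lastTime_inter_spacing_mem hmeas hlaw hindep t K hC,
    measure_succ_le_lastTime hmeas hlaw hindep, mul_comm, ← div_eq_mul_inv, add_comm K t,
    ENNReal.mul_div_mul_left _ _ h2 h2']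

/-- A deterministic identity, obtained by evaluating the probability of `ν ≥ K + t + 1` through
prefixes of two different lengths. -/
theorem mixture_univ_eq_survival (hmeas : ∀ i, Measurable (X i))
    (hlaw : ∀ i, P.map (X i) = laplaceMeasure) (hindep : iIndepFun X P) (t K : ℕ) :
    mixture K (survival t) Set.univ = survival (t + K) 1 := by
  have h := measure_lastTime_inter_spacing_mem hmeas hlaw hindep t K MeasurableSet.univ
  have h2 : {ω | (fun j : Fin (K + 1) => spacing X j ω) ∈ Set.univ} = Set.univ := by simp
  rw [h2, Set.inter_univ, measure_succ_le_lastTime hmeas hlaw hindep, add_comm K t] at h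
  exact ((ENNReal.mul_right_inj (by simp) (by simp)).1 h).symm

/-- Both conditional laws equal `mixture k (survival 0)` divided by the survival probability
`survival k 1`. -/
theorem map_spacing_eq_map_div (hmeas : ∀ i, Measurable (X i))
    (hlaw : ∀ i, P.map (X i) = laplaceMeasure) (hindep : iIndepFun X P) {Ω' : Type*}
    [MeasurableSpace Ω'] {P' : Measure Ω'} [IsProbabilityMeasure P'] {Y : ℕ → Ω' → ℕ}
    {ε : ℕ → Ω' → ℝ} (hY : IsMarkovChain P' Y 1 lazyMatrix) (hε : ∀ j, Measurable (ε j))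
    (hεlaw : ∀ j, P'.map (ε j) = expMeasure 1) (hind : iIndepFun ε P')
    (hYε : IndepFun (fun ω j => Y j ω) (fun ω j => ε j ω) P') (k : ℕ) :
    P' {ω | 0 < Y k ω} ≠ 0 ∧
      (P[|{ω | k + 1 ≤ lastTime X ω}]).map (fun ω (j : Fin (k + 1)) => spacing X j ω) =
        (P'[|{ω | 0 < Y k ω}]).map (fun ω (j : Fin (k + 1)) => ε j ω / (2 * (Y j ω : ℝ))) := by
  have hH : P' {ω | 0 < Y k ω} = survival (0 + k) 1 := by
    have h := hY.measure_pos_inter_div_mem hε hεlaw hind hYε k MeasurableSet.univ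
    rw [mixture_univ_eq_survival hmeas hlaw hindep] at h
    simpa using h
  refine ⟨by rw [hH]; exact survival_one_ne_zero _, ?_⟩
  have h1 : Measurable fun ω (j : Fin (k + 1)) => spacing X j ω :=
    measurable_pi_lambda _ fun j => measurable_spacing hmeas j
  have h2 : Measurable fun ω (j : Fin (k + 1)) => ε j ω / (2 * (Y j ω : ℝ)) :=
    measurable_pi_lambda _ fun j => measurable_div_chain hY.measurable hε j
  ext C hC
  rw [Measure.map_apply h1 hC, Measure.map_apply h2 hC,
    cond_apply (measurableSet_lt measurable_const (hY.measurable k)), hH]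
  refine (cond_spacing_mem hmeas hlaw hindep 0 k hC).trans ?_
  rw [div_eq_mul_inv, mul_comm, ← hY.measure_pos_inter_div_mem hε hεlaw hind hYε k hC]
  rfl

theorem tendsto_cond_spacing_mem (hmeas : ∀ i, Measurable (X i))
    (hlaw : ∀ i, P.map (X i) = laplaceMeasure) (hindep : iIndepFun X P) {Ω' : Type*}
    [MeasurableSpace Ω'] {P' : Measure Ω'} [IsProbabilityMeasure P'] {Y : ℕ → Ω' → ℕ}
    {ε : ℕ → Ω' → ℝ} (hY : IsMarkovChain P' Y 1 (doobTransform lazyMatrix fun j => (j : ℝ)))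
    (hε : ∀ j, Measurable (ε j)) (hεlaw : ∀ j, P'.map (ε j) = expMeasure 1)
    (hind : iIndepFun ε P') (hYε : IndepFun (fun ω j => Y j ω) (fun ω j => ε j ω) P') (k : ℕ)
    {C : Set (Fin (k + 1) → ℝ)} (hC : MeasurableSet C) :
    Tendsto (fun m => P[|{ω | m ≤ lastTime X ω}] {ω | (fun j : Fin (k + 1) => spacing X j ω) ∈ C})
      atTop (𝓝 (P' {ω | (fun j : Fin (k + 1) => ε j ω / (2 * (Y j ω : ℝ))) ∈ C})) := by
  -- Writing the threshold as `m = t + (k + 1)` leaves exactly `t` steps of survival after the last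
  -- recorded count.
  rw [← tendsto_add_atTop_iff_nat (k + 1), hY.measure_div_mem_of_doobTransform hε hεlaw hind hYε k hC]
  refine (tendsto_mixture k (g := survival) (fun i => tendsto_survival_ratio k i) C).congr fun t => ?_
  rw [← cond_spacing_mem hmeas hlaw hindep t k hC, show t + (k + 1) = k + t + 1 by ring]

theorem tendstoInDistribution_spacing (hmeas : ∀ i, Measurable (X i))
    (hlaw : ∀ i, P.map (X i) = laplaceMeasure) (hindep : iIndepFun X P) {Ω' : Type*}
    [MeasurableSpace Ω'] {P' : Measure Ω'} [IsProbabilityMeasure P'] {Y : ℕ → Ω' → ℕ}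
    {ε : ℕ → Ω' → ℝ} (hY : IsMarkovChain P' Y 1 (doobTransform lazyMatrix fun j => (j : ℝ)))
    (hε : ∀ j, Measurable (ε j)) (hεlaw : ∀ j, P'.map (ε j) = expMeasure 1)
    (hind : iIndepFun ε P') (hYε : IndepFun (fun ω j => Y j ω) (fun ω j => ε j ω) P') (k : ℕ)
    [∀ m : ℕ, IsProbabilityMeasure (P[|{ω | m ≤ lastTime X ω}])] :
    TendstoInDistribution (fun (_ : ℕ) ω (j : Fin k) => spacing X j ω) atTop
      (fun ω (j : Fin k) => ε j ω / (2 * (Y j ω : ℝ)))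
      (fun m : ℕ => P[|{ω | m ≤ lastTime X ω}]) P' := by
  have h1 : Measurable fun ω (j : Fin k) => spacing X j ω :=
    measurable_pi_lambda _ fun j => measurable_spacing hmeas j
  have h2 : Measurable fun ω (j : Fin k) => ε j ω / (2 * (Y j ω : ℝ)) :=
    measurable_pi_lambda _ fun j => measurable_div_chain hY.measurable hε j
  refine ⟨fun m => h1.aemeasurable, h2.aemeasurable, ?_⟩
  -- Setwise convergence on measurable sets is stronger than needed; open sets suffice by the
  -- portmanteau theorem.
  refine tendsto_of_forall_isOpen_le_liminf' fun G hG => ?_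
  -- The set limit concerns `k + 1` coordinates. Pulling back along the projection that drops the
  -- last one also covers `k = 0`.
  have hres : Measurable fun (v : Fin (k + 1) → ℝ) (j : Fin k) => v j.castSucc :=
    measurable_pi_lambda _ fun j => measurable_pi_apply _
  have h := tendsto_cond_spacing_mem hmeas hlaw hindep hY hε hεlaw hind hYε k
    (hres hG.measurableSet)
  simp only [ProbabilityMeasure.coe_mk, Measure.map_apply h1 hG.measurableSet,
    Measure.map_apply h2 hG.measurableSet]
  exact h.liminf_eq.ge

end

end LaplaceWalk

theorem mainTheorem9 {Ω : Type*} [MeasurableSpace Ω] (P : Measure Ω) [IsProbabilityMeasure P]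
    (X : ℕ → Ω → ℝ) (hmeas : ∀ i, Measurable (X i))
    (hlaw : ∀ i, P.map (X i) = LaplaceWalk.laplaceMeasure)
    (hindep : iIndepFun X P) :
    -- the ladder time is almost surely finite, and all conditionings below make sense
    (∀ᵐ ω ∂P, ∃ n, LaplaceWalk.walk X n ω < 0) ∧
    (∀ m : ℕ, P {ω | m ≤ LaplaceWalk.lastTime X ω} ≠ 0) ∧
    (∀ k, Measurable (LaplaceWalk.spacing X k)) ∧
    -- given `ν ≥ 1`, the chain of excursion counts is Markov
    LaplaceWalk.IsMarkovChain (P[|{ω | 1 ≤ LaplaceWalk.lastTime X ω}])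
      (LaplaceWalk.excursionChain X) 1 LaplaceWalk.lazyMatrix ∧
    -- conditional law of the first `k + 1` spacings given the first `k + 1` excursion counts
    (∀ (k : ℕ) (y : ℕ → ℕ), 0 < y k →
      (P[|{ω | 1 ≤ LaplaceWalk.lastTime X ω}])
        {ω | ∀ i ≤ k, LaplaceWalk.excursionChain X i ω = y i} ≠ 0 →
      ((P[|{ω | 1 ≤ LaplaceWalk.lastTime X ω}])[|{ω | ∀ i ≤ k,
          LaplaceWalk.excursionChain X i ω = y i}]).map
          (fun ω (j : Fin (k + 1)) => LaplaceWalk.spacing X j ω) =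
        Measure.pi fun j : Fin (k + 1) => expMeasure (2 * (y j : ℝ))) ∧
    -- identity in law of the first `k + 1` spacings given `ν ≥ k + 1`
    (∀ (Ω' : Type*) [MeasurableSpace Ω'] (P' : Measure Ω') [IsProbabilityMeasure P']
      (Y : ℕ → Ω' → ℕ) (ε : ℕ → Ω' → ℝ),
      LaplaceWalk.IsMarkovChain P' Y 1 LaplaceWalk.lazyMatrix →
      (∀ j, Measurable (ε j)) → (∀ j, P'.map (ε j) = expMeasure 1) → iIndepFun ε P' →
      IndepFun (fun ω j => Y j ω) (fun ω j => ε j ω) P' →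
      ∀ k : ℕ, P' {ω | 0 < Y k ω} ≠ 0 ∧
        (P[|{ω | k + 1 ≤ LaplaceWalk.lastTime X ω}]).map
            (fun ω (j : Fin (k + 1)) => LaplaceWalk.spacing X j ω) =
          (P'[|{ω | 0 < Y k ω}]).map
            (fun ω (j : Fin (k + 1)) => ε j ω / (2 * (Y j ω : ℝ)))) ∧
    -- `h(j) = j` is harmonic
    (∀ i : ℕ, HasSum (fun j : ℕ => LaplaceWalk.lazyMatrix i j * (j : ℝ)) (i : ℝ)) ∧
    -- the `h`-transformed chain: its transition probabilities, and the limit law given `ν ≥ m`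
    (∀ (Ω' : Type*) [MeasurableSpace Ω'] (P' : Measure Ω') [IsProbabilityMeasure P']
      (Y : ℕ → Ω' → ℕ) (ε : ℕ → Ω' → ℝ),
      LaplaceWalk.IsMarkovChain P' Y 1
        (LaplaceWalk.doobTransform LaplaceWalk.lazyMatrix fun j => (j : ℝ)) →
      (∀ j, Measurable (ε j)) → (∀ j, P'.map (ε j) = expMeasure 1) → iIndepFun ε P' →
      IndepFun (fun ω j => Y j ω) (fun ω j => ε j ω) P' →
      (∀ᵐ ω ∂P', ∀ n, 0 < Y n ω) ∧
      (∀ n m i j : ℕ, 1 ≤ i → 1 ≤ j → P' {ω | Y n ω = i} ≠ 0 →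
        P'[|{ω | Y n ω = i}] {ω | Y (n + m) ω = j} =
          ENNReal.ofReal ((1 / 2) ^ m * LaplaceWalk.matPow (1 + LaplaceWalk.P₀) m i j
            * ((j : ℝ) / (i : ℝ)))) ∧
      ∀ k : ℕ, ∃ _ : ∀ m : ℕ, IsProbabilityMeasure (P[|{ω | m ≤ LaplaceWalk.lastTime X ω}]),
        TendstoInDistribution
          (fun (_ : ℕ) ω (j : Fin k) => LaplaceWalk.spacing X j ω) atTop
          (fun ω (j : Fin k) => ε j ω / (2 * (Y j ω : ℝ)))
          (fun m : ℕ => P[|{ω | m ≤ LaplaceWalk.lastTime X ω}]) P') := by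
  open LaplaceWalk in
  refine ⟨ae_exists_walk_neg hmeas hlaw hindep, measure_le_lastTime_ne_zero hmeas hlaw hindep,
    measurable_spacing hmeas, isMarkovChain_excursionChain hmeas hlaw hindep,
    fun k y hk hne => map_spacing_cond_prefixSet hmeas hlaw hindep k y hk hne,
    fun Ω' _ P' _ Y ε hY hε hεlaw hind hYε k =>
      map_spacing_eq_map_div hmeas hlaw hindep hY hε hεlaw hind hYε k,
    hasSum_lazyMatrix_mul, fun Ω' _ P' _ Y ε hY hε hεlaw hind hYε =>
      ⟨hY.ae_pos_of_doobTransform, fun n m i j hi hj h0 => hY.cond_doobTransform_add n m hi hj h0,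
        fun k => ?_⟩⟩
  have hprob : ∀ m : ℕ, IsProbabilityMeasure (P[|{ω | m ≤ LaplaceWalk.lastTime X ω}]) := fun m =>
    cond_isProbabilityMeasure (LaplaceWalk.measure_le_lastTime_ne_zero hmeas hlaw hindep m)
  exact ⟨hprob,
    LaplaceWalk.tendstoInDistribution_spacing hmeas hlaw hindep hY hε hεlaw hind hYε k⟩
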